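/- Let $\Bbbk$ be a field of characteristic zero, let $a,b,k,p,q\in\Bbbk$ and let $V$ be the vector space with basis $x_1,x_2,x_3$ and braiding $c$ (the braiding of type $\mathfrak R_{1,2}$ with $t=1$) \begin{align*} c(x_i\otimes x_1)&=x_1\otimes x_i,\quad c(x_i\otimes x_2)=x_2\otimes x_i\quad (i=1,2), & c(x_1\otimes x_3)&=(x_3+p\,x_1)\otimes x_1,\\ c(x_3\otimes x_1)&=x_1\otimes x_3+b\,x_1\otimes x_1, & c(x_2\otimes x_3)&=(x_3+q\,x_1)\otimes x_2,\\ c(x_3\otimes x_2)&=x_2\otimes x_3+b\,x_2\otimes x_1+(p-q)\,x_1\otimes x_2,\\ c(x_3\otimes x_3)&=x_3\otimes x_3+b\,x_3\otimes x_1+p\,x_1\otimes x_3+k\,(x_1\otimes x_2-x_2\otimes x_1)+a\,x_1\otimes x_1. \end{align*} Let $T(V)$ be the tensor algebra, a braided Hopf algebra in which the elements of $V$ are primitive, let $\mathcal J(V)$ be its largest homogeneous Hopf ideal generated by homogeneous elements of degree $\ge 2$, and let $\mathfrak B(V)=T(V)/\mathcal J(V)$ be the Nichols algebra of $(V,c)$.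 Define $z_0=x_2$ and, for $n\ge 1$, $$z_n=(x_3-nb\,x_1)z_{n-1}-z_{n-1}x_3+(n-1)!\,(q-p)\Big(\frac{-b-p}{2}\Big)^{n-1}x_1^nx_2 ,\qquad \beta_n=-n\Big(\frac{n+1}{2}\,b+\frac{n-1}{2}\,p+q\Big),$$ with the convention $0^0=1$. Assume that $b\ne p-2q$, and consider the relations $$(1)\ \ x_2x_1-x_1x_2,\quad x_3x_1-x_1x_3+\tfrac{p-b}{2}\,x_1^2;\qquad\qquad (2)\ \ z_{n+1}z_n-z_nz_{n+1}\quad (n\ge 0).$$ (a) If $\beta_n\neq 0$ for all $n\ge 1$, then $\mathcal J(V)$ is the two-sided ideal generated by (1) and (2); the monomials $x_1^{a_1}x_2^{a_2}z_1^{b_1}\cdots z_n^{b_n}x_3^{a_3}$ ($n\ge1$, $a_i,b_j\ge 0$), indexed by $(a_1,a_2,a_3)\in\mathbb N_0^3$ and the finitely supported sequence $(b_j)_{j\ge 1}$ of exponents, form a basis (the PBW-basis $B_\infty$) of $\mathfrak B(V)$; and $\operatorname{GKdim}\mathfrak B(V)=\infty$. (b) Otherwise there is a unique $N\ge 1$ with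 $\beta_N=0$; then $\mathcal J(V)$ is the two-sided ideal generated by (1), (2) and $z_{N+1}+(N+1)\frac{b+p}{2}\,x_1z_N$; the monomials $x_1^{a_1}x_2^{a_2}z_1^{b_1}\cdots z_N^{b_N}x_3^{a_3}$ ($a_i,b_j\ge 0$), indexed by their exponents, form a basis (the PBW-basis $B_{N+3}$) of $\mathfrak B(V)$; and $\operatorname{GKdim}\mathfrak B(V)=N+3$. -/

import Mathlib

open scoped TensorProduct

noncomputable section

namespace Nichols

/-! ### The Nichols algebra of a braiding in coordinates

A braided vector space with basis `(x_i)_{i ∈ ι}` is given by the coefficients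
`c (x_i ⊗ x_j) = ∑ k l, r i j k l • x_k ⊗ x_l`.  The tensor algebra `T(V)` is
`FreeAlgebra K ι`. -/

section General

variable {K : Type*} [Field K] {ι : Type*} [Fintype ι] [DecidableEq ι]

/-- The extension of the braiding to `V ⊗ T(V) → T(V) ⊗ V`, as a matrix of linear forms:
`c (x_i ⊗ y) = ∑ m, (braidGen r y i m) ⊗ x_m`.  The identity
`c (v ⊗ y y') = (id ⊗ c) (c ⊗ id) (v ⊗ y ⊗ y')` says that `y ↦ braidGen r y` is multiplicative. -/
def braidGen (r : ι → ι → Matrix ι ι K) :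
    FreeAlgebra K ι →ₐ[K] Matrix ι ι (FreeAlgebra K ι) :=
  FreeAlgebra.lift K fun j =>
    Matrix.of fun i m => ∑ l, r i j l m • FreeAlgebra.ι K l

/-- Left multiplication by `x_i ⊗ 1 + 1 ⊗ x_i` on `T(V) ⊗ T(V)` with its braided product
`(y ⊗ z)(y' ⊗ z') = y c(z ⊗ y') z'`; that is,
`y ⊗ z ↦ x_i y ⊗ z + ∑ m, (braidGen r y i m) ⊗ x_m z`. -/
def primitiveMul (r : ι → ι → Matrix ι ι K) (i : ι) :
    Module.End K (FreeAlgebra K ι ⊗[K] FreeAlgebra K ι) :=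
  TensorProduct.map (LinearMap.mulLeft K (FreeAlgebra.ι K i)) LinearMap.id +
    ∑ m, TensorProduct.map
      (Matrix.entryLinearMap K (FreeAlgebra K ι) i m ∘ₗ (braidGen r).toLinearMap)
      (LinearMap.mulLeft K (FreeAlgebra.ι K m))

/-- The braided coproduct of `T(V)`: the multiplicative map (for the braided product on
`T(V) ⊗ T(V)`) with `Δ(x_i) = x_i ⊗ 1 + 1 ⊗ x_i`. -/
def coproduct (r : ι → ι → Matrix ι ι K) :
    FreeAlgebra K ι →ₗ[K] FreeAlgebra K ι ⊗[K] FreeAlgebra K ι :=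
  LinearMap.applyₗ (1 ⊗ₜ[K] 1) ∘ₗ (FreeAlgebra.lift K (primitiveMul r)).toLinearMap

variable (K ι) in
/-- The homogeneous component `Tⁿ(V)`. -/
def degreePart (n : ℕ) : Submodule K (FreeAlgebra K ι) :=
  Submodule.span K (Set.range (FreeAlgebra.ι K)) ^ n

/-- `I` is a homogeneous Hopf ideal of `T(V)` generated by homogeneous elements of degree `≥ 2`.
Such an ideal is killed by the counit, and since it is graded with `I⁰ = 0`, the recursion
`S(x) = -x - ∑ S(x') x''` shows that it is automatically stable under the antipode. -/
def IsHopfIdeal (r : ι → ι → Matrix ι ι K) (I : TwoSidedIdeal (FreeAlgebra K ι)) : Prop :=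
  (∃ S : Set (FreeAlgebra K ι),
    (∀ s ∈ S, ∃ n, 2 ≤ n ∧ s ∈ degreePart K ι n) ∧ I = TwoSidedIdeal.span S) ∧
  ∀ x ∈ I, coproduct r x ∈
    Submodule.span K {w | ∃ y z : FreeAlgebra K ι, (y ∈ I ∨ z ∈ I) ∧ w = y ⊗ₜ[K] z}

/-- The ideal `J(V)`: the largest homogeneous Hopf ideal generated in degrees `≥ 2`
(the sum of all of them). -/
def nicholsIdeal (r : ι → ι → Matrix ι ι K) : TwoSidedIdeal (FreeAlgebra K ι) :=
  sSup {I | IsHopfIdeal r I}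

/-- The Nichols algebra `B(V) = T(V) / J(V)`. -/
abbrev NicholsAlgebra (r : ι → ι → Matrix ι ι K) : Type _ :=
  (nicholsIdeal r).ringCon.Quotient

/-- The projection `T(V) → B(V)`. -/
def proj (r : ι → ι → Matrix ι ι K) : FreeAlgebra K ι →ₐ[K] NicholsAlgebra r :=
  (nicholsIdeal r).ringCon.mkₐ (α := K)

end General

/-- The Gelfand-Kirillov dimension of a `K`-algebra: the supremum over the finite-dimensional
subspaces `W` of `limsup (log dim (K + W + ⋯ + Wⁿ) / log n)`. -/
def GKdim (K A : Type*) [Field K] [Ring A] [Algebra K A] : EReal :=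
  ⨆ W : {W : Submodule K A // W.FG},
    Filter.limsup (fun n : ℕ =>
      ((Real.log (Module.finrank K ↥((1 ⊔ W.1) ^ n)) / Real.log n : ℝ) : EReal)) Filter.atTop

/-- The family `f` is a basis of the vector space `M`. -/
def IsBasis (K : Type*) {M σ : Type*} [Field K] [AddCommGroup M] [Module K M] (f : σ → M) : Prop :=
  LinearIndependent K f ∧ Submodule.span K (Set.range f) = ⊤

/-! ### The family `R_{1,2}` -/

section R12

variable {K : Type*} [Field K]

/-- The braiding of type `R_{1,2}`: `R12 t a b p q k i j` is the matrix whose `(m, l)` entry is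
the coefficient of `x_m ⊗ x_l` in `c (x_i ⊗ x_j)`; indices `0, 1, 2` stand for `1, 2, 3`. -/
def R12 (t a b p q k : K) : Fin 3 → Fin 3 → Matrix (Fin 3) (Fin 3) K
  | 0, 0 => !![t, 0, 0; 0, 0, 0; 0, 0, 0]
  | 0, 1 => !![0, 0, 0; t, 0, 0; 0, 0, 0]
  | 0, 2 => !![t * p, 0, 0; 0, 0, 0; t, 0, 0]
  | 1, 0 => !![0, t, 0; 0, 0, 0; 0, 0, 0]
  | 1, 1 => !![0, 0, 0; 0, t, 0; 0, 0, 0]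
  | 1, 2 => !![0, t * q, 0; 0, 0, 0; 0, t, 0]
  | 2, 0 => !![t * b, 0, t; 0, 0, 0; 0, 0, 0]
  | 2, 1 => !![0, t * (p - q), 0; t * b, 0, t; 0, 0, 0]
  | 2, 2 => !![t * a, t * k, t * p; -(t * k), 0, 0; t * b, 0, t]

variable (K) in
/-- The generators `x_1, x_2, x_3` of `T(V)` (indexed by `0, 1, 2`). -/
abbrev x (i : Fin 3) : FreeAlgebra K (Fin 3) := FreeAlgebra.ι K i

/-- The elements `z_n`: `z_0 = x_2` and
`z_n = (x_3 - n b x_1) z_{n-1} - z_{n-1} x_3 + (n-1)! (q-p) ((-b-p)/2)^{n-1} x_1^n x_2`. -/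
def z (b p q : K) : ℕ → FreeAlgebra K (Fin 3)
  | 0 => x K 1
  | n + 1 =>
    (x K 2 - (((n : K) + 1) * b) • x K 0) * z b p q n - z b p q n * x K 2 +
      ((n.factorial : K) * (q - p) * ((-b - p) / 2) ^ n) • (x K 0 ^ (n + 1) * x K 1)

/-- `β_n = -n ((n+1)/2 b + (n-1)/2 p + q)`. -/
def beta (b p q : K) (n : ℕ) : K :=
  -(n : K) * (((n : K) + 1) / 2 * b + ((n : K) - 1) / 2 * p + q)

/-- The two quadratic relations. -/
def quadraticRels (b p : K) : Set (FreeAlgebra K (Fin 3)) :=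
  {x K 1 * x K 0 - x K 0 * x K 1,
   x K 2 * x K 0 - x K 0 * x K 2 + ((p - b) / 2) • x K 0 ^ 2}

/-- The relations `z_{n+1} z_n - z_n z_{n+1}`, `n ≥ 0`. -/
def zRels (b p q : K) : Set (FreeAlgebra K (Fin 3)) :=
  Set.range fun n : ℕ => z b p q (n + 1) * z b p q n - z b p q n * z b p q (n + 1)

/-- The monomial `x_1^{a₁} x_2^{a₂} z_1^{e_1} ⋯ z_n^{e_n} x_3^{a₃}`
(`e_j` is `e (j - 1)` in the code). -/
def monomial (b p q : K) {n : ℕ} (a₁ a₂ : ℕ) (e : Fin n → ℕ) (a₃ : ℕ) : FreeAlgebra K (Fin 3) :=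
  x K 0 ^ a₁ * x K 1 ^ a₂ * (List.ofFn fun j : Fin n => z b p q (j + 1) ^ e j).prod * x K 2 ^ a₃

/-- The family `B_∞`, indexed by its exponents `(a₁, a₂, e, a₃)`, where `e` is finitely supported;
the length `n` of the monomial is taken so that all later exponents vanish. -/
def BInfty (b p q : K) (s : ℕ × ℕ × (ℕ →₀ ℕ) × ℕ) : FreeAlgebra K (Fin 3) :=
  monomial b p q s.1 s.2.1 (fun j : Fin (s.2.2.1.support.sup Nat.succ) => s.2.2.1 j) s.2.2.2

/-- The family `B_{N+3}`, indexed by its exponents `(a₁, a₂, e, a₃)`. -/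
def BFin (b p q : K) (N : ℕ) (s : ℕ × ℕ × (Fin N → ℕ) × ℕ) : FreeAlgebra K (Fin 3) :=
  monomial b p q s.1 s.2.1 s.2.2.1 s.2.2.2

end R12

end Nichols

end

open scoped TensorProduct

noncomputable section

namespace Nichols

/-! ### Skew derivations of the tensor algebra and their compatibility with the braiding. -/

section General

variable {K : Type*} [Field K] {ι : Type*}

/-! The Nichols ideal is first made computable. Contracting the right tensor factor of the coproduct
with the coefficient of `x_m` gives skew derivations `skewDer r m`. For a solution of the braid
equation, the elements all of whose iterated skew derivatives have zero counit form a graded Hopf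
ideal without linear part, and every admissible Hopf ideal lies in it
(`IsBraiding.nicholsIdeal_eq`). Hence in the Nichols algebra an element killed by the counit and by
the three derivations is zero, so relations are proved by differentiating.

For `R_{1,2}` put `v_0 = x_2` and `v_{n+1} = [x_3, v_n] - (n+1) b x_1 v_n`. By one joint induction
(`v_spec`), `∂_1` and `∂_3` kill `v_n`, while `∂_2 v_n = ρ_n x_1^n` with `ρ_n = (n+1) ∏_{j<n}
((p-b)/2 - q - j (b+p)/2)`; consequently `x_1` and all `v_n` commute. The identity `z_{n+1} +
(n+1)(b+p)/2 x_1 z_n = v_{n+1} - ((p-b)/2 - q - n(b+p)/2) x_1 v_n` (`zPoly_add`) makes the passage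
from `v` to `z` triangular. Since `β_n = n ((p-b)/2 - q - n(b+p)/2)`, the vanishing of `β_N` kills
both `ρ_{N+1}`, hence `v_{N+1}`, and the last term of the identity for `n = N`: this is the extra
relation in (b). As `b ≠ p - 2q`, the factor `j = 0` is nonzero, so `ρ_n ≠ 0` as long as no `β_j`
with `1 ≤ j < n` vanishes.

Independence: on polynomials in `x_1, v_0, v_1, …` the maps `∂_1, ∂_2` act as `∂/∂X_0` and as the
derivation `X_{n+1} ↦ ρ_n X_0^n`. The iterated brackets of these two recover all partial derivatives
while the `ρ_n` are nonzero, so no nonzero polynomial in `x_1, v_0, …, v_N` evaluates to zero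
(`eq_zero_of_φ_eq_zero`). Powers of `x_3` are then separated by `∂_3`, which lowers the degree in
`x_3`.

Spanning: in the algebra presented by (1) and (2) all `z_i` commute (`commute_z_z`), and the
commutator with `x_3` maps polynomials in `x_1, z_0, z_1, …` to such polynomials, so `x_3` can be
moved to the right. A family that spans the presented algebra and is independent in its quotient,
the Nichols algebra, forces the two to coincide (`nicholsIdeal_eq_span_and_isBasis`). Counting PBW
monomials bounds the growth on both sides. -/

/-- Induction on the tensor algebra by left multiplication with generators. -/
theorem freeAlgebra_induction_left {P : FreeAlgebra K ι → Prop} (one : P 1)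
    (mul : ∀ i y, P y → P (FreeAlgebra.ι K i * y)) (add : ∀ y z, P y → P z → P (y + z))
    (smul : ∀ (c : K) y, P y → P (c • y)) (y : FreeAlgebra K ι) : P y := by
  suffices ∀ y z : FreeAlgebra K ι, P z → P (y * z) by simpa using this y 1 one
  intro y
  induction y using FreeAlgebra.induction with
  | grade0 c => intro z hz; rw [← Algebra.smul_def]; exact smul _ _ hz
  | grade1 i => intro z hz; exact mul i z hz
  | mul u v hu hv => intro z hz; rw [mul_assoc]; exact hu _ (hv _ hz)
  | add u v hu hv => intro z hz; rw [add_mul]; exact add _ _ (hu _ hz) (hv _ hz)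

/-- The counit of `T(V)`. -/
abbrev counit : FreeAlgebra K ι →ₐ[K] K := FreeAlgebra.algebraMapInv

theorem counit_ι (i : ι) : counit (FreeAlgebra.ι K i) = 0 := by
  simp [counit, FreeAlgebra.algebraMapInv]

/-- The map `id ⊗ f : T(V) ⊗ T(V) → T(V)` for a linear form `f`. -/
def contractRight (f : FreeAlgebra K ι →ₗ[K] K) :
    FreeAlgebra K ι ⊗[K] FreeAlgebra K ι →ₗ[K] FreeAlgebra K ι :=
  (TensorProduct.rid K (FreeAlgebra K ι)).toLinearMap ∘ₗ LinearMap.lTensor _ f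

theorem contractRight_tmul (f : FreeAlgebra K ι →ₗ[K] K) (u v : FreeAlgebra K ι) :
    contractRight f (u ⊗ₜ[K] v) = f v • u := by
  simp [contractRight]

variable [DecidableEq ι]

/-- The algebra map `T(V) → K[ε]` with `x_i ↦ δ_{im} ε`. -/
def linCoeffAux (m : ι) : FreeAlgebra K ι →ₐ[K] TrivSqZeroExt K K :=
  FreeAlgebra.lift K fun i => TrivSqZeroExt.inr (if i = m then 1 else 0)

theorem fst_linCoeffAux (m : ι) (y : FreeAlgebra K ι) :
    (linCoeffAux m y).fst = counit y := by
  have : (TrivSqZeroExt.fstHom K K K).comp (linCoeffAux m) = counit (ι := ι) := by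
    ext i; by_cases h : i = m <;> simp [linCoeffAux, counit, FreeAlgebra.algebraMapInv, h]
  exact DFunLike.congr_fun this y

/-- The coefficient of `x_m` in the linear part of an element of `T(V)`. -/
def linCoeff (m : ι) : FreeAlgebra K ι →ₗ[K] K :=
  (TrivSqZeroExt.sndHom K K).restrictScalars K ∘ₗ (linCoeffAux m).toLinearMap

theorem linCoeff_mul (m : ι) (y z : FreeAlgebra K ι) :
    linCoeff m (y * z) = counit y * linCoeff m z + linCoeff m y * counit z := by
  simp [linCoeff, TrivSqZeroExt.snd_mul, fst_linCoeffAux, mul_comm]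

theorem linCoeff_ι (m i : ι) :
    linCoeff m (FreeAlgebra.ι K i) = if i = m then 1 else 0 := by
  by_cases h : i = m <;> simp [linCoeff, linCoeffAux, h]

theorem linCoeff_one (m : ι) : linCoeff m (1 : FreeAlgebra K ι) = 0 := by
  simp [linCoeff]

theorem linCoeff_ι_mul (m i : ι) (y : FreeAlgebra K ι) :
    linCoeff m (FreeAlgebra.ι K i * y) = (if i = m then 1 else 0) * counit y := by
  rw [linCoeff_mul, counit_ι, linCoeff_ι]; simp

variable [Fintype ι] (r : ι → ι → Matrix ι ι K)

theorem coproduct_one : coproduct r 1 = 1 ⊗ₜ[K] 1 := by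
  simp [coproduct]

theorem coproduct_ι_mul (i : ι) (y : FreeAlgebra K ι) :
    coproduct r (FreeAlgebra.ι K i * y) = primitiveMul r i (coproduct r y) := by
  simp [coproduct]

theorem primitiveMul_tmul (i : ι) (u v : FreeAlgebra K ι) :
    primitiveMul r i (u ⊗ₜ[K] v) =
      (FreeAlgebra.ι K i * u) ⊗ₜ[K] v + ∑ m, (braidGen r u i m) ⊗ₜ[K] (FreeAlgebra.ι K m * v) := by
  simp [primitiveMul]

theorem braidGen_ι (j i m : ι) :
    braidGen r (FreeAlgebra.ι K j) i m = ∑ l, r i j l m • FreeAlgebra.ι K l := by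
  simp [braidGen]

theorem braidGen_mul_apply (y z : FreeAlgebra K ι) (i m : ι) :
    braidGen r (y * z) i m = ∑ s, braidGen r y i s * braidGen r z s m := by
  rw [map_mul, Matrix.mul_apply]

theorem braidGen_one_apply (i m : ι) :
    braidGen r (1 : FreeAlgebra K ι) i m = if i = m then 1 else 0 := by
  rw [map_one, Matrix.one_apply]

/-- The braiding preserves the degree of `y`, so only the degree zero part contributes, and there
the braiding is the flip. -/
theorem counit_braidGen (y : FreeAlgebra K ι) (i m : ι) :
    counit (braidGen r y i m) = if i = m then counit y else 0 := by
  induction y using freeAlgebra_induction_left generalizing i m with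
  | one => rw [braidGen_one_apply]; split_ifs <;> simp
  | mul j y ih =>
    rw [braidGen_mul_apply, map_sum, map_mul, counit_ι]
    simp [braidGen_ι, counit_ι]
  | add y z hy hz => simp only [map_add, Matrix.add_apply, hy, hz]; split_ifs <;> simp
  | smul c y hy => simp only [map_smul, Matrix.smul_apply, hy]; split_ifs <;> simp

/-- Each summand of `primitiveMul` that puts a new generator in the right factor is killed by the
counit; the remaining summand is left multiplication. -/
theorem contractRight_counit_coproduct (y : FreeAlgebra K ι) :
    contractRight counit.toLinearMap (coproduct r y) = y := by
  induction y using freeAlgebra_induction_left with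
  | one => simp [coproduct_one, contractRight_tmul]
  | mul i y ih =>
    rw [coproduct_ι_mul]
    have : ∀ w, contractRight counit.toLinearMap (primitiveMul r i w) =
        FreeAlgebra.ι K i * contractRight counit.toLinearMap w := by
      intro w
      induction w with
      | zero => simp
      | add a b ha hb => simp only [map_add, ha, hb, mul_add]
      | tmul u v => simp [primitiveMul_tmul, contractRight_tmul, counit_ι]
    rw [this, ih]
  | add y z hy hz => rw [map_add, map_add, hy, hz]
  | smul c y hy => rw [map_smul, map_smul, hy]

/-- The skew derivation `∂_m` of `T(V)`: the component of the coproduct in `T(V) ⊗ x_m`. -/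
def skewDer (m : ι) : FreeAlgebra K ι →ₗ[K] FreeAlgebra K ι :=
  contractRight (linCoeff m) ∘ₗ coproduct r

theorem skewDer_one (m : ι) : skewDer r m 1 = 0 := by
  simp [skewDer, coproduct_one, contractRight_tmul, linCoeff_one]

/-- The coefficient of `x_m` in `x_j v` is `δ_{jm}` times the counit of `v`, so the braided summand
is contracted by the counit and the counit axiom returns `y` itself. -/
theorem skewDer_ι_mul (m i : ι) (y : FreeAlgebra K ι) :
    skewDer r m (FreeAlgebra.ι K i * y) =
      FreeAlgebra.ι K i * skewDer r m y + braidGen r y i m := by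
  have h : ∀ w, contractRight (linCoeff m) (primitiveMul r i w) =
      FreeAlgebra.ι K i * contractRight (linCoeff m) w +
        braidGen r (contractRight counit.toLinearMap w) i m := by
    intro w
    induction w with
    | zero => simp
    | add a b ha hb => simp only [map_add, ha, hb, mul_add, Matrix.add_apply]; abel
    | tmul u v => simp [primitiveMul_tmul, contractRight_tmul, linCoeff_ι_mul]
  simp only [skewDer, LinearMap.comp_apply, coproduct_ι_mul, h, contractRight_counit_coproduct]

theorem skewDer_ι (m i : ι) :
    skewDer r m (FreeAlgebra.ι K i) = if i = m then 1 else 0 := by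
  have := skewDer_ι_mul r m i 1
  rwa [mul_one, skewDer_one, mul_zero, zero_add, braidGen_one_apply] at this

theorem skewDer_mul (m : ι) (y z : FreeAlgebra K ι) :
    skewDer r m (y * z) = y * skewDer r m z + ∑ i, skewDer r i y * braidGen r z i m := by
  induction y using freeAlgebra_induction_left generalizing m with
  | one => simp [skewDer_one]
  | mul j y ih =>
    rw [mul_assoc, skewDer_ι_mul, ih, braidGen_mul_apply, mul_add, ← mul_assoc, add_assoc,
      Finset.mul_sum, ← Finset.sum_add_distrib]
    simp only [skewDer_ι_mul, add_mul, mul_assoc]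
  | add y z hy hz =>
    simp only [add_mul, map_add, hy, hz, Finset.sum_add_distrib]; abel
  | smul c y hy =>
    simp only [smul_mul_assoc, map_smul, hy, smul_add, Finset.smul_sum]

/-- The braid equation in coordinates. -/
def IsBraiding : Prop :=
  ∀ a b j l m n : ι,
    ∑ i, ∑ i', ∑ s, r a b i i' * (r i' j s n * r i s l m) =
      ∑ i, ∑ i', ∑ s, r i i' m n * (r b j s i' * r a s l i)

/-- The extension of the braiding to `(V ⊗ V) ⊗ T(V)`, as an algebra map into matrices. -/
def braidGen₂ : FreeAlgebra K ι →ₐ[K] Matrix (ι × ι) (ι × ι) (FreeAlgebra K ι) :=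
  ((Matrix.compAlgEquiv ι ι (FreeAlgebra K ι) K).toAlgHom.comp
    (braidGen r).mapMatrix).comp (braidGen r)

theorem braidGen₂_apply (y : FreeAlgebra K ι) (b a n m : ι) :
    braidGen₂ r y (b, a) (n, m) = braidGen r (braidGen r y b n) a m := by
  simp [braidGen₂, Matrix.compAlgEquiv]

-- Both sides are entries of the products, in the two orders, of one fixed scalar matrix with the
-- value at `y` of the algebra map `braidGen₂`. Commuting with a fixed matrix is closed under sums
-- and products, so the generators suffice, and for them it is the braid equation.
variable {r} in
theorem IsBraiding.natural (h : IsBraiding r) (y : FreeAlgebra K ι) (a b m n : ι) :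
    ∑ i, ∑ i', r a b i i' • braidGen r (braidGen r y i' n) i m =
      ∑ i, ∑ i', r i i' m n • braidGen r (braidGen r y b i') a i := by
  let R : Matrix (ι × ι) (ι × ι) (FreeAlgebra K ι) :=
    Matrix.of fun s t => algebraMap K _ (r s.2 s.1 t.2 t.1)
  have key : Commute R (braidGen₂ r y) := by
    induction y using FreeAlgebra.induction with
    | grade0 c => rw [AlgHom.commutes]; exact Algebra.commutes' c R |>.symm
    | grade1 j =>
      ext ⟨b, a⟩ ⟨n, m⟩
      simp only [Matrix.mul_apply, Fintype.sum_prod_type, braidGen₂_apply, braidGen_ι, R,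
        Matrix.of_apply, map_sum, map_smul, Matrix.sum_apply, Matrix.smul_apply]
      simp only [← Algebra.commutes, ← Algebra.smul_def, Finset.smul_sum, smul_smul]
      have e1 : ∀ l, ∑ i', ∑ i, ∑ s, r a b i i' * (r i' j s n * r i s l m) =
          ∑ i', ∑ i, ∑ s, r i i' m n * (r b j s i' * r a s l i) := by
        intro l
        rw [Finset.sum_comm, h a b j l m n, Finset.sum_comm]
      have e2 := Finset.sum_congr (rfl : (Finset.univ : Finset ι) = _)
        fun l _ => congrArg (· • FreeAlgebra.ι K l) (e1 l)
      simp only [Finset.sum_smul] at e2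
      have swap : ∀ f : ι → ι → ι → ι → FreeAlgebra K ι,
          ∑ l, ∑ i', ∑ i, ∑ s, f l i' i s = ∑ i', ∑ i, ∑ s, ∑ l, f l i' i s := by
        intro f
        rw [Finset.sum_comm]
        refine Finset.sum_congr rfl fun _ _ => ?_
        rw [Finset.sum_comm]
        refine Finset.sum_congr rfl fun _ _ => ?_
        rw [Finset.sum_comm]
      exact (swap _).symm.trans (e2.trans (swap _))
    | mul u v hu hv => rw [map_mul]; exact hu.mul_right hv
    | add u v hu hv => rw [map_add]; exact hu.add_right hv
  have e := congrFun (congrFun key.eq (b, a)) (n, m)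
  simp only [Matrix.mul_apply, Fintype.sum_prod_type, braidGen₂_apply, R, Matrix.of_apply] at e
  simp only [← Algebra.commutes, ← Algebra.smul_def] at e
  rw [Finset.sum_comm, e, Finset.sum_comm]

/-- The derivations commute with the braiding. -/
theorem IsBraiding.skewDer_braidGen (h : IsBraiding r) (y : FreeAlgebra K ι) (k i m : ι) :
    skewDer r k (braidGen r y i m) =
      ∑ s, ∑ j, r s j k m • braidGen r (skewDer r j y) i s := by
  induction y using freeAlgebra_induction_left generalizing k i m with
  | one =>
    rw [braidGen_one_apply]
    split_ifs <;> simp [skewDer_one]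
  | mul a y ih =>
    simp only [braidGen_mul_apply, map_sum, braidGen_ι, Finset.sum_mul, smul_mul_assoc, map_smul,
      skewDer_ι_mul, ih, smul_add, Finset.sum_add_distrib, map_add, Matrix.add_apply]
    congr 1
    · simp only [Finset.smul_sum, Finset.mul_sum]
      rw [Finset.sum_comm' (t' := Finset.univ) (s' := fun _ => Finset.univ) (by simp)]
      have : ∀ f : ι → ι → ι → ι → FreeAlgebra K ι,
          ∑ l, ∑ t, ∑ s, ∑ j, f l t s j = ∑ s, ∑ j, ∑ t, ∑ l, f l t s j := by
        intro f
        rw [Finset.sum_comm]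
        simp_rw [Finset.sum_comm (γ := ι) (t := Finset.univ (α := ι))
          (f := fun l s => ∑ j, f l _ s j)]
        rw [Finset.sum_comm]
        refine Finset.sum_congr rfl fun _ _ => ?_
        simp_rw [Finset.sum_comm (f := fun l j => f l _ _ j)]
        rw [Finset.sum_comm]
      rw [this]
      refine Finset.sum_congr rfl fun s _ => Finset.sum_congr rfl fun j _ =>
        Finset.sum_congr rfl fun t _ => Finset.sum_congr rfl fun l _ => ?_
      rw [mul_smul_comm, smul_comm]
    -- The braid equation enters only here, for the term in which the derivation hits the leading
    -- generator's braiding partner `y`.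
    · rw [Finset.sum_comm, h.natural]
  | add y z hy hz =>
    simp only [map_add, Matrix.add_apply, hy, hz, smul_add, Finset.sum_add_distrib]
  | smul c y hy =>
    simp only [map_smul, Matrix.smul_apply, hy, Finset.smul_sum]
    refine Finset.sum_congr rfl fun s _ => Finset.sum_congr rfl fun j _ => smul_comm _ _ _

end General

/-! ### A criterion for membership in `U ⊗ T + T ⊗ U`. -/

section Tensor

variable {K : Type*} [Field K] {ι : Type*}

/-- A tensor whose right contractions with a family of linear forms cutting out `U` all lie in
`U` belongs to `U ⊗ T + T ⊗ U`. -/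
theorem mem_span_tmul_of_contractRight {κ : Type*} (F : κ → FreeAlgebra K ι →ₗ[K] K)
    (U : Submodule K (FreeAlgebra K ι)) (hU : ∀ y, (∀ w, F w y = 0) → y ∈ U)
    (W : FreeAlgebra K ι ⊗[K] FreeAlgebra K ι) (hW : ∀ w, contractRight (F w) W ∈ U) :
    W ∈ Submodule.span K
      {w | ∃ y z : FreeAlgebra K ι, (y ∈ U ∨ z ∈ U) ∧ w = y ⊗ₜ[K] z} := by
  classical
  -- In `T/U ⊗ T/U`, expand along a basis of the left factor. The coefficient at `i` is the class of
  -- `L W`, and each form `F w` takes on `L W` the value of `f` at a right contraction of `W`. That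
  -- contraction lies in `U`, where `f` vanishes, so `L W` lies in `U`.
  have hker : TensorProduct.map U.mkQ U.mkQ W = 0 := by
    let B := Module.Basis.ofVectorSpace K (FreeAlgebra K ι ⧸ U)
    apply (TensorProduct.equivFinsuppOfBasisLeft B).injective
    rw [map_zero]
    ext i
    let f : FreeAlgebra K ι →ₗ[K] K := B.coord i ∘ₗ U.mkQ
    let L : FreeAlgebra K ι ⊗[K] FreeAlgebra K ι →ₗ[K] FreeAlgebra K ι :=
      (TensorProduct.lid K _).toLinearMap ∘ₗ LinearMap.rTensor _ f
    have h1 : ∀ W, TensorProduct.equivFinsuppOfBasisLeft B (TensorProduct.map U.mkQ U.mkQ W) i =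
        U.mkQ (L W) := by
      intro W
      induction W with
      | zero => simp
      | add a b ha hb => simp only [map_add, Finsupp.add_apply, ha, hb]
      | tmul u v => simp [L, f]
    have h2 : ∀ w W, F w (L W) = f (contractRight (F w) W) := by
      intro w W
      induction W with
      | zero => simp
      | add a b ha hb => simp only [map_add, ha, hb]
      | tmul u v => simp [L, contractRight_tmul, mul_comm]
    rw [h1, Finsupp.zero_apply, Submodule.mkQ_apply, Submodule.Quotient.mk_eq_zero]
    apply hU
    intro w
    rw [h2]
    simp only [f, LinearMap.comp_apply, Submodule.mkQ_apply,
      (Submodule.Quotient.mk_eq_zero U).2 (hW w), map_zero]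
  have hex : Function.Exact U.subtype U.mkQ := by
    intro y; simp
  rw [← LinearMap.mem_ker, TensorProduct.map_ker hex U.mkQ_surjective hex U.mkQ_surjective] at hker
  refine (sup_le ?_ ?_ : _ ≤ Submodule.span K _) hker
  · rintro _ ⟨w, rfl⟩
    induction w with
    | zero => simp
    | add a b ha hb => rw [map_add]; exact add_mem ha hb
    | tmul u v => exact Submodule.subset_span ⟨u, v, Or.inr v.2, by simp⟩
  · rintro _ ⟨w, rfl⟩
    induction w with
    | zero => simp
    | add a b ha hb => rw [map_add]; exact add_mem ha hb
    | tmul u v => exact Submodule.subset_span ⟨u, v, Or.inl u.2, by simp⟩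

end Tensor

/-! ### The radical of the skew derivations is a Hopf ideal. -/

section General

variable {K : Type*} [Field K] {ι : Type*} [Fintype ι] [DecidableEq ι]
  {r : ι → ι → Matrix ι ι K}

/-- The coproduct commutes with the braiding. -/
theorem IsBraiding.coproduct_braidGen (h : IsBraiding r) (y : FreeAlgebra K ι) (i m : ι) :
    coproduct r (braidGen r y i m) =
      ∑ s, TensorProduct.map
        (Matrix.entryLinearMap K (FreeAlgebra K ι) i s ∘ₗ (braidGen r).toLinearMap)
        (Matrix.entryLinearMap K (FreeAlgebra K ι) s m ∘ₗ (braidGen r).toLinearMap)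
        (coproduct r y) := by
  induction y using freeAlgebra_induction_left generalizing i m with
  | one =>
    rw [braidGen_one_apply]
    have : ∀ s, (if i = s then (1 : FreeAlgebra K ι) else 0) ⊗ₜ[K]
        (if s = m then (1 : FreeAlgebra K ι) else 0) =
        if i = s then (if i = m then 1 ⊗ₜ[K] 1 else 0) else 0 := by
      intro s; split_ifs <;> simp_all
    simp only [coproduct_one, TensorProduct.map_tmul, LinearMap.comp_apply,
      AlgHom.toLinearMap_apply, Matrix.entryLinearMap_apply, braidGen_one_apply, this]
    simp only [Finset.sum_ite_eq, Finset.mem_univ, if_true]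
    split_ifs <;> simp [coproduct_one]
  | mul j y ih =>
    simp only [braidGen_mul_apply, map_sum, braidGen_ι, Finset.sum_mul, smul_mul_assoc, map_smul,
      coproduct_ι_mul, ih]
    generalize coproduct r y = w
    induction w with
    | zero => simp
    | add a b ha hb => simp only [map_add, smul_add, Finset.sum_add_distrib, ha, hb]
    | tmul u v =>
      simp only [TensorProduct.map_tmul, LinearMap.comp_apply, AlgHom.toLinearMap_apply,
        Matrix.entryLinearMap_apply, primitiveMul_tmul, map_add, map_sum, smul_add,
        Finset.sum_add_distrib, braidGen_mul_apply, braidGen_ι]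
      congr 1
      · simp only [TensorProduct.sum_tmul, Finset.sum_mul, smul_mul_assoc,
          TensorProduct.smul_tmul', Finset.smul_sum]
        have : ∀ f : ι → ι → ι → FreeAlgebra K ι ⊗[K] FreeAlgebra K ι,
            ∑ t, ∑ l, ∑ s, f t l s = ∑ s, ∑ t, ∑ l, f t l s := by
          intro f
          simp_rw [Finset.sum_comm (f := fun l s => f _ l s)]
          rw [Finset.sum_comm]
        rw [this]
      · simp only [TensorProduct.tmul_sum, Finset.sum_mul, smul_mul_assoc,
          TensorProduct.tmul_smul, Finset.smul_sum]
        -- For fixed right-hand factors the equality of the left-hand factors is naturality of the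
        -- braiding; the rest is reordering of sums.
        have e : ∀ t n, ∑ s, ∑ l, (r i j l s • braidGen r (braidGen r u s t) l n) ⊗ₜ[K]
            (FreeAlgebra.ι K n * braidGen r v t m) =
            ∑ l, ∑ s, (r l s n t • braidGen r (braidGen r u j s) i l) ⊗ₜ[K]
            (FreeAlgebra.ι K n * braidGen r v t m) := by
          intro t n
          simp only [← TensorProduct.sum_tmul]
          rw [Finset.sum_comm, h.natural]
        simp only [← TensorProduct.smul_tmul'] at e
        have e' := Finset.sum_congr (rfl : (Finset.univ : Finset ι) = _) fun t _ =>
          Finset.sum_congr (rfl : (Finset.univ : Finset ι) = _) fun n _ => e t n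
        refine Eq.trans ?_ (e'.trans ?_)
        · rw [Finset.sum_comm' (t' := Finset.univ) (s' := fun _ => Finset.univ) (by simp)]
          rw [Finset.sum_comm]
          have : ∀ f : ι → ι → ι → ι → FreeAlgebra K ι ⊗[K] FreeAlgebra K ι,
              ∑ s, ∑ l, ∑ t, ∑ n, f s l t n = ∑ t, ∑ n, ∑ s, ∑ l, f s l t n := by
            intro f
            simp_rw [Finset.sum_comm (f := fun l t => ∑ n, f _ l t n)]
            rw [Finset.sum_comm]
            refine Finset.sum_congr rfl fun _ _ => ?_
            simp_rw [Finset.sum_comm (f := fun l n => f _ l _ n)]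
            rw [Finset.sum_comm]
          exact this _
        · have : ∀ f : ι → ι → ι → ι → FreeAlgebra K ι ⊗[K] FreeAlgebra K ι,
              ∑ t, ∑ n, ∑ l, ∑ s, f t n l s = ∑ l, ∑ s, ∑ t, ∑ n, f t n l s := by
            intro f
            simp_rw [Finset.sum_comm (f := fun n l => ∑ s, f _ n l s)]
            rw [Finset.sum_comm]
            refine Finset.sum_congr rfl fun _ _ => ?_
            simp_rw [Finset.sum_comm (f := fun n s => f _ n _ s)]
            rw [Finset.sum_comm]
          exact this _
  | add y z hy hz => simp only [map_add, Matrix.add_apply, hy, hz, Finset.sum_add_distrib]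
  | smul c y hy => simp only [map_smul, Matrix.smul_apply, hy, Finset.smul_sum]

/-- Coassociativity, for the components `T(V) ⊗ T(V) ⊗ x_m`. -/
theorem IsBraiding.lTensor_skewDer_coproduct (h : IsBraiding r) (m : ι) (y : FreeAlgebra K ι) :
    LinearMap.lTensor _ (skewDer r m) (coproduct r y) = coproduct r (skewDer r m y) := by
  induction y using freeAlgebra_induction_left with
  | one => simp [coproduct_one, skewDer_one]
  | mul i y ih =>
    rw [skewDer_ι_mul, map_add, coproduct_ι_mul, coproduct_ι_mul, ← ih, h.coproduct_braidGen]
    generalize coproduct r y = w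
    induction w with
    | zero => simp
    | add a b ha hb => simp only [map_add, ha, hb, Finset.sum_add_distrib]; abel
    | tmul u v =>
      simp only [LinearMap.lTensor_tmul, primitiveMul_tmul, map_add, map_sum, skewDer_ι_mul,
        TensorProduct.tmul_add, Finset.sum_add_distrib, TensorProduct.map_tmul,
        LinearMap.comp_apply, AlgHom.toLinearMap_apply, Matrix.entryLinearMap_apply]
      abel
  | add y z hy hz => simp only [map_add, hy, hz]
  | smul c y hy => simp only [map_smul, hy]

variable (r) in
/-- The iterated skew derivation along a word. -/
def wordDer : List ι → FreeAlgebra K ι →ₗ[K] FreeAlgebra K ι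
  | [] => LinearMap.id
  | m :: w => wordDer w ∘ₗ skewDer r m

variable (r) in
/-- The elements all of whose iterated skew derivatives have vanishing counit. -/
def radicalSubmodule : Submodule K (FreeAlgebra K ι) :=
  ⨅ w, LinearMap.ker (counit.toLinearMap ∘ₗ wordDer r w)

theorem mem_radicalSubmodule {y : FreeAlgebra K ι} :
    y ∈ radicalSubmodule r ↔ ∀ w, counit (wordDer r w y) = 0 := by
  simp [radicalSubmodule]

theorem mem_radicalSubmodule_iff {y : FreeAlgebra K ι} :
    y ∈ radicalSubmodule r ↔ counit y = 0 ∧ ∀ m, skewDer r m y ∈ radicalSubmodule r := by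
  simp only [mem_radicalSubmodule]
  refine ⟨fun h => ⟨h [], fun m w => h (m :: w)⟩, fun h w => ?_⟩
  cases w with
  | nil => exact h.1
  | cons m w => exact h.2 m w

/-- The radical is the largest derivation-stable subspace of the kernel of the counit; closure
properties below are obtained by applying this to the subspace one wants to absorb. -/
theorem le_radicalSubmodule {S : Submodule K (FreeAlgebra K ι)} (h0 : ∀ y ∈ S, counit y = 0)
    (h1 : ∀ m, ∀ y ∈ S, skewDer r m y ∈ S) : S ≤ radicalSubmodule r := by
  intro y hy
  rw [mem_radicalSubmodule]
  intro w
  induction w generalizing y with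
  | nil => exact h0 y hy
  | cons m w ih => exact ih (h1 m y hy)

/-- The span of all braided images of radical elements is stable under derivations because
derivations commute with the braiding. -/
theorem IsBraiding.braidGen_mem_radical (h : IsBraiding r) {y : FreeAlgebra K ι}
    (hy : y ∈ radicalSubmodule r) (i m : ι) : braidGen r y i m ∈ radicalSubmodule r := by
  let S : Submodule K (FreeAlgebra K ι) :=
    Submodule.span K {u | ∃ y ∈ radicalSubmodule r, ∃ i m, u = braidGen r y i m}
  have key : S ≤ radicalSubmodule r := by
    apply le_radicalSubmodule
    · intro u hu
      refine Submodule.span_induction ?_ ?_ ?_ ?_ hu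
      · rintro _ ⟨y, hy, i, m, rfl⟩
        rw [counit_braidGen, (mem_radicalSubmodule_iff.1 hy).1, ite_self]
      · simp
      · intro u v _ _ hu hv; rw [map_add, hu, hv, add_zero]
      · intro c u _ hu; rw [map_smul, hu, smul_zero]
    · intro k u hu
      refine Submodule.span_induction ?_ ?_ ?_ ?_ hu
      · rintro _ ⟨y, hy, i, m, rfl⟩
        rw [h.skewDer_braidGen]
        exact Submodule.sum_mem _ fun s _ => Submodule.sum_mem _ fun j _ =>
          Submodule.smul_mem _ _ (Submodule.subset_span
            ⟨_, (mem_radicalSubmodule_iff.1 hy).2 j, i, s, rfl⟩)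
      · simp
      · intro u v _ _ hu hv; rw [map_add]; exact add_mem hu hv
      · intro c u _ hu; rw [map_smul]; exact Submodule.smul_mem _ _ hu
  exact key (Submodule.subset_span ⟨y, hy, i, m, rfl⟩)

theorem radical_mul_mem {y : FreeAlgebra K ι} (hy : y ∈ radicalSubmodule r)
    (z : FreeAlgebra K ι) : y * z ∈ radicalSubmodule r := by
  have key : radicalSubmodule r * ⊤ ≤ radicalSubmodule r := by
    apply le_radicalSubmodule
    · intro u hu
      refine Submodule.mul_induction_on hu ?_ ?_
      · intro y hy z _
        rw [map_mul, (mem_radicalSubmodule_iff.1 hy).1, zero_mul]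
      · intro u v hu hv; rw [map_add, hu, hv, add_zero]
    · intro m u hu
      refine Submodule.mul_induction_on hu ?_ ?_
      · intro y hy z _
        rw [skewDer_mul]
        exact add_mem (Submodule.mul_mem_mul hy trivial) (Submodule.sum_mem _ fun i _ =>
          Submodule.mul_mem_mul ((mem_radicalSubmodule_iff.1 hy).2 i) trivial)
      · intro u v hu hv; rw [map_add]; exact add_mem hu hv
  exact key (Submodule.mul_mem_mul hy trivial)

/-- Unlike for right multiples, the twisted Leibniz rule here applies the braiding to the radical
factor, so the stability of the radical under the braiding is needed. -/
theorem IsBraiding.mul_radical_mem (h : IsBraiding r) (y : FreeAlgebra K ι)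
    {z : FreeAlgebra K ι} (hz : z ∈ radicalSubmodule r) : y * z ∈ radicalSubmodule r := by
  have key : ⊤ * radicalSubmodule r ≤ radicalSubmodule r := by
    apply le_radicalSubmodule
    · intro u hu
      refine Submodule.mul_induction_on hu ?_ ?_
      · intro y _ z hz
        rw [map_mul, (mem_radicalSubmodule_iff.1 hz).1, mul_zero]
      · intro u v hu hv; rw [map_add, hu, hv, add_zero]
    · intro m u hu
      refine Submodule.mul_induction_on hu ?_ ?_
      · intro y _ z hz
        rw [skewDer_mul]
        exact add_mem (Submodule.mul_mem_mul trivial ((mem_radicalSubmodule_iff.1 hz).2 m))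
          (Submodule.sum_mem _ fun i _ =>
            Submodule.mul_mem_mul trivial (h.braidGen_mem_radical hz i m))
      · intro u v hu hv; rw [map_add]; exact add_mem hu hv
  exact key (Submodule.mul_mem_mul trivial hz)

/-- The radical as a two-sided ideal. -/
def IsBraiding.radical (h : IsBraiding r) : TwoSidedIdeal (FreeAlgebra K ι) :=
  TwoSidedIdeal.mk' (radicalSubmodule r) (zero_mem _) (fun hx hy => add_mem hx hy)
    (fun hx => neg_mem hx) (fun hy => h.mul_radical_mem _ hy) (fun hx => radical_mul_mem hx _)

theorem IsBraiding.mem_radical (h : IsBraiding r) {y : FreeAlgebra K ι} :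
    y ∈ h.radical ↔ y ∈ radicalSubmodule r := by
  simp [IsBraiding.radical]

/-- Iterated coassociativity: the forms that cut out the radical act on the right of the coproduct
as iterated derivations, which preserve the radical. This is what the tensor criterion requires. -/
theorem IsBraiding.contractRight_wordDer (h : IsBraiding r) (w : List ι) (y : FreeAlgebra K ι) :
    contractRight (counit.toLinearMap ∘ₗ wordDer r w) (coproduct r y) = wordDer r w y := by
  induction w generalizing y with
  | nil => exact contractRight_counit_coproduct r y
  | cons m w ih =>
    have e : ∀ W, contractRight (counit.toLinearMap ∘ₗ wordDer r (m :: w)) W =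
        contractRight (counit.toLinearMap ∘ₗ wordDer r w)
          (LinearMap.lTensor _ (skewDer r m) W) := by
      intro W
      induction W with
      | zero => simp
      | add a b ha hb => simp only [map_add, ha, hb]
      | tmul u v => simp [contractRight_tmul, wordDer]
    rw [e, h.lTensor_skewDer_coproduct, ih]
    rfl

theorem wordDer_mem_radicalSubmodule (w : List ι) {y : FreeAlgebra K ι}
    (hy : y ∈ radicalSubmodule r) : wordDer r w y ∈ radicalSubmodule r := by
  induction w generalizing y with
  | nil => exact hy
  | cons m w ih => exact ih ((mem_radicalSubmodule_iff.1 hy).2 m)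

theorem IsBraiding.coproduct_mem_of_mem_radical (h : IsBraiding r) {y : FreeAlgebra K ι}
    (hy : y ∈ radicalSubmodule r) : coproduct r y ∈ Submodule.span K
      {w | ∃ u v : FreeAlgebra K ι, (u ∈ radicalSubmodule r ∨ v ∈ radicalSubmodule r) ∧
        w = u ⊗ₜ[K] v} := by
  apply mem_span_tmul_of_contractRight (fun w => counit.toLinearMap ∘ₗ wordDer r w)
  · exact fun y hy => mem_radicalSubmodule.2 hy
  · intro w
    rw [h.contractRight_wordDer]
    exact wordDer_mem_radicalSubmodule w hy

end General

/-! ### The grading of the tensor algebra. -/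

section Grading

variable {K : Type*} [Field K] {ι : Type*}

/-- The grading of `T(V)`: the algebra map `x_i ↦ x_i X`, whose coefficients are the homogeneous
components. -/
def gradeHom : FreeAlgebra K ι →ₐ[K] Polynomial (FreeAlgebra K ι) :=
  FreeAlgebra.lift K fun i => Polynomial.C (FreeAlgebra.ι K i) * Polynomial.X

theorem gradeHom_ι (i : ι) :
    gradeHom (FreeAlgebra.ι K i) = Polynomial.C (FreeAlgebra.ι K i) * Polynomial.X := by
  simp [gradeHom]

/-- The homogeneous component of degree `n`. -/
def component (n : ℕ) : FreeAlgebra K ι →ₗ[K] FreeAlgebra K ι where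
  toFun y := (gradeHom y).coeff n
  map_add' := by simp
  map_smul' := by simp

theorem component_one (n : ℕ) :
    component n (1 : FreeAlgebra K ι) = if n = 0 then 1 else 0 := by
  simp [component, Polynomial.coeff_one]

theorem component_zero_ι_mul (i : ι) (y : FreeAlgebra K ι) :
    component 0 (FreeAlgebra.ι K i * y) = 0 := by
  simp [component, gradeHom_ι, Polynomial.mul_coeff_zero]

theorem component_succ_ι_mul (n : ℕ) (i : ι) (y : FreeAlgebra K ι) :
    component (n + 1) (FreeAlgebra.ι K i * y) = FreeAlgebra.ι K i * component n y := by
  simp [component, gradeHom_ι, mul_assoc, Polynomial.coeff_C_mul, Polynomial.coeff_X_mul]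

theorem mem_of_component_mem {S : Submodule K (FreeAlgebra K ι)} {y : FreeAlgebra K ι}
    (h : ∀ n, component n y ∈ S) : y ∈ S := by
  -- Summing the coefficients, that is, setting `X = 1`, undoes `gradeHom`.
  let φ : Polynomial (FreeAlgebra K ι) →ₗ[FreeAlgebra K ι] FreeAlgebra K ι :=
    Polynomial.lsum fun _ => LinearMap.id
  have hφ : ∀ y, φ (gradeHom y) = y := by
    intro y
    induction y using freeAlgebra_induction_left with
    | one =>
      rw [map_one, ← Polynomial.C_1, ← Polynomial.monomial_zero_left]
      exact Polynomial.sum_monomial_index _ _ rfl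
    | mul i y ih =>
      have e : ∀ p, φ (Polynomial.X * p) = φ p := by
        intro p
        induction p using Polynomial.induction_on' with
        | add p q hp hq => rw [mul_add, map_add, map_add, hp, hq]
        | monomial n a =>
          rw [Polynomial.X_mul_monomial]
          simp [φ, Polynomial.lsum, Polynomial.sum_monomial_index]
      rw [map_mul, gradeHom_ι, mul_assoc, ← Polynomial.smul_eq_C_mul, map_smul, e, ih, smul_eq_mul]
    | add y z hy hz => rw [map_add, map_add, hy, hz]
    | smul c y hy =>
      rw [map_smul, ← algebraMap_smul (FreeAlgebra K ι) c, map_smul, hy, algebraMap_smul]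
  rw [← hφ y]
  exact Submodule.sum_mem _ fun n _ => h n

theorem component_mem_degreePart (n : ℕ) (y : FreeAlgebra K ι) :
    component n y ∈ degreePart K ι n := by
  induction y using freeAlgebra_induction_left generalizing n with
  | one =>
    rw [component_one]
    split_ifs with h
    · subst h; rw [degreePart, pow_zero]; exact Submodule.one_le.1 le_rfl
    · exact zero_mem _
  | mul i y ih =>
    cases n with
    | zero => rw [component_zero_ι_mul]; exact zero_mem _
    | succ n =>
      rw [component_succ_ι_mul, degreePart, pow_succ']
      exact Submodule.mul_mem_mul (Submodule.subset_span ⟨i, rfl⟩) (ih n)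
  | add y z hy hz => rw [map_add]; exact add_mem (hy n) (hz n)
  | smul c y hy => rw [map_smul]; exact Submodule.smul_mem _ _ (hy n)

theorem counit_component (n : ℕ) (y : FreeAlgebra K ι) :
    counit (component n y) = if n = 0 then counit y else 0 := by
  induction y using freeAlgebra_induction_left with
  | one => rw [component_one]; split_ifs <;> simp
  | mul i y ih =>
    cases n with
    | zero => simp [component_zero_ι_mul, counit_ι]
    | succ n => simp [component_succ_ι_mul, counit_ι]
  | add y z hy hz => rw [map_add, map_add, hy, hz]; split_ifs <;> simp
  | smul c y hy => rw [map_smul, map_smul, hy]; split_ifs <;> simp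

theorem component_zero (y : FreeAlgebra K ι) :
    component 0 y = algebraMap K _ (counit y) := by
  induction y using freeAlgebra_induction_left with
  | one => simp [component_one]
  | mul i y ih => simp [component_zero_ι_mul, counit_ι]
  | add y z hy hz => simp only [map_add, hy, hz]
  | smul c y hy => rw [map_smul, map_smul, hy, smul_eq_mul, map_mul, Algebra.smul_def]

theorem counit_eq_zero_of_mem_degreePart {n : ℕ} {y : FreeAlgebra K ι}
    (hy : y ∈ degreePart K ι (n + 1)) : counit y = 0 := by
  rw [degreePart, pow_succ] at hy
  refine Submodule.mul_induction_on hy (fun u _ v hv => ?_) fun u v hu hv => ?_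
  · suffices counit v = 0 by rw [map_mul, this, mul_zero]
    refine Submodule.span_induction ?_ ?_ ?_ ?_ hv
    · rintro _ ⟨i, rfl⟩; exact counit_ι i
    · simp
    · intro u v _ _ hu hv; rw [map_add, hu, hv, add_zero]
    · intro c u _ hu; rw [map_smul, hu, smul_zero]
  · rw [map_add, hu, hv, add_zero]

theorem linCoeff_eq_zero_of_mem_degreePart [DecidableEq ι] {n : ℕ} {y : FreeAlgebra K ι}
    (hy : y ∈ degreePart K ι (n + 2)) (m : ι) : linCoeff m y = 0 := by
  rw [degreePart, pow_succ] at hy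
  refine Submodule.mul_induction_on hy (fun u hu v hv => ?_) fun u v hu hv => ?_
  · have hv' : v ∈ degreePart K ι (0 + 1) := by rwa [degreePart, zero_add, pow_one]
    rw [linCoeff_mul, counit_eq_zero_of_mem_degreePart (n := n) hu,
      counit_eq_zero_of_mem_degreePart hv']
    simp
  · rw [map_add, hu, hv, add_zero]

end Grading

/-! ### The Nichols ideal equals the radical. -/

section Radical

variable {K : Type*} [Field K] {ι : Type*} [Fintype ι] [DecidableEq ι]
  {r : ι → ι → Matrix ι ι K}

theorem component_braidGen (n : ℕ) (y : FreeAlgebra K ι) (i m : ι) :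
    component n (braidGen r y i m) = braidGen r (component n y) i m := by
  induction y using freeAlgebra_induction_left generalizing n i m with
  | one =>
    rw [braidGen_one_apply, component_one]
    split_ifs with h1 h2 h2 <;> simp [component_one, h1, h2]
  | mul j y ih =>
    cases n with
    | zero =>
      simp [braidGen_mul_apply, component_zero_ι_mul, braidGen_ι, Finset.sum_mul]
    | succ n =>
      simp [braidGen_mul_apply, component_succ_ι_mul, braidGen_ι, Finset.sum_mul, ih]
  | add y z hy hz => simp only [map_add, Matrix.add_apply, hy, hz]
  | smul c y hy => simp only [map_smul, Matrix.smul_apply, hy]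

theorem skewDer_component_zero (m : ι) (y : FreeAlgebra K ι) :
    skewDer r m (component 0 y) = 0 := by
  rw [component_zero, Algebra.algebraMap_eq_smul_one, map_smul, skewDer_one, smul_zero]

theorem skewDer_component_succ (n : ℕ) (m : ι) (y : FreeAlgebra K ι) :
    skewDer r m (component (n + 1) y) = component n (skewDer r m y) := by
  induction y using freeAlgebra_induction_left generalizing n with
  | one => simp [component_one, skewDer_one]
  | mul i y ih =>
    rw [component_succ_ι_mul, skewDer_ι_mul, skewDer_ι_mul, map_add, component_braidGen]
    cases n with
    | zero => rw [skewDer_component_zero, mul_zero, component_zero_ι_mul]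
    | succ n => rw [ih, component_succ_ι_mul]
  | add y z hy hz => simp only [map_add, hy, hz]
  | smul c y hy => simp only [map_smul, hy]

/-- Derivations lower the degree by exactly one, so the condition on a word only sees one
homogeneous component. -/
theorem component_mem_radicalSubmodule {y : FreeAlgebra K ι} (hy : y ∈ radicalSubmodule r)
    (n : ℕ) : component n y ∈ radicalSubmodule r := by
  rw [mem_radicalSubmodule]
  intro w
  induction w generalizing n y with
  | nil =>
    change counit (component n y) = 0
    rw [counit_component, (mem_radicalSubmodule_iff.1 hy).1, ite_self]
  | cons m w ih =>
    change counit (wordDer r w (skewDer r m (component n y))) = 0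
    cases n with
    | zero => rw [skewDer_component_zero, map_zero, map_zero]
    | succ n =>
      rw [skewDer_component_succ]
      exact ih ((mem_radicalSubmodule_iff.1 hy).2 m) n

/-- The derivations read off the coefficients of a linear element. This is why the radical is
generated in degrees at least 2. -/
theorem eq_zero_of_mem_radicalSubmodule_of_mem_span {y : FreeAlgebra K ι}
    (hy : y ∈ radicalSubmodule r) (h : y ∈ Submodule.span K (Set.range (FreeAlgebra.ι K))) :
    y = 0 := by
  obtain ⟨c, rfl⟩ := (Submodule.mem_span_range_iff_exists_fun K).1 h
  refine Finset.sum_eq_zero fun m _ => ?_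
  have := (mem_radicalSubmodule_iff.1 ((mem_radicalSubmodule_iff.1 hy).2 m)).1
  simp only [map_sum, map_smul, skewDer_ι] at this
  simp at this
  rw [this, zero_smul]

theorem IsBraiding.isHopfIdeal_radical (h : IsBraiding r) : IsHopfIdeal r h.radical := by
  refine ⟨⟨{s | s ∈ radicalSubmodule r ∧ ∃ n, 2 ≤ n ∧ s ∈ degreePart K ι n}, fun s hs => hs.2,
    le_antisymm ?_ ?_⟩, ?_⟩
  · intro y hy
    rw [h.mem_radical] at hy
    let I := TwoSidedIdeal.span
      {s | s ∈ radicalSubmodule r ∧ ∃ n, 2 ≤ n ∧ s ∈ degreePart K ι n}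
    let S : Submodule K (FreeAlgebra K ι) :=
      { carrier := I
        zero_mem' := I.zero_mem
        add_mem' := I.add_mem
        smul_mem' := fun c u hu => by
          rw [Algebra.smul_def]; exact I.mul_mem_left _ _ hu }
    suffices y ∈ S from this
    refine mem_of_component_mem fun n => ?_
    have hn := component_mem_radicalSubmodule hy n
    match n with
    | 0 => rw [component_zero, (mem_radicalSubmodule_iff.1 hy).1, map_zero]; exact zero_mem _
    | 1 =>
      have := component_mem_degreePart 1 y
      rw [degreePart, pow_one] at this
      rw [eq_zero_of_mem_radicalSubmodule_of_mem_span hn this]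
      exact zero_mem _
    | n + 2 =>
      exact TwoSidedIdeal.subset_span ⟨hn, n + 2, by omega, component_mem_degreePart _ y⟩
  · rw [TwoSidedIdeal.span_le]
    exact fun s hs => h.mem_radical.2 hs.1
  · intro y hy
    simp only [h.mem_radical] at hy ⊢
    exact h.coproduct_mem_of_mem_radical hy

/-- Generation in degrees at least 2 leaves the ideal without constant and linear parts. Hence
contracting `I ⊗ T + T ⊗ I` with a linear coefficient on the right lands in `I`, so `I` is stable
under the derivations. -/
theorem IsHopfIdeal.mem_radicalSubmodule {I : TwoSidedIdeal (FreeAlgebra K ι)}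
    (hI : IsHopfIdeal r I) {y : FreeAlgebra K ι} (hy : y ∈ I) : y ∈ radicalSubmodule r := by
  obtain ⟨⟨S, hS, hIS⟩, hΔ⟩ := hI
  have hlin : ∀ y ∈ I, counit y = 0 ∧ ∀ m, linCoeff m y = 0 := by
    intro y hy
    rw [hIS] at hy
    refine TwoSidedIdeal.span_induction (p := fun y _ => counit y = 0 ∧ ∀ m, linCoeff m y = 0)
      ?_ ?_ ?_ ?_ ?_ ?_ hy
    · intro s hs
      obtain ⟨n, hn, hs⟩ := hS s hs
      obtain ⟨n, rfl⟩ := Nat.exists_eq_add_of_le' hn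
      exact ⟨counit_eq_zero_of_mem_degreePart (n := n + 1) hs,
        linCoeff_eq_zero_of_mem_degreePart hs⟩
    · simp
    · intro u v _ _ hu hv; simp [hu, hv]
    · intro u _ hu; simp [hu]
    · intro a u _ hu; simp [hu, linCoeff_mul]
    · intro a u _ hu; simp [hu, linCoeff_mul]
  let J : Submodule K (FreeAlgebra K ι) :=
    { carrier := I
      zero_mem' := I.zero_mem
      add_mem' := I.add_mem
      smul_mem' := fun c u hu => by
        rw [Algebra.smul_def]; exact I.mul_mem_left _ _ hu }
  refine le_radicalSubmodule (S := J) (fun y hy => (hlin y hy).1) (fun m y hy => ?_) hy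
  rw [skewDer, LinearMap.comp_apply]
  refine Submodule.span_induction ?_ ?_ ?_ ?_ (hΔ y hy)
  · rintro _ ⟨u, v, huv, rfl⟩
    rw [contractRight_tmul]
    rcases huv with hu | hv
    · exact J.smul_mem _ hu
    · rw [(hlin v hv).2, zero_smul]; exact J.zero_mem
  · rw [map_zero]; exact J.zero_mem
  · intro u v _ _ hu hv; rw [map_add]; exact J.add_mem hu hv
  · intro c u _ hu; rw [map_smul]; exact J.smul_mem _ hu

/-- The Nichols ideal consists of the elements all of whose iterated skew derivatives have
vanishing counit. -/
theorem IsBraiding.nicholsIdeal_eq (h : IsBraiding r) : nicholsIdeal r = h.radical :=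
  le_antisymm (sSup_le fun _ hI _ hy => h.mem_radical.2 (hI.mem_radicalSubmodule hy))
    (le_sSup h.isHopfIdeal_radical)

end Radical

/-! ### Calculus with the skew derivations of type `R_{1,2}`: the elements `v_n`. -/

/-- The structure on the Nichols algebra of type `R_{1,2}` used below: three generators,
the counit, the skew derivations `d1, d2, d3`, and the nonzero entries `g1, g2, g31, g32` of the
braiding with the generators. -/
structure R12Derivations {K : Type*} [Field K] (a b p q k : K) (B : Type*) [Ring B]
    [Algebra K B] where
  x₁ : B
  x₂ : B
  x₃ : B
  ε : B →ₗ[K] K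
  d1 : B →ₗ[K] B
  d2 : B →ₗ[K] B
  d3 : B →ₗ[K] B
  g1 : B →ₗ[K] B
  g2 : B →ₗ[K] B
  g31 : B →ₗ[K] B
  g32 : B →ₗ[K] B
  ε_one : ε 1 = 1
  ε_mul : ∀ u v, ε (u * v) = ε u * ε v
  ε_x₁ : ε x₁ = 0
  ε_x₂ : ε x₂ = 0
  ε_x₃ : ε x₃ = 0
  d1_one : d1 1 = 0
  d2_one : d2 1 = 0
  d3_one : d3 1 = 0
  d1_mul : ∀ u v, d1 (u * v) = u * d1 v + d1 u * g1 v + d3 u * g31 v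
  d2_mul : ∀ u v, d2 (u * v) = u * d2 v + d2 u * g2 v + d3 u * g32 v
  d3_mul : ∀ u v, d3 (u * v) = u * d3 v + d3 u * g1 v
  d1_x₁ : d1 x₁ = 1
  d1_x₂ : d1 x₂ = 0
  d1_x₃ : d1 x₃ = 0
  d2_x₁ : d2 x₁ = 0
  d2_x₂ : d2 x₂ = 1
  d2_x₃ : d2 x₃ = 0
  d3_x₁ : d3 x₁ = 0
  d3_x₂ : d3 x₂ = 0
  d3_x₃ : d3 x₃ = 1
  g1_one : g1 1 = 1
  g1_mul : ∀ u v, g1 (u * v) = g1 u * g1 v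
  g2_mul : ∀ u v, g2 (u * v) = g2 u * g2 v
  g31_mul : ∀ u v, g31 (u * v) = g1 u * g31 v + g31 u * g1 v
  g32_mul : ∀ u v, g32 (u * v) = g1 u * g32 v + g32 u * g2 v
  g1_x₁ : g1 x₁ = x₁
  g1_x₂ : g1 x₂ = x₂
  g1_x₃ : g1 x₃ = x₃ + p • x₁
  g2_x₁ : g2 x₁ = x₁
  g2_x₂ : g2 x₂ = x₂
  g2_x₃ : g2 x₃ = x₃ + q • x₁
  g31_x₁ : g31 x₁ = b • x₁
  g31_x₂ : g31 x₂ = b • x₂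
  g31_x₃ : g31 x₃ = b • x₃ + a • x₁ - k • x₂
  g32_x₁ : g32 x₁ = 0
  g32_x₂ : g32 x₂ = (p - q) • x₁
  g32_x₃ : g32 x₃ = k • x₁
  eq_zero : ∀ u, ε u = 0 → d1 u = 0 → d2 u = 0 → d3 u = 0 → u = 0

namespace R12Derivations

variable {K : Type*} [Field K] {a b p q k : K} {B : Type*} [Ring B] [Algebra K B]
  (S : R12Derivations a b p q k B)

/-- The elements `v_n`, with `v_0 = x_2` and `v_{n+1} = x_3 v_n - v_n x_3 - (n+1) b x_1 v_n`. -/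
def v : ℕ → B
  | 0 => S.x₂
  | n + 1 => S.x₃ * v n - v n * S.x₃ - (((n : K) + 1) * b) • (S.x₁ * v n)

/-- The coefficient of `∂_2 v_n`. -/
def rho (b p q : K) (n : ℕ) : K :=
  ((n : K) + 1) * ∏ j ∈ Finset.range n, ((p - b) / 2 - q - (j : K) * ((b + p) / 2))

/-- The coefficient of `g_{32} v_n`. -/
def gam (b p q : K) (n : ℕ) : K :=
  ∏ j ∈ Finset.range (n + 1), (p - q - (j : K) * ((b + p) / 2))

theorem gam_succ (n : ℕ) :
    gam b p q (n + 1) = gam b p q n * (p - q - ((n : K) + 1) * ((b + p) / 2)) := by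
  rw [gam, Finset.prod_range_succ, ← gam]; push_cast; rfl

theorem commute_x₂_x₁ : Commute S.x₂ S.x₁ := by
  refine sub_eq_zero.1 (S.eq_zero _ ?_ ?_ ?_ ?_) <;>
  simp [S.ε_mul, S.d1_mul, S.d2_mul, S.d3_mul, S.ε_x₁, S.d1_x₁, S.d1_x₂, S.d2_x₁, S.d2_x₂, S.d3_x₁,
    S.d3_x₂, S.g1_x₂, S.g2_x₁]

variable [CharZero K]

/-- Because `p - q - (b+p)/2 = (p-b)/2 - q`, the factors of index `j + 1` are the factors of `rho`.
This makes the recursion for `rho` close up into a product. -/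
theorem gam_eq (n : ℕ) :
    gam b p q n =
      (p - q) * ∏ j ∈ Finset.range n, ((p - b) / 2 - q - (j : K) * ((b + p) / 2)) := by
  rw [gam, Finset.prod_range_succ', mul_comm]
  congr 1
  · simp
  · refine Finset.prod_congr rfl fun j _ => ?_
    push_cast; ring

theorem rho_succ (n : ℕ) :
    rho b p q (n + 1) =
      rho b p q n * ((n : K) * ((b - p) / 2) - q - ((n : K) + 1) * b) + gam b p q n := by
  rw [gam_eq, rho, rho, Finset.prod_range_succ]; push_cast; ring

theorem x₃_mul_x₁ : S.x₃ * S.x₁ = S.x₁ * S.x₃ + ((b - p) / 2) • S.x₁ ^ 2 := by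
  refine sub_eq_zero.1 (S.eq_zero _ ?_ ?_ ?_ ?_) <;>
  simp only [map_sub, map_add, map_smul, pow_two, S.ε_mul, S.d1_mul, S.d2_mul, S.d3_mul, S.ε_x₁,
    S.d1_x₁, S.d1_x₃, S.d2_x₁, S.d2_x₃, S.d3_x₁, S.d3_x₃, S.g1_x₁, S.g1_x₃, S.g2_x₁,
    S.g31_x₁, S.g32_x₁, mul_zero, zero_mul, mul_one, one_mul, smul_zero, add_zero, zero_add, smul_add,
    sub_self]
  module

theorem x₃_mul_x₁_pow (n : ℕ) :
    S.x₃ * S.x₁ ^ n = S.x₁ ^ n * S.x₃ + ((n : K) * ((b - p) / 2)) • S.x₁ ^ (n + 1) := by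
  induction n with
  | zero => simp
  | succ n ih =>
    rw [pow_succ, ← mul_assoc, ih, add_mul, mul_assoc, x₃_mul_x₁, mul_add, smul_mul_assoc,
      mul_smul_comm, ← pow_add, ← pow_succ, ← mul_assoc, ← pow_succ]
    push_cast
    module

/-- The commutator with `x_3` sends `x_1` to a multiple of `x_1^2`, which commutes with `v_n` by
induction; the two contributions cancel. -/
theorem commute_x₁_v (n : ℕ) : Commute S.x₁ (S.v n) := by
  induction n with
  | zero => exact S.commute_x₂_x₁.symm
  | succ n ih =>
    have h1 : S.x₁ * (S.x₃ * S.v n) = S.x₃ * S.v n * S.x₁ - ((b - p) / 2) • (S.x₁ ^ 2 * S.v n) := by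
      rw [mul_assoc, ← ih.eq, ← mul_assoc, ← mul_assoc, S.x₃_mul_x₁, add_mul, smul_mul_assoc]
      abel
    have h2 : S.x₁ * (S.v n * S.x₃) = S.v n * S.x₃ * S.x₁ - ((b - p) / 2) • (S.x₁ ^ 2 * S.v n) := by
      rw [mul_assoc, S.x₃_mul_x₁, mul_add, mul_smul_comm, ← (ih.pow_left 2).eq, ← mul_assoc,
        ← mul_assoc, ih.eq]
      abel
    have h3 : S.x₁ * (S.x₁ * S.v n) = S.x₁ * S.v n * S.x₁ := by rw [mul_assoc, ih.eq]
    rw [Commute, SemiconjBy, v, mul_sub, mul_sub, h1, h2, mul_smul_comm, h3, sub_mul, sub_mul,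
      smul_mul_assoc]
    abel

/-- The statements need each other: `∂_1 v_{n+1}` uses `g31 v_n`, and the term `-(n+1) b x_1 v_n` is
chosen to cancel it; `∂_2 v_{n+1}` uses `g32 v_n`; and `g31 v_{n+1}` needs `v_n` to commute with
`x_1` and `x_2`, because of the terms in `a` and `k`. -/
theorem v_spec (n : ℕ) :
    Commute S.x₂ (S.v n) ∧ S.ε (S.v n) = 0 ∧ S.g1 (S.v n) = S.v n ∧ S.g2 (S.v n) = S.v n ∧
      S.g31 (S.v n) = (((n : K) + 1) * b) • S.v n ∧
      S.g32 (S.v n) = gam b p q n • S.x₁ ^ (n + 1) ∧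
      S.d1 (S.v n) = 0 ∧ S.d2 (S.v n) = rho b p q n • S.x₁ ^ n ∧ S.d3 (S.v n) = 0 := by
  induction n with
  | zero =>
    simp [v, S.ε_x₂, S.g1_x₂, S.g2_x₂, S.g31_x₂, S.g32_x₂, S.d1_x₂, S.d2_x₂, S.d3_x₂, gam, rho]
  | succ n ih =>
    obtain ⟨hY, hε, hg1, hg2, hg31, hg32, hd1, hd2, hd3⟩ := ih
    have hX := S.commute_x₁_v n
    have e0 : S.ε (S.v (n + 1)) = 0 := by
      simp [v, S.ε_mul, S.ε_x₃, S.ε_x₁]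
    have e1 : S.g1 (S.v (n + 1)) = S.v (n + 1) := by
      simp only [v, map_sub, map_smul, S.g1_mul, S.g1_x₃, S.g1_x₁, hg1, add_mul, mul_add,
        smul_mul_assoc, mul_smul_comm, hX.eq]
      abel
    have e2 : S.g2 (S.v (n + 1)) = S.v (n + 1) := by
      simp only [v, map_sub, map_smul, S.g2_mul, S.g2_x₃, S.g2_x₁, hg2, add_mul, mul_add,
        smul_mul_assoc, mul_smul_comm, hX.eq]
      abel
    have e3 : S.d3 (S.v (n + 1)) = 0 := by
      simp [v, S.d3_mul, S.d3_x₃, S.d3_x₁, hg1, hd3]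
    have e4 : S.d1 (S.v (n + 1)) = 0 := by
      simp [v, S.d1_mul, S.d1_x₃, S.d1_x₁, S.d3_x₃, S.d3_x₁, hg1, hd3, hd1, hg31]
    have e5 : S.d2 (S.v (n + 1)) = rho b p q (n + 1) • S.x₁ ^ (n + 1) := by
      simp only [v, map_sub, map_smul, S.d2_mul, S.d2_x₃, S.d2_x₁, S.d3_x₃, S.d3_x₁, hg2, hd3, hd2,
        hg32, S.g2_x₃, mul_smul_comm, smul_mul_assoc, S.x₃_mul_x₁_pow, mul_add, mul_zero, zero_mul,
        one_mul, ← pow_succ, ← pow_succ', add_zero]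
      rw [rho_succ]
      module
    have e6 : S.g32 (S.v (n + 1)) = gam b p q (n + 1) • S.x₁ ^ (n + 2) := by
      simp only [v, map_sub, map_smul, S.g32_mul, S.g1_x₃, hg1, hg2, hg32, S.g32_x₃, S.g32_x₁,
        S.g2_x₁, S.g2_x₃, mul_smul_comm, smul_mul_assoc, S.x₃_mul_x₁_pow, mul_add, add_mul,
        mul_zero, zero_add, ← pow_succ, ← pow_succ', hX.eq]
      rw [gam_succ]
      push_cast
      module
    have e7 : S.g31 (S.v (n + 1)) = ((((n + 1 : ℕ) : K) + 1) * b) • S.v (n + 1) := by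
      simp only [v, map_sub, map_smul, S.g31_mul, S.g1_x₃, S.g1_x₁, hg1, hg31, S.g31_x₃,
        S.g31_x₁, mul_smul_comm, smul_mul_assoc, mul_add, mul_sub, add_mul, sub_mul, hX.eq, hY.eq]
      push_cast
      module
    refine ⟨?_, e0, e1, e2, e7, e6, e4, e5, e3⟩
    -- The commutator with `x_2` is differentiated; only `∂_2` gives something nontrivial, namely a
    -- multiple of the commutator of `x_2` with a power of `x_1`.
    refine sub_eq_zero.1 (S.eq_zero _ ?_ ?_ ?_ ?_)
    · simp [S.ε_mul, S.ε_x₂]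
    · simp [S.d1_mul, e4, e3, S.d1_x₂, S.d3_x₂]
    · simp only [map_sub, S.d2_mul, e5, e3, e2, S.d2_x₂, S.d3_x₂, S.g2_x₂, zero_mul, add_zero,
        mul_smul_comm, smul_mul_assoc, one_mul, mul_one, (S.commute_x₂_x₁.pow_right (n + 1)).eq]
      abel
    · simp [S.d3_mul, e3, S.d3_x₂]

theorem ε_v (n : ℕ) : S.ε (S.v n) = 0 := (S.v_spec n).2.1
theorem g1_v (n : ℕ) : S.g1 (S.v n) = S.v n := (S.v_spec n).2.2.1
theorem g2_v (n : ℕ) : S.g2 (S.v n) = S.v n := (S.v_spec n).2.2.2.1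
theorem d1_v (n : ℕ) : S.d1 (S.v n) = 0 := (S.v_spec n).2.2.2.2.2.2.1
theorem d2_v (n : ℕ) : S.d2 (S.v n) = rho b p q n • S.x₁ ^ n := (S.v_spec n).2.2.2.2.2.2.2.1
theorem d3_v (n : ℕ) : S.d3 (S.v n) = 0 := (S.v_spec n).2.2.2.2.2.2.2.2

/-- Under `∂_2` the commutator becomes a combination of commutators of `v_m`, `v_n` with powers of
`x_1`, and the other derivations kill it. This is the source of the relations (2). -/
theorem commute_v_v (m n : ℕ) : Commute (S.v m) (S.v n) := by
  refine sub_eq_zero.1 (S.eq_zero _ ?_ ?_ ?_ ?_)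
  · simp [S.ε_mul, S.ε_v]
  · simp [S.d1_mul, S.d1_v, S.d3_v]
  · simp only [map_sub, S.d2_mul, S.d2_v, S.d3_v, S.g2_v, zero_mul, add_zero, mul_smul_comm,
      smul_mul_assoc, ((S.commute_x₁_v _).pow_left _).eq]
    abel
  · simp [S.d3_mul, S.d3_v]

end R12Derivations

/-! ### Polynomials in commuting elements, and ideals stable under derivations. -/

section CommAeval

variable {K : Type*} [Field K] {A : Type*} [Ring A] [Algebra K A] {σ : Type*}

open scoped IsMulCommutative in
/-- Evaluation of polynomials at a commuting family of elements of an algebra. -/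
def commAeval (y : σ → A) (hy : ∀ i j, Commute (y i) (y j)) : MvPolynomial σ K →ₐ[K] A :=
  haveI : IsMulCommutative (Algebra.adjoin K (Set.range y)) :=
    Algebra.isMulCommutative_adjoin K (by rintro _ ⟨i, rfl⟩ _ ⟨j, rfl⟩; exact hy i j)
  (Algebra.adjoin K (Set.range y)).val.comp
    (MvPolynomial.aeval fun i => (⟨y i, Algebra.subset_adjoin ⟨i, rfl⟩⟩ :
      Algebra.adjoin K (Set.range y)))

theorem commAeval_X (y : σ → A) (hy : ∀ i j, Commute (y i) (y j)) (i : σ) :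
    commAeval (K := K) y hy (MvPolynomial.X i) = y i := by
  simp [commAeval]

end CommAeval

section Stable

open MvPolynomial

variable {K : Type*} [Field K] {σ : Type*}

theorem pderiv_mem_supported {s : Set σ} {f : MvPolynomial σ K} (hf : f ∈ supported K s) (i : σ) :
    pderiv i f ∈ supported K s := by
  classical
  refine Algebra.adjoin_induction ?_ ?_ ?_ ?_ hf
  · rintro _ ⟨j, -, rfl⟩
    rw [pderiv_X, Pi.single_apply]
    split_ifs
    · exact one_mem _
    · exact zero_mem _
  · intro c; rw [algebraMap_eq, pderiv_C]; exact zero_mem _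
  · intro u v _ _ hu hv; rw [map_add]; exact add_mem hu hv
  · intro u v hu' hv' hu hv
    rw [pderiv_mul]
    exact add_mem (mul_mem hu hv') (mul_mem hu' hv)

/-- The derivation `e_k` of `K[X_0, X_1, …]` with `e_k X_0 = 0` and
`e_k X_{n+1} = n (n-1) ⋯ (n-k+1) ρ_n X_0^{n-k}`. -/
def lowering (ρ : ℕ → K) (k : ℕ) : Derivation K (MvPolynomial ℕ K) (MvPolynomial ℕ K) :=
  mkDerivation K fun i => Nat.casesOn i 0 fun n => C (ρ n * n.descFactorial k) * X 0 ^ (n - k)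

theorem lowering_X_zero (ρ : ℕ → K) (k : ℕ) : lowering ρ k (X 0) = 0 := by
  simp [lowering, mkDerivation_X]

theorem lowering_X_succ (ρ : ℕ → K) (k n : ℕ) :
    lowering ρ k (X (n + 1)) = C (ρ n * n.descFactorial k) * X 0 ^ (n - k) := by
  simp [lowering, mkDerivation_X]

/-- Bracketing with `∂/∂X_0` differentiates the coefficients `X_0^{n-k}`. So an ideal stable under
`∂/∂X_0` and `lowering ρ 0` is stable under the whole family. -/
theorem lowering_succ (ρ : ℕ → K) (k : ℕ) :
    lowering ρ (k + 1) = ⁅(pderiv 0 : Derivation K (MvPolynomial ℕ K) _), lowering ρ k⁆ := by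
  refine derivation_ext fun i => ?_
  rw [Derivation.commutator_apply]
  cases i with
  | zero => simp [lowering_X_zero]
  | succ n =>
    rw [lowering_X_succ, lowering_X_succ, pderiv_X_of_ne (Nat.succ_ne_zero n), map_zero, sub_zero,
      pderiv_C_mul, pderiv_pow, pderiv_X_self, mul_one, Nat.descFactorial_succ, Nat.sub_sub]
    push_cast
    simp only [map_mul, map_natCast]
    ring

variable [CharZero K]

/-- A set of polynomials without constant term that is stable under partial derivatives is
zero. -/
theorem eq_zero_of_pderiv_stable {S : Set (MvPolynomial σ K)}
    (h0 : ∀ f ∈ S, constantCoeff f = 0) (h1 : ∀ f ∈ S, ∀ i, pderiv i f ∈ S)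
    {f : MvPolynomial σ K} (hf : f ∈ S) : f = 0 := by
  have key : ∀ n (m : σ →₀ ℕ), m.degree = n → ∀ f ∈ S, coeff m f = 0 := by
    intro n
    induction n with
    | zero =>
      intro m hm f hf
      rw [(Finsupp.degree_eq_zero_iff m).1 hm]
      exact h0 f hf
    | succ n ih =>
      intro m hm f hf
      have hne : m ≠ 0 := by rintro rfl; simp at hm
      obtain ⟨i, hi⟩ := Finsupp.ne_iff.1 hne
      have hle : Finsupp.single i 1 ≤ m := by
        rw [Finsupp.single_le_iff]; exact Nat.one_le_iff_ne_zero.2 hi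
      obtain ⟨m', rfl⟩ := exists_add_of_le hle
      rw [add_comm] at hm ⊢
      have hm' : m'.degree = n := by
        rw [map_add, Finsupp.degree_single] at hm; omega
      have h := ih m' hm' _ (h1 f hf i)
      rw [coeff_pderiv] at h
      exact (mul_eq_zero.1 h).resolve_right (Nat.cast_add_one_ne_zero _)
  ext m
  rw [key _ m rfl f hf, coeff_zero]

/-- On polynomials in `X_0, …, X_{N+1}` the operators `lowering ρ k` form a triangular system in the
partial derivatives `∂_{n+1}`: terms with `n < k` vanish and the term `n = k` has the constant
coefficient `ρ_k k!`, invertible for `k ≤ N`. Solving it shows that all partial derivatives of `f`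
stay in the ideal, and in characteristic zero an element without constant terms among its iterated
derivatives is zero. -/
theorem eq_zero_of_lowering_stable {ρ : ℕ → K} {N : ℕ} (hρ : ∀ n ≤ N, ρ n ≠ 0)
    (I : Ideal (MvPolynomial ℕ K)) (h0 : ∀ f ∈ I, constantCoeff f = 0)
    (h1 : ∀ f ∈ I, pderiv 0 f ∈ I) (h2 : ∀ f ∈ I, lowering ρ 0 f ∈ I)
    {f : MvPolynomial ℕ K} (hf : f ∈ I) (hs : f ∈ supported K {i | i ≤ N + 1}) : f = 0 := by
  have hlow : ∀ k, ∀ f ∈ I, lowering ρ k f ∈ I := by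
    intro k
    induction k with
    | zero => exact h2
    | succ k ih =>
      intro f hf
      rw [lowering_succ, Derivation.commutator_apply]
      exact sub_mem (h1 _ (ih f hf)) (ih _ (h1 f hf))
  have hformula : ∀ k, ∀ f ∈ supported K {i | i ≤ N + 1}, lowering ρ k f =
      ∑ n ∈ Finset.range (N + 1),
        C (ρ n * n.descFactorial k) * X 0 ^ (n - k) * pderiv (n + 1) f := by
    intro k f hf
    let D : Derivation K (MvPolynomial ℕ K) (MvPolynomial ℕ K) :=
      ∑ n ∈ Finset.range (N + 1),
        (C (ρ n * n.descFactorial k) * X 0 ^ (n - k) : MvPolynomial ℕ K) • pderiv (n + 1)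
    have hD : ∀ f, D f = ∑ n ∈ Finset.range (N + 1),
        C (ρ n * n.descFactorial k) * X 0 ^ (n - k) * pderiv (n + 1) f := by
      intro f
      have := congrFun (map_sum (Derivation.coeFnAddMonoidHom (R := K)
        (A := MvPolynomial ℕ K) (M := MvPolynomial ℕ K)) (fun n =>
        (C (ρ n * n.descFactorial k) * X 0 ^ (n - k) : MvPolynomial ℕ K) • pderiv (n + 1))
        (Finset.range (N + 1))) f
      rw [Finset.sum_apply] at this
      exact this
    rw [← hD]
    refine derivation_eqOn_supported (fun i hi => ?_) hf
    simp only [Function.comp_apply]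
    rw [hD]
    cases i with
    | zero =>
      rw [lowering_X_zero]
      symm
      refine Finset.sum_eq_zero fun n _ => ?_
      rw [pderiv_X_of_ne (Nat.succ_ne_zero n).symm, mul_zero]
    | succ m =>
      have hm : m ∈ Finset.range (N + 1) := by
        have : m + 1 ≤ N + 1 := hi
        simp; omega
      rw [lowering_X_succ, Finset.sum_eq_single_of_mem m hm, pderiv_X_self, mul_one]
      intro n _ hn
      rw [pderiv_X_of_ne (by simpa using hn.symm), mul_zero]
  refine eq_zero_of_pderiv_stable (S := {f | f ∈ I ∧ f ∈ supported K {i | i ≤ N + 1}})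
    (fun f hf => h0 f hf.1) (fun f hf i => ⟨?_, pderiv_mem_supported hf.2 i⟩) ⟨hf, hs⟩
  obtain ⟨hf, hs⟩ := hf
  -- Descending induction on `k = N - d`: the operator of index `k` yields `∂_{k+1} f` once the
  -- higher partial derivatives are known to lie in the ideal.
  have key : ∀ d k, k + d = N → ∀ n, k ≤ n → n ≤ N → pderiv (n + 1) f ∈ I := by
    intro d
    induction d with
    | zero =>
      rintro k hk n hn hN
      have hkn : n = N := by omega
      have h := hlow N f hf
      rw [hformula N f hs, Finset.sum_eq_single_of_mem N (by simp)] at h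
      · subst hkn
        rw [Nat.sub_self, pow_zero, mul_one] at h
        have := I.mul_mem_left (C (ρ n * n.descFactorial n)⁻¹) h
        rwa [← mul_assoc, ← C_mul, inv_mul_cancel₀, C_1, one_mul] at this
        exact mul_ne_zero (hρ n le_rfl) (by exact_mod_cast (Nat.descFactorial_self n ▸
          Nat.factorial_ne_zero n))
      · intro m hm hmN
        have : m.descFactorial N = 0 := by
          rw [Nat.descFactorial_eq_zero_iff_lt]; simp at hm; omega
        simp [this]
    | succ d ih =>
      rintro k hk n hn hN
      have ih' := ih (k + 1) (by omega)
      by_cases hkn : k + 1 ≤ n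
      · exact ih' n hkn hN
      obtain rfl : n = k := by omega
      have h := hlow n f hf
      rw [hformula n f hs, ← Finset.add_sum_erase _ _ (Finset.mem_range.2 (by omega : n < N + 1)),
        Ideal.add_mem_iff_left] at h
      · rw [Nat.sub_self, pow_zero, mul_one] at h
        have := I.mul_mem_left (C (ρ n * n.descFactorial n)⁻¹) h
        rwa [← mul_assoc, ← C_mul, inv_mul_cancel₀, C_1, one_mul] at this
        exact mul_ne_zero (hρ n hN) (by exact_mod_cast (Nat.descFactorial_self n ▸
          Nat.factorial_ne_zero n))
      · refine Ideal.sum_mem _ fun m hm => ?_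
        rw [Finset.mem_erase, Finset.mem_range] at hm
        rcases lt_or_gt_of_ne hm.1 with hlt | hgt
        · rw [Nat.descFactorial_eq_zero_iff_lt.2 hlt]; simp
        · exact I.mul_mem_left _ (ih' m hgt (by omega))
  match i with
  | 0 => exact h1 f hf
  | n + 1 =>
    by_cases hn : n ≤ N
    · exact key N 0 (by omega) n (by omega) hn
    · rw [pderiv_eq_zero_of_notMem_vars]
      · exact zero_mem _
      · intro hmem
        have : n + 1 ≤ N + 1 := mem_supported.1 hs hmem
        omega

end Stable

/-! ### Independence of the monomials in `x_1, v_0, v_1, …`. -/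

namespace R12Derivations

open MvPolynomial

variable {K : Type*} [Field K] [CharZero K] {a b p q k : K} {B : Type*} [Ring B] [Algebra K B]
  (S : R12Derivations a b p q k B)

/-- The family `x_1, v_0, v_1, …`. -/
def vFamily : ℕ → B
  | 0 => S.x₁
  | n + 1 => S.v n

theorem commute_vFamily (i j : ℕ) : Commute (S.vFamily i) (S.vFamily j) := by
  cases i <;> cases j
  · exact Commute.refl _
  · exact S.commute_x₁_v _
  · exact (S.commute_x₁_v _).symm
  · exact S.commute_v_v _ _

/-- Evaluation at `x_1, v_0, v_1, …`. -/
def φ : MvPolynomial ℕ K →ₐ[K] B := commAeval S.vFamily S.commute_vFamily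

theorem φ_X_zero : S.φ (X 0) = S.x₁ := commAeval_X _ _ _
theorem φ_X_succ (n : ℕ) : S.φ (X (n + 1)) = S.v n := commAeval_X _ _ _

theorem φ_comm (f g : MvPolynomial ℕ K) : S.φ f * S.φ g = S.φ g * S.φ f := by
  rw [← map_mul, mul_comm, map_mul]

theorem φ_C (c : K) : S.φ (C c) = c • (1 : B) := by
  rw [← algebraMap_eq, AlgHom.commutes, Algebra.algebraMap_eq_smul_one]

theorem φ_C_mul (c : K) (f : MvPolynomial ℕ K) : S.φ (C c * f) = c • S.φ f := by
  rw [C_mul', map_smul]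

theorem ε_φ (f : MvPolynomial ℕ K) : S.ε (S.φ f) = constantCoeff f := by
  induction f using MvPolynomial.induction_on with
  | C c => rw [φ_C, map_smul, S.ε_one, constantCoeff_C, smul_eq_mul, mul_one]
  | add f g hf hg => rw [map_add, map_add, map_add, hf, hg]
  | mul_X f i hf =>
    rw [map_mul, S.ε_mul, map_mul, constantCoeff_X, mul_zero]
    cases i with
    | zero => rw [φ_X_zero, S.ε_x₁, mul_zero]
    | succ n => rw [φ_X_succ, S.ε_v, mul_zero]

theorem g1_φ (f : MvPolynomial ℕ K) : S.g1 (S.φ f) = S.φ f := by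
  induction f using MvPolynomial.induction_on with
  | C c => rw [φ_C, map_smul, S.g1_one]
  | add f g hf hg => rw [map_add, map_add, hf, hg]
  | mul_X f i hf =>
    rw [map_mul, S.g1_mul, hf]
    cases i with
    | zero => rw [φ_X_zero, S.g1_x₁]
    | succ n => rw [φ_X_succ, S.g1_v]

theorem d3_φ (f : MvPolynomial ℕ K) : S.d3 (S.φ f) = 0 := by
  induction f using MvPolynomial.induction_on with
  | C c => rw [φ_C, map_smul, S.d3_one, smul_zero]
  | add f g hf hg => rw [map_add, map_add, hf, hg, add_zero]
  | mul_X f i hf =>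
    rw [map_mul, S.d3_mul, hf, zero_mul, add_zero]
    cases i with
    | zero => rw [φ_X_zero, S.d3_x₁, mul_zero]
    | succ n => rw [φ_X_succ, S.d3_v, mul_zero]

/-- On the image of `φ`, `g1` is the identity and `d3` vanishes, so the twisted Leibniz rule is the
ordinary one and the generators decide. -/
theorem d1_φ (f : MvPolynomial ℕ K) : S.d1 (S.φ f) = S.φ (pderiv 0 f) := by
  induction f using MvPolynomial.induction_on with
  | C c => rw [φ_C, map_smul, S.d1_one, smul_zero, pderiv_C, map_zero]
  | add f g hf hg => rw [map_add, map_add, map_add, map_add, hf, hg]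
  | mul_X f i hf =>
    rw [map_mul, S.d1_mul, S.d3_φ, zero_mul, add_zero, hf, pderiv_mul, S.g1_φ, map_add, map_mul,
      map_mul]
    cases i with
    | zero => rw [pderiv_X_self, map_one, φ_X_zero, S.d1_x₁, add_comm]
    | succ n =>
      rw [φ_X_succ, S.d1_v, pderiv_X_of_ne (Nat.succ_ne_zero n), map_zero, add_comm]

theorem d2_φ (f : MvPolynomial ℕ K) : S.d2 (S.φ f) = S.φ (lowering (rho b p q) 0 f) := by
  induction f using MvPolynomial.induction_on with
  | C c => rw [φ_C, map_smul, S.d2_one, smul_zero, derivation_C, map_zero]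
  | add f g hf hg => rw [map_add, map_add, map_add, map_add, hf, hg]
  | mul_X f i hf =>
    rw [map_mul, S.d2_mul, S.d3_φ, zero_mul, add_zero, hf, Derivation.leibniz, smul_eq_mul,
      smul_eq_mul, map_add, map_mul, map_mul]
    cases i with
    | zero =>
      rw [lowering_X_zero, map_zero, φ_X_zero, S.d2_x₁, S.g2_x₁, ← S.φ_X_zero, S.φ_comm]
    | succ n =>
      rw [φ_X_succ, S.d2_v, lowering_X_succ, S.g2_v, map_mul, map_pow, S.φ_X_zero, φ_C,
        ← S.φ_X_succ, S.φ_comm]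
      simp

/-- `φ` is injective on the polynomials in `x_1, v_0, …, v_N` if `ρ_0, …, ρ_N ≠ 0`. -/
theorem eq_zero_of_φ_eq_zero {N : ℕ} (hρ : ∀ n ≤ N, rho b p q n ≠ 0) {f : MvPolynomial ℕ K}
    (hs : f ∈ supported K {i | i ≤ N + 1}) (hf : S.φ f = 0) : f = 0 := by
  refine eq_zero_of_lowering_stable hρ (RingHom.ker S.φ) ?_ ?_ ?_ hf hs
  · intro f hf
    rw [← S.ε_φ, (RingHom.mem_ker).1 hf, map_zero]
  · intro f hf
    rw [RingHom.mem_ker, ← S.d1_φ, (RingHom.mem_ker).1 hf, map_zero]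
  · intro f hf
    rw [RingHom.mem_ker, ← S.d2_φ, (RingHom.mem_ker).1 hf, map_zero]

end R12Derivations

/-! ### From `v_n` to `z_n`, and separation of the powers of `x_3`. -/

namespace R12Derivations

open MvPolynomial

section Polynomials

variable {K : Type*} [Field K] (b p q : K)

/-- The derivation of `K[x_1, v_0, v_1, …]` induced by the commutator with `x_3`. -/
def adDer : Derivation K (MvPolynomial ℕ K) (MvPolynomial ℕ K) :=
  mkDerivation K fun i => Nat.casesOn i (C ((b - p) / 2) * X 0 ^ 2) fun n =>
    X (n + 2) + C (((n : K) + 1) * b) * (X 0 * X (n + 1))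

theorem adDer_X_zero : adDer b p (X 0) = C ((b - p) / 2) * X 0 ^ 2 :=
  mkDerivation_X _ _ _

theorem adDer_X_succ (n : ℕ) :
    adDer b p (X (n + 1)) = X (n + 2) + C (((n : K) + 1) * b) * (X 0 * X (n + 1)) := by
  rw [adDer, mkDerivation_X]

/-- The polynomial in `x_1, v_0, …, v_n` representing `z_n`. -/
def zPoly : ℕ → MvPolynomial ℕ K
  | 0 => X 1
  | n + 1 => adDer b p (zPoly n) - C (((n : K) + 1) * b) * (X 0 * zPoly n) +
      C ((n.factorial : K) * (q - p) * ((-b - p) / 2) ^ n) * (X 0 ^ (n + 1) * X 1)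

/-- The polynomial in `x_1, z_0, …, z_n` representing `v_n`. -/
def vPoly : ℕ → MvPolynomial ℕ K
  | 0 => X 1
  | n + 1 => X (n + 2) + C (((n : K) + 1) * ((b + p) / 2)) * (X 0 * X (n + 1)) +
      C ((p - b) / 2 - q - (n : K) * ((b + p) / 2)) * (X 0 * vPoly n)

theorem X_mem_supported_Iic {i n : ℕ} (h : i ≤ n) :
    (X i : MvPolynomial ℕ K) ∈ supported K {i | i ≤ n} :=
  X_mem_supported.2 h

/-- The substitution `v_n ↦ z_n`. -/
def zSubst : MvPolynomial ℕ K →ₐ[K] MvPolynomial ℕ K :=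
  aeval fun i => Nat.casesOn i (X 0) fun n => zPoly b p q n

theorem zSubst_X_zero : zSubst b p q (X 0) = X 0 := aeval_X _ _

theorem zSubst_X_succ (n : ℕ) : zSubst b p q (X (n + 1)) = zPoly b p q n := aeval_X _ _

variable [CharZero K]

/-- The inductive step applies the commutator with `x_3` to the previous identity. The factorial
term in the definition of `z_n` is what keeps the right-hand side to two terms: its multiples of
`X_0^{n+1} X_1` cancel in that step. -/
theorem zPoly_add (n : ℕ) :
    zPoly b p q (n + 1) + C (((n : K) + 1) * ((b + p) / 2)) * (X 0 * zPoly b p q n) =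
      X (n + 2) - C ((p - b) / 2 - q - (n : K) * ((b + p) / 2)) * (X 0 * X (n + 1)) := by
  -- Inside `C` the halves are opaque to ring normalization, so their defining equation is supplied
  -- separately.
  have h2 : (C (2⁻¹ : K) : MvPolynomial ℕ K) * 2 = 1 := by
    rw [← map_ofNat (C : K →+* MvPolynomial ℕ K) 2, ← C_mul, inv_mul_cancel₀ two_ne_zero, C_1]
  induction n with
  | zero =>
    simp only [zPoly, adDer_X_succ, div_eq_mul_inv, C_add, C_sub, C_mul, C_1,
      Nat.factorial, pow_zero, map_zero, Nat.cast_one, Nat.cast_zero]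
    linear_combination (C p * X 0 * X 1 : MvPolynomial ℕ K) * h2
  | succ n ih =>
    have hD := congrArg (adDer b p) ih
    have e1 : adDer b p (zPoly b p q (n + 1)) = zPoly b p q (n + 2) +
        C ((((n + 1 : ℕ) : K) + 1) * b) * (X 0 * zPoly b p q (n + 1)) -
        C (((n + 1).factorial : K) * (q - p) * ((-b - p) / 2) ^ (n + 1)) *
          (X 0 ^ (n + 2) * X 1) := by
      rw [zPoly.eq_def b p q (n + 2)]; ring
    have e0 : adDer b p (zPoly b p q n) = zPoly b p q (n + 1) +
        C (((n : K) + 1) * b) * (X 0 * zPoly b p q n) -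
        C ((n.factorial : K) * (q - p) * ((-b - p) / 2) ^ n) * (X 0 ^ (n + 1) * X 1) := by
      rw [zPoly.eq_def b p q (n + 1)]; ring
    simp only [map_add, map_sub, derivation_C, Derivation.leibniz, adDer_X_zero, adDer_X_succ,
      e0, e1, smul_eq_mul] at hD
    simp only [Nat.factorial_succ, Nat.cast_mul] at hD ih ⊢
    simp only [div_eq_mul_inv, C_add, C_sub, C_mul, C_neg, C_1, C_pow, map_natCast, Nat.cast_add,
      Nat.cast_one] at hD ih ⊢
    linear_combination hD - ((n + 1) * C b + (C b - C p) * C 2⁻¹) * X 0 * ih +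
      C b * X 0 * (zPoly b p q (n + 1) - X (n + 2)) * h2

theorem zPoly_mem_supported (n : ℕ) : zPoly b p q n ∈ supported K {i | i ≤ n + 1} := by
  induction n with
  | zero => exact X_mem_supported_Iic le_rfl
  | succ n ih =>
    have hC : ∀ c : K, C c ∈ supported K {i | i ≤ n + 2} := fun c => Subalgebra.algebraMap_mem _ c
    have hX : ∀ i, i ≤ n + 2 → (X i : MvPolynomial ℕ K) ∈ supported K {i | i ≤ n + 2} :=
      fun i hi => X_mem_supported_Iic hi
    have ih' : zPoly b p q n ∈ supported K {i | i ≤ n + 2} :=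
      supported_mono (fun i (hi : i ≤ n + 1) => (hi.trans (Nat.le_succ _) : i ≤ n + 2)) ih
    rw [eq_sub_of_add_eq (zPoly_add b p q n)]
    exact sub_mem (sub_mem (hX _ le_rfl) (mul_mem (hC _) (mul_mem (hX _ (by omega))
      (hX _ (by omega))))) (mul_mem (hC _) (mul_mem (hX _ (by omega)) ih'))

/-- `vPoly` solves the triangular identity `zPoly_add` recursively for `v_{n+1}`; substituting it is
a left inverse. -/
theorem zSubst_injective : Function.Injective (zSubst b p q) := by
  let η : MvPolynomial ℕ K →ₐ[K] MvPolynomial ℕ K :=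
    aeval fun i => Nat.casesOn i (X 0) fun n => vPoly b p q n
  have h0 : η (X 0) = X 0 := aeval_X _ _
  have h1 : ∀ n, η (X (n + 1)) = vPoly b p q n := fun n => aeval_X _ _
  have hC : ∀ c, η (C c) = C c := fun c => η.commutes c
  have hz : ∀ n, η (zPoly b p q n) = X (n + 1) := by
    intro n
    induction n with
    | zero => exact h1 0
    | succ n ih =>
      have := congrArg η (zPoly_add b p q n)
      rw [map_add, map_sub, map_mul η, map_mul η, map_mul η, map_mul η, h0, h1, h1, ih, hC, hC,
        vPoly] at this
      linear_combination this
  have hid : η.comp (zSubst b p q) = AlgHom.id K _ := by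
    refine MvPolynomial.algHom_ext fun i => ?_
    cases i with
    | zero => simp [zSubst_X_zero, h0]
    | succ n => simp [zSubst_X_succ, hz]
  exact Function.LeftInverse.injective (g := η) fun f => DFunLike.congr_fun hid f

theorem zSubst_mem_supported {N : ℕ} {f : MvPolynomial ℕ K}
    (hf : f ∈ supported K {i | i ≤ N + 1}) : zSubst b p q f ∈ supported K {i | i ≤ N + 1} := by
  refine Algebra.adjoin_induction ?_ ?_ ?_ ?_ hf
  · rintro _ ⟨i, hi, rfl⟩
    replace hi : i ≤ N + 1 := hi
    cases i with
    | zero => rw [zSubst_X_zero]; exact X_mem_supported_Iic (Nat.zero_le _)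
    | succ n =>
      rw [zSubst_X_succ]
      exact supported_mono (fun j (hj : j ≤ n + 1) => (hj.trans hi : j ≤ N + 1))
        (zPoly_mem_supported b p q n)
  · intro c; rw [AlgHom.commutes]; exact Subalgebra.algebraMap_mem _ c
  · intro u v _ _ hu hv; rw [map_add]; exact add_mem hu hv
  · intro u v _ _ hu hv; rw [map_mul]; exact mul_mem hu hv

end Polynomials

variable {K : Type*} [Field K] [CharZero K] {a b p q k : K} {B : Type*} [Ring B] [Algebra K B]
  (S : R12Derivations a b p q k B)

theorem x₃_mul_φ (f : MvPolynomial ℕ K) :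
    S.x₃ * S.φ f = S.φ f * S.x₃ + S.φ (adDer b p f) := by
  induction f using MvPolynomial.induction_on with
  | C c => rw [derivation_C, map_zero, add_zero, φ_C, smul_mul_assoc, mul_smul_comm, one_mul,
      mul_one]
  | add f g hf hg => rw [map_add, mul_add, hf, hg, map_add, map_add, add_mul]; abel
  | mul_X f i hf =>
    have hX : S.x₃ * S.φ (X i) = S.φ (X i) * S.x₃ + S.φ (adDer b p (X i)) := by
      cases i with
      | zero =>
        rw [φ_X_zero, S.x₃_mul_x₁, adDer_X_zero, φ_C_mul, map_pow, φ_X_zero]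
      | succ n =>
        rw [adDer_X_succ, map_add, φ_C_mul, map_mul, φ_X_zero, φ_X_succ, φ_X_succ, v]
        abel
    rw [map_mul, ← mul_assoc, hf, add_mul, mul_assoc, hX, mul_add, Derivation.leibniz, smul_eq_mul,
      smul_eq_mul, map_add, map_mul, map_mul, S.φ_comm (X i), mul_assoc, add_assoc]

/-- The elements `z_n`. -/
def z : ℕ → B
  | 0 => S.x₂
  | n + 1 =>
    (S.x₃ - (((n : K) + 1) * b) • S.x₁) * z n - z n * S.x₃ +
      ((n.factorial : K) * (q - p) * ((-b - p) / 2) ^ n) • (S.x₁ ^ (n + 1) * S.x₂)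

theorem φ_zPoly (n : ℕ) : S.φ (zPoly b p q n) = S.z n := by
  induction n with
  | zero => exact S.φ_X_succ 0
  | succ n ih =>
    rw [zPoly, z, map_add, map_sub, φ_C_mul, φ_C_mul, map_mul, map_mul, map_pow,
      φ_X_zero, S.φ_X_succ 0, v, ← ih, sub_mul, x₃_mul_φ, smul_mul_assoc]
    abel

theorem commute_z_z (m n : ℕ) : Commute (S.z m) (S.z n) := by
  rw [← φ_zPoly, ← φ_zPoly]; exact S.φ_comm _ _

/-- If `ρ_{n+1} = 0`, then `v_{n+1} = 0`. -/
theorem v_succ_eq_zero {n : ℕ} (h : rho b p q (n + 1) = 0) : S.v (n + 1) = 0 :=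
  S.eq_zero _ (S.ε_v _) (S.d1_v _) (by rw [S.d2_v, h, zero_smul]) (S.d3_v _)

/-- The coefficient assumed to vanish is both that of `x_1 v_n` in `zPoly_add` and the last factor
of `rho b p q (n + 1)`. The first fact reduces the left-hand side to `v_{n+1}`, the second makes
`v_{n+1}` zero. -/
theorem z_succ_add {n : ℕ} (h : (p - b) / 2 - q - (n : K) * ((b + p) / 2) = 0) :
    S.z (n + 1) + (((n : K) + 1) * ((b + p) / 2)) • (S.x₁ * S.z n) = 0 := by
  have e := congrArg S.φ (zPoly_add b p q n)
  rw [h, map_zero, zero_mul, sub_zero, map_add, φ_C_mul, map_mul, φ_zPoly, φ_zPoly, φ_X_zero,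
    φ_X_succ] at e
  rw [e]
  apply S.v_succ_eq_zero
  rw [rho, Finset.prod_range_succ, h, mul_zero, mul_zero]

/-- The span of the elements `u x_3^i`, `i < j`, with `u` a polynomial in `x_1` and the `v_n`. -/
def lowerPart (j : ℕ) : Submodule K B :=
  Submodule.span K {y | ∃ f : MvPolynomial ℕ K, ∃ i < j, y = S.φ f * S.x₃ ^ i}

theorem mem_lowerPart (f : MvPolynomial ℕ K) {i j : ℕ} (h : i < j) :
    S.φ f * S.x₃ ^ i ∈ S.lowerPart j :=
  Submodule.subset_span ⟨f, i, h, rfl⟩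

theorem lowerPart_mono {i j : ℕ} (h : i ≤ j) : S.lowerPart i ≤ S.lowerPart j :=
  Submodule.span_mono fun _ ⟨f, l, hl, hy⟩ => ⟨f, l, hl.trans_le h, hy⟩

theorem φ_mul_mem_lowerPart (f : MvPolynomial ℕ K) {j : ℕ} {y : B} (hy : y ∈ S.lowerPart j) :
    S.φ f * y ∈ S.lowerPart j := by
  refine Submodule.span_induction ?_ ?_ ?_ ?_ hy
  · rintro _ ⟨g, i, hi, rfl⟩
    rw [← mul_assoc, ← map_mul]
    exact S.mem_lowerPart _ hi
  · rw [mul_zero]; exact zero_mem _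
  · intro u v _ _ hu hv; rw [mul_add]; exact add_mem hu hv
  · intro c u _ hu; rw [mul_smul_comm]; exact Submodule.smul_mem _ _ hu

theorem x₃_mul_mem_lowerPart {j : ℕ} {y : B} (hy : y ∈ S.lowerPart j) :
    S.x₃ * y ∈ S.lowerPart (j + 1) := by
  refine Submodule.span_induction ?_ ?_ ?_ ?_ hy
  · rintro _ ⟨g, i, hi, rfl⟩
    rw [← mul_assoc, x₃_mul_φ, add_mul, mul_assoc, ← pow_succ']
    exact add_mem (S.mem_lowerPart _ (by omega)) (S.mem_lowerPart _ (by omega))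
  · rw [mul_zero]; exact zero_mem _
  · intro u v _ _ hu hv; rw [mul_add]; exact add_mem hu hv
  · intro c u _ hu; rw [mul_smul_comm]; exact Submodule.smul_mem _ _ hu

theorem g1_x₃_pow (j : ℕ) : S.g1 (S.x₃ ^ j) - S.x₃ ^ j ∈ S.lowerPart j := by
  induction j with
  | zero => rw [pow_zero, S.g1_one, sub_self]; exact zero_mem _
  | succ j ih =>
    have e : S.g1 (S.x₃ ^ (j + 1)) - S.x₃ ^ (j + 1) =
        S.x₃ * (S.g1 (S.x₃ ^ j) - S.x₃ ^ j) +
          p • (S.φ (X 0) * (S.g1 (S.x₃ ^ j) - S.x₃ ^ j) + S.φ (X 0) * S.x₃ ^ j) := by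
      rw [pow_succ', S.g1_mul, S.g1_x₃, φ_X_zero, add_mul, mul_sub, mul_sub, smul_mul_assoc,
        sub_add_cancel]
      abel
    rw [e]
    exact add_mem (S.x₃_mul_mem_lowerPart ih) (Submodule.smul_mem _ _ (add_mem
      (S.lowerPart_mono (Nat.le_succ j) (S.φ_mul_mem_lowerPart _ ih))
      (S.mem_lowerPart _ (Nat.lt_succ_self j))))

/-- Since `g1` changes `x_3^j` only by terms of lower degree in `x_3`, `d3` is ordinary
differentiation in `x_3` up to lower terms. -/
theorem d3_x₃_pow_succ (j : ℕ) :
    S.d3 (S.x₃ ^ (j + 1)) - ((j : K) + 1) • S.x₃ ^ j ∈ S.lowerPart j := by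
  induction j with
  | zero => simp [S.d3_x₃]
  | succ j ih =>
    have e : S.d3 (S.x₃ ^ (j + 2)) - (((j + 1 : ℕ) : K) + 1) • S.x₃ ^ (j + 1) =
        S.x₃ * (S.d3 (S.x₃ ^ (j + 1)) - ((j : K) + 1) • S.x₃ ^ j) +
          (S.g1 (S.x₃ ^ (j + 1)) - S.x₃ ^ (j + 1)) := by
      rw [pow_succ' _ (j + 1), S.d3_mul, S.d3_x₃, one_mul, mul_sub, mul_smul_comm, ← pow_succ']
      push_cast
      module
    rw [e]
    exact add_mem (S.x₃_mul_mem_lowerPart ih) (S.g1_x₃_pow _)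

theorem d3_mem_lowerPart {j : ℕ} {y : B} (hy : y ∈ S.lowerPart (j + 1)) :
    S.d3 y ∈ S.lowerPart j := by
  refine Submodule.span_induction ?_ ?_ ?_ ?_ hy
  · rintro _ ⟨g, i, hi, rfl⟩
    rw [S.d3_mul, S.d3_φ, zero_mul, add_zero]
    apply S.φ_mul_mem_lowerPart
    cases i with
    | zero => rw [pow_zero, S.d3_one]; exact zero_mem _
    | succ i =>
      have h1 := S.lowerPart_mono (by omega : i ≤ j) (S.d3_x₃_pow_succ i)
      have h2 : S.x₃ ^ i ∈ S.lowerPart j := by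
        simpa using S.mem_lowerPart 1 (by omega : i < j)
      exact (Submodule.sub_mem_iff_left _ (Submodule.smul_mem _ _ h2)).1 h1
  · rw [map_zero]; exact zero_mem _
  · intro u v _ _ hu hv; rw [map_add]; exact add_mem hu hv
  · intro c u _ hu; rw [map_smul]; exact Submodule.smul_mem _ _ hu

/-- Each application of `d3` lowers the degree in `x_3` and multiplies the leading coefficient by a
positive integer, which is invertible in characteristic zero. -/
theorem φ_eq_zero_of_leading (j : ℕ) (f : MvPolynomial ℕ K) {y : B} (hy : y ∈ S.lowerPart j)
    (h : S.φ f * S.x₃ ^ j + y = 0) : S.φ f = 0 := by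
  induction j generalizing f y with
  | zero =>
    have : S.lowerPart 0 = ⊥ := by simp [lowerPart]
    rw [this, Submodule.mem_bot] at hy
    simpa [hy] using h
  | succ j ih =>
    have h' := congrArg S.d3 h
    rw [map_add, S.d3_mul, S.d3_φ, zero_mul, add_zero, map_zero] at h'
    have := ih (((j : K) + 1) • f)
      (y := S.φ f * (S.d3 (S.x₃ ^ (j + 1)) - ((j : K) + 1) • S.x₃ ^ j) +
      S.d3 y) (add_mem (S.φ_mul_mem_lowerPart _ (S.d3_x₃_pow_succ j)) (S.d3_mem_lowerPart hy)) ?_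
    · rw [map_smul] at this
      exact (smul_eq_zero.1 this).resolve_left (Nat.cast_add_one_ne_zero j)
    · rw [← h', map_smul, mul_sub, mul_smul_comm, smul_mul_assoc]
      abel

theorem φ_eq_zero_of_sum (f : ℕ → MvPolynomial ℕ K) (d : ℕ)
    (h : ∑ j ∈ Finset.range d, S.φ (f j) * S.x₃ ^ j = 0) : ∀ j < d, S.φ (f j) = 0 := by
  induction d with
  | zero => intro j hj; omega
  | succ d ih =>
    rw [Finset.sum_range_succ, add_comm] at h
    have hd := S.φ_eq_zero_of_leading d (f d)
      (Submodule.sum_mem _ fun j hj => S.mem_lowerPart _ (Finset.mem_range.1 hj)) h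
    rw [hd, zero_mul, zero_add] at h
    intro j hj
    rcases Nat.lt_succ_iff_lt_or_eq.1 hj with hj | rfl
    · exact ih h j hj
    · exact hd

/-- The family `x_1, z_0, z_1, …`. -/
def zFamily : ℕ → B
  | 0 => S.x₁
  | n + 1 => S.z n

theorem φ_zSubst_X (i : ℕ) : S.φ (zSubst b p q (X i)) = S.zFamily i := by
  cases i with
  | zero => rw [zSubst_X_zero, φ_X_zero]; rfl
  | succ n => rw [zSubst_X_succ, φ_zPoly]; rfl

/-- The elements `u x_3^j`, with `u` a polynomial in `x_1, z_0, …, z_N`, are independent if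
`ρ_0, …, ρ_N ≠ 0`. -/
theorem eq_zero_of_sum_zSubst {N : ℕ} (hρ : ∀ n ≤ N, rho b p q n ≠ 0)
    (f : ℕ → MvPolynomial ℕ K) (hf : ∀ j, f j ∈ supported K {i | i ≤ N + 1}) (d : ℕ)
    (h : ∑ j ∈ Finset.range d, S.φ (zSubst b p q (f j)) * S.x₃ ^ j = 0) :
    ∀ j < d, f j = 0 := by
  intro j hj
  have h1 := S.φ_eq_zero_of_sum (fun j => zSubst b p q (f j)) d h j hj
  have h2 := S.eq_zero_of_φ_eq_zero hρ (zSubst_mem_supported b p q (hf j)) h1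
  exact zSubst_injective b p q (h2.trans (map_zero _).symm)

end R12Derivations

/-! ### The braid equation for `R_{1,2}`. -/

section Braiding

variable {K : Type*} [Field K]

/-- The braiding as an operator on functions of two indices. -/
def braidOp {ι : Type*} [Fintype ι] (r : ι → ι → Matrix ι ι K) (i j : ι) (F : ι → ι → K) : K :=
  ∑ l, ∑ m, r i j l m * F l m

/-- Delta functions recover the coefficients. With an arbitrary `F` in place of coefficients, the
equation can be checked by symbolic rewriting instead of expanding sums over all indices. -/
theorem isBraiding_of_braidOp {ι : Type*} [Fintype ι] [DecidableEq ι] {r : ι → ι → Matrix ι ι K}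
    (h : ∀ a b j (F : ι → ι → ι → K),
      braidOp r a b (fun i i' => braidOp r i' j fun l n => braidOp r i l fun l' m => F l' m n) =
        braidOp r b j fun l s' => braidOp r a l fun l' s => braidOp r s s' fun m n => F l' m n) :
    IsBraiding r := by
  intro a b j l₀ m₀ n₀
  have e := h a b j fun l m n =>
    (if l = l₀ then 1 else 0) * ((if m = m₀ then 1 else 0) * (if n = n₀ then 1 else 0))
  simp only [braidOp, mul_ite, mul_one, mul_zero, Finset.sum_ite_irrel, Finset.sum_ite_eq',
    Finset.mem_univ, if_true, Finset.sum_const_zero] at e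
  simp only [Finset.mul_sum] at e
  have e2 : ∀ f : ι → ι → ι → K, ∑ l, ∑ s', ∑ s, f l s' s = ∑ s, ∑ s', ∑ l, f l s' s := by
    intro f
    rw [Finset.sum_comm]
    simp_rw [Finset.sum_comm (f := fun l s => f l _ s)]
    rw [Finset.sum_comm]
  refine e.trans ((e2 _).trans ?_)
  refine Finset.sum_congr rfl fun s _ => Finset.sum_congr rfl fun s' _ =>
    Finset.sum_congr rfl fun l _ => ?_
  ring

theorem isBraiding_R12 (a b p q k : K) : IsBraiding (R12 1 a b p q k) := by
  apply isBraiding_of_braidOp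
  have h00 : ∀ F, braidOp (R12 1 a b p q k) 0 0 F = F 0 0 := by
    intro F; simp [braidOp, R12, Fin.sum_univ_three]
  have h01 : ∀ F, braidOp (R12 1 a b p q k) 0 1 F = F 1 0 := by
    intro F; simp [braidOp, R12, Fin.sum_univ_three]
  have h02 : ∀ F, braidOp (R12 1 a b p q k) 0 2 F = p * F 0 0 + F 2 0 := by
    intro F; simp [braidOp, R12, Fin.sum_univ_three]
  have h10 : ∀ F, braidOp (R12 1 a b p q k) 1 0 F = F 0 1 := by
    intro F; simp [braidOp, R12, Fin.sum_univ_three]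
  have h11 : ∀ F, braidOp (R12 1 a b p q k) 1 1 F = F 1 1 := by
    intro F; simp [braidOp, R12, Fin.sum_univ_three]
  have h12 : ∀ F, braidOp (R12 1 a b p q k) 1 2 F = q * F 0 1 + F 2 1 := by
    intro F; simp [braidOp, R12, Fin.sum_univ_three]
  have h20 : ∀ F, braidOp (R12 1 a b p q k) 2 0 F = b * F 0 0 + F 0 2 := by
    intro F; simp [braidOp, R12, Fin.sum_univ_three]
  have h21 : ∀ F, braidOp (R12 1 a b p q k) 2 1 F = (p - q) * F 0 1 + (b * F 1 0 + F 1 2) := by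
    intro F; simp [braidOp, R12, Fin.sum_univ_three]
  have h22 : ∀ F, braidOp (R12 1 a b p q k) 2 2 F =
      a * F 0 0 + k * F 0 1 + p * F 0 2 + -(k * F 1 0) + (b * F 2 0 + F 2 2) := by
    intro F; simp [braidOp, R12, Fin.sum_univ_three]
  intro i j l F
  fin_cases i <;> fin_cases j <;> fin_cases l <;>
    simp only [Fin.zero_eta, Fin.mk_one, Fin.reduceFinMk, h00, h01, h02, h10, h11, h12, h20, h21,
      h22] <;> ring

end Braiding

/-! ### Descent of the derivations to the Nichols algebra. -/

section Descend

variable {K M N P : Type*} [Field K] [AddCommGroup M] [Module K M] [AddCommGroup N] [Module K N]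
  [AddCommGroup P] [Module K P]

/-- The factorization of a linear map through a surjection. -/
def descend (π : M →ₗ[K] N) (hπ : Function.Surjective π) (f : M →ₗ[K] P)
    (h : ∀ y, π y = 0 → f y = 0) : N →ₗ[K] P :=
  (LinearMap.ker π).liftQ f (fun y hy => h y hy) ∘ₗ
    (π.quotKerEquivOfSurjective hπ).symm.toLinearMap

theorem descend_apply (π : M →ₗ[K] N) (hπ : Function.Surjective π) (f : M →ₗ[K] P)
    (h : ∀ y, π y = 0 → f y = 0) (y : M) : descend π hπ f h (π y) = f y := by
  have : (π.quotKerEquivOfSurjective hπ).symm (π y) = (LinearMap.ker π).mkQ y := by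
    rw [LinearEquiv.symm_apply_eq]; rfl
  rw [descend, LinearMap.comp_apply, LinearEquiv.coe_coe, this]
  rfl

end Descend

section Proj

variable {K : Type*} [Field K] {ι : Type*} [Fintype ι] [DecidableEq ι]
  {r : ι → ι → Matrix ι ι K}

theorem proj_surjective : Function.Surjective (proj r) := RingCon.mkₐ_surjective _

theorem proj_eq_zero_iff {y : FreeAlgebra K ι} : proj r y = 0 ↔ y ∈ nicholsIdeal r := by
  rw [TwoSidedIdeal.mem_iff, ← RingCon.eq]
  rfl

variable {P : Type*} [AddCommGroup P] [Module K P]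

/-- The linear map on the Nichols algebra induced by a linear map on `T(V)`. -/
def IsBraiding.induced (h : IsBraiding r) (f : FreeAlgebra K ι →ₗ[K] P)
    (hf : ∀ y ∈ radicalSubmodule r, f y = 0) : NicholsAlgebra r →ₗ[K] P :=
  descend (proj r).toLinearMap proj_surjective f fun y hy =>
    hf y (by rwa [AlgHom.toLinearMap_apply, proj_eq_zero_iff, h.nicholsIdeal_eq,
      h.mem_radical] at hy)

theorem IsBraiding.induced_proj (h : IsBraiding r) (f : FreeAlgebra K ι →ₗ[K] P)
    (hf : ∀ y ∈ radicalSubmodule r, f y = 0) (y : FreeAlgebra K ι) :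
    h.induced f hf (proj r y) = f y :=
  descend_apply _ _ _ _ y

theorem IsBraiding.proj_eq_zero_iff (h : IsBraiding r) {y : FreeAlgebra K ι} :
    proj r y = 0 ↔ y ∈ radicalSubmodule r := by
  rw [Nichols.proj_eq_zero_iff, h.nicholsIdeal_eq, h.mem_radical]

/-- The skew derivation induced on the Nichols algebra. -/
def IsBraiding.inducedDer (h : IsBraiding r) (m : ι) : NicholsAlgebra r →ₗ[K] NicholsAlgebra r :=
  h.induced ((proj r).toLinearMap ∘ₗ skewDer r m) fun _ hy =>
    h.proj_eq_zero_iff.2 ((mem_radicalSubmodule_iff.1 hy).2 m)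

/-- The entries of the braiding with the generators, induced on the Nichols algebra. -/
def IsBraiding.inducedBraid (h : IsBraiding r) (i m : ι) :
    NicholsAlgebra r →ₗ[K] NicholsAlgebra r :=
  h.induced ((proj r).toLinearMap ∘ₗ
    (Matrix.entryLinearMap K (FreeAlgebra K ι) i m ∘ₗ (braidGen r).toLinearMap)) fun _ hy =>
    h.proj_eq_zero_iff.2 (h.braidGen_mem_radical hy i m)

/-- The counit of the Nichols algebra. -/
def IsBraiding.inducedCounit (h : IsBraiding r) : NicholsAlgebra r →ₗ[K] K :=
  h.induced counit.toLinearMap fun _ hy => (mem_radicalSubmodule_iff.1 hy).1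

theorem IsBraiding.inducedDer_proj (h : IsBraiding r) (m : ι) (y : FreeAlgebra K ι) :
    h.inducedDer m (proj r y) = proj r (skewDer r m y) :=
  h.induced_proj _ _ y

theorem IsBraiding.inducedBraid_proj (h : IsBraiding r) (i m : ι) (y : FreeAlgebra K ι) :
    h.inducedBraid i m (proj r y) = proj r (braidGen r y i m) :=
  h.induced_proj _ _ y

theorem IsBraiding.inducedCounit_proj (h : IsBraiding r) (y : FreeAlgebra K ι) :
    h.inducedCounit (proj r y) = counit y :=
  h.induced_proj _ _ y

end Proj

section R12

variable {K : Type*} [Field K] (a b p q k : K)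

/-- This shape is closed under matrix multiplication, so it is enough that the matrices of the
generators have it. It reduces the general Leibniz rules to those of `R12Derivations`. -/
theorem braidGen_R12_zero (y : FreeAlgebra K (Fin 3)) :
    braidGen (R12 1 a b p q k) y 0 1 = 0 ∧ braidGen (R12 1 a b p q k) y 0 2 = 0 ∧
      braidGen (R12 1 a b p q k) y 1 0 = 0 ∧ braidGen (R12 1 a b p q k) y 1 2 = 0 ∧
      braidGen (R12 1 a b p q k) y 2 2 = braidGen (R12 1 a b p q k) y 0 0 := by
  induction y using freeAlgebra_induction_left with
  | one => simp [braidGen_one_apply]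
  | mul j y ih =>
    obtain ⟨h1, h2, h3, h4, h5⟩ := ih
    simp only [braidGen_mul_apply, Fin.sum_univ_three, h1, h2, h3, h4, h5, mul_zero, add_zero,
      zero_add]
    fin_cases j <;> simp [braidGen_ι, Fin.sum_univ_three, R12, add_comm]
  | add y z hy hz => simp [hy, hz]
  | smul c y hy => simp [hy]

/-- The skew derivations and braidings on the Nichols algebra of type `R_{1,2}`. -/
def r12Derivations : R12Derivations a b p q k (NicholsAlgebra (R12 1 a b p q k)) :=
  let h := isBraiding_R12 a b p q k
  { x₁ := proj _ (x K 0)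
    x₂ := proj _ (x K 1)
    x₃ := proj _ (x K 2)
    ε := h.inducedCounit
    d1 := h.inducedDer 0
    d2 := h.inducedDer 1
    d3 := h.inducedDer 2
    g1 := h.inducedBraid 0 0
    g2 := h.inducedBraid 1 1
    g31 := h.inducedBraid 2 0
    g32 := h.inducedBraid 2 1
    ε_one := by rw [← map_one (proj _), h.inducedCounit_proj, map_one]
    ε_mul := by
      intro u v
      obtain ⟨u, rfl⟩ := proj_surjective u
      obtain ⟨v, rfl⟩ := proj_surjective v
      simp only [← map_mul, h.inducedCounit_proj]
    ε_x₁ := by rw [h.inducedCounit_proj, counit_ι]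
    ε_x₂ := by rw [h.inducedCounit_proj, counit_ι]
    ε_x₃ := by rw [h.inducedCounit_proj, counit_ι]
    d1_one := by rw [← map_one (proj _), h.inducedDer_proj, skewDer_one, map_zero]
    d2_one := by rw [← map_one (proj _), h.inducedDer_proj, skewDer_one, map_zero]
    d3_one := by rw [← map_one (proj _), h.inducedDer_proj, skewDer_one, map_zero]
    d1_mul := by
      intro u v
      obtain ⟨u, rfl⟩ := proj_surjective u
      obtain ⟨v, rfl⟩ := proj_surjective v
      obtain ⟨h1, h2, h3, h4, h5⟩ := braidGen_R12_zero a b p q k v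
      simp only [← map_mul, ← map_add, h.inducedDer_proj, h.inducedBraid_proj, skewDer_mul,
        Fin.sum_univ_three, h3, mul_zero, add_zero, add_assoc]
    d2_mul := by
      intro u v
      obtain ⟨u, rfl⟩ := proj_surjective u
      obtain ⟨v, rfl⟩ := proj_surjective v
      obtain ⟨h1, h2, h3, h4, h5⟩ := braidGen_R12_zero a b p q k v
      simp only [← map_mul, ← map_add, h.inducedDer_proj, h.inducedBraid_proj, skewDer_mul,
        Fin.sum_univ_three, h1, mul_zero, zero_add, add_assoc]
    d3_mul := by
      intro u v
      obtain ⟨u, rfl⟩ := proj_surjective u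
      obtain ⟨v, rfl⟩ := proj_surjective v
      obtain ⟨h1, h2, h3, h4, h5⟩ := braidGen_R12_zero a b p q k v
      simp only [← map_mul, ← map_add, h.inducedDer_proj, h.inducedBraid_proj, skewDer_mul,
        Fin.sum_univ_three, h2, h4, h5, mul_zero, zero_add]
    d1_x₁ := by rw [h.inducedDer_proj, skewDer_ι]; simp
    d1_x₂ := by rw [h.inducedDer_proj, skewDer_ι]; simp
    d1_x₃ := by rw [h.inducedDer_proj, skewDer_ι]; simp
    d2_x₁ := by rw [h.inducedDer_proj, skewDer_ι]; simp
    d2_x₂ := by rw [h.inducedDer_proj, skewDer_ι]; simp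
    d2_x₃ := by rw [h.inducedDer_proj, skewDer_ι]; simp
    d3_x₁ := by rw [h.inducedDer_proj, skewDer_ι]; simp
    d3_x₂ := by rw [h.inducedDer_proj, skewDer_ι]; simp
    d3_x₃ := by rw [h.inducedDer_proj, skewDer_ι]; simp
    g1_one := by rw [← map_one (proj _), h.inducedBraid_proj, braidGen_one_apply]; simp
    g1_mul := by
      intro u v
      obtain ⟨u, rfl⟩ := proj_surjective u
      obtain ⟨v, rfl⟩ := proj_surjective v
      obtain ⟨h1, h2, h3, h4, h5⟩ := braidGen_R12_zero a b p q k u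
      simp only [← map_mul, h.inducedBraid_proj, braidGen_mul_apply,
        Fin.sum_univ_three, h1, h2, zero_mul, add_zero]
    g2_mul := by
      intro u v
      obtain ⟨u, rfl⟩ := proj_surjective u
      obtain ⟨v, rfl⟩ := proj_surjective v
      obtain ⟨h1, h2, h3, h4, h5⟩ := braidGen_R12_zero a b p q k u
      simp only [← map_mul, h.inducedBraid_proj, braidGen_mul_apply,
        Fin.sum_univ_three, h3, h4, zero_mul, add_zero, zero_add]
    g31_mul := by
      intro u v
      obtain ⟨u, rfl⟩ := proj_surjective u
      obtain ⟨v, rfl⟩ := proj_surjective v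
      obtain ⟨-, -, -, -, h5⟩ := braidGen_R12_zero a b p q k u
      obtain ⟨h1, h2, h3, h4, -⟩ := braidGen_R12_zero a b p q k v
      simp only [← map_mul, ← map_add, h.inducedBraid_proj, braidGen_mul_apply,
        Fin.sum_univ_three, h3, h5, mul_zero, add_zero]
      rw [add_comm]
    g32_mul := by
      intro u v
      obtain ⟨u, rfl⟩ := proj_surjective u
      obtain ⟨v, rfl⟩ := proj_surjective v
      obtain ⟨-, -, -, -, h5⟩ := braidGen_R12_zero a b p q k u
      obtain ⟨h1, h2, h3, h4, -⟩ := braidGen_R12_zero a b p q k v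
      simp only [← map_mul, ← map_add, h.inducedBraid_proj, braidGen_mul_apply,
        Fin.sum_univ_three, h1, h5, mul_zero, zero_add]
      rw [add_comm]
    g1_x₁ := by
      rw [h.inducedBraid_proj, braidGen_ι]; simp [Fin.sum_univ_three, R12]
    g1_x₂ := by
      rw [h.inducedBraid_proj, braidGen_ι]; simp [Fin.sum_univ_three, R12]
    g1_x₃ := by
      rw [h.inducedBraid_proj, braidGen_ι]; simp [Fin.sum_univ_three, R12, add_comm]
    g2_x₁ := by
      rw [h.inducedBraid_proj, braidGen_ι]; simp [Fin.sum_univ_three, R12]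
    g2_x₂ := by
      rw [h.inducedBraid_proj, braidGen_ι]; simp [Fin.sum_univ_three, R12]
    g2_x₃ := by
      rw [h.inducedBraid_proj, braidGen_ι]; simp [Fin.sum_univ_three, R12, add_comm]
    g31_x₁ := by
      rw [h.inducedBraid_proj, braidGen_ι]; simp [Fin.sum_univ_three, R12]
    g31_x₂ := by
      rw [h.inducedBraid_proj, braidGen_ι]; simp [Fin.sum_univ_three, R12]
    g31_x₃ := by
      simp only [h.inducedBraid_proj, braidGen_ι, ← map_smul, ← map_add, ← map_sub]
      congr 1
      simp [Fin.sum_univ_three, R12]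
      abel
    g32_x₁ := by
      rw [h.inducedBraid_proj, braidGen_ι]; simp [Fin.sum_univ_three, R12]
    g32_x₂ := by
      rw [h.inducedBraid_proj, braidGen_ι]; simp [Fin.sum_univ_three, R12]
    g32_x₃ := by
      rw [h.inducedBraid_proj, braidGen_ι]; simp [Fin.sum_univ_three, R12]
    eq_zero := by
      intro u h0 h1 h2 h3
      obtain ⟨u, rfl⟩ := proj_surjective u
      rw [h.inducedCounit_proj] at h0
      rw [h.inducedDer_proj, h.proj_eq_zero_iff] at h1 h2 h3
      rw [h.proj_eq_zero_iff, mem_radicalSubmodule_iff]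
      exact ⟨h0, fun m => by fin_cases m <;> assumption⟩ }

theorem r12Derivations_z (n : ℕ) :
    (r12Derivations a b p q k).z n = proj (R12 1 a b p q k) (z b p q n) := by
  induction n with
  | zero => rfl
  | succ n ih =>
    rw [R12Derivations.z, ih, z]
    simp only [map_add, map_sub, map_mul, map_smul, map_pow]
    rfl

end R12

/-! ### Consequences of the relations (1) and (2) in any algebra. -/

section Commutation

variable {K : Type*} [Field K] {A : Type*} [Ring A] [Algebra K A] {b p q : K}
  {π : FreeAlgebra K (Fin 3) →ₐ[K] A}

theorem map_z_succ (π : FreeAlgebra K (Fin 3) →ₐ[K] A) (b p q : K) (n : ℕ) :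
    π (z b p q (n + 1)) =
      π (x K 2) * π (z b p q n) - π (z b p q n) * π (x K 2) -
        (((n : K) + 1) * b) • (π (x K 0) * π (z b p q n)) +
        ((n.factorial : K) * (q - p) * ((-b - p) / 2) ^ n) •
          (π (x K 0) ^ (n + 1) * π (z b p q 0)) := by
  rw [z.eq_2]
  simp only [map_add, map_sub, map_mul, map_smul, map_pow, sub_mul, smul_mul_assoc]
  rw [sub_right_comm]
  rfl

theorem commute_x_z (h : ∀ u ∈ quadraticRels b p, π u = 0) (n : ℕ) :
    Commute (π (x K 0)) (π (z b p q n)) := by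
  have h1 : π (x K 1) * π (x K 0) = π (x K 0) * π (x K 1) := by
    have := h _ (Set.mem_insert _ _)
    rwa [map_sub, map_mul, map_mul, sub_eq_zero] at this
  have h2 : π (x K 2) * π (x K 0) = π (x K 0) * π (x K 2) - ((p - b) / 2) • π (x K 0) ^ 2 := by
    have := h _ (Set.mem_insert_of_mem _ rfl)
    rw [map_add, map_sub, map_mul, map_mul, map_smul, map_pow] at this
    rw [← sub_eq_zero, ← this]; abel
  have hY : Commute (π (x K 0)) (π (z b p q 0)) := h1.symm
  induction n with
  | zero => exact hY
  | succ n ih =>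
    have e1 : Commute (π (x K 0))
        (π (x K 2) * π (z b p q n) - π (z b p q n) * π (x K 2)) := by
      have e2 : π (x K 0) * π (x K 2) =
          π (x K 2) * π (x K 0) + ((p - b) / 2) • π (x K 0) ^ 2 := by rw [h2]; abel
      have e3 := (ih.pow_left 2).eq
      rw [Commute, SemiconjBy, mul_sub, sub_mul, ← mul_assoc, e2, add_mul, mul_assoc, ih.eq,
        smul_mul_assoc, e3, ← mul_assoc (π (x K 0)), ih.eq, mul_assoc _ (π (x K 0)) (π (x K 2)), e2,
        mul_add,
        mul_smul_comm, mul_assoc, mul_assoc]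
      abel
    rw [map_z_succ]
    exact (e1.sub_right (((Commute.refl _).mul_right ih).smul_right _)).add_right
      ((((Commute.refl _).pow_right _).mul_right hY).smul_right _)

/-- Induction on `i + j`. If `z_i` and `z_j` commute, the Jacobi identity with `x_3` gives
`[z_{i+1}, z_j] = -[z_i, z_{j+1}]`. Thus every commutator can be moved along its antidiagonal to one
with `i = j`, which is trivial, or with neighbouring indices, which is a relation (2). -/
theorem commute_z_z (h : ∀ u ∈ quadraticRels b p, π u = 0) (hz : ∀ u ∈ zRels b p q, π u = 0)
    (i j : ℕ) : Commute (π (z b p q i)) (π (z b p q j)) := by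
  suffices ∀ s i j, i + j ≤ s → Commute (π (z b p q i)) (π (z b p q j)) from
    this _ i j le_rfl
  intro s
  induction s with
  | zero =>
    intro i j hij
    obtain ⟨rfl, rfl⟩ : i = 0 ∧ j = 0 := by omega
    exact Commute.refl _
  | succ s ih =>
    have shift : ∀ i j, i + j = s →
        π (z b p q (i + 1)) * π (z b p q j) - π (z b p q j) * π (z b p q (i + 1)) =
          -(π (z b p q i) * π (z b p q (j + 1)) - π (z b p q (j + 1)) * π (z b p q i)) := by
      intro i j hij
      -- The correction terms of `z_{i+1}` commute with `z_j`: `x_1` does, and `x_2 = z_0` does by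
      -- induction since `j ≤ s`.
      have low : ∀ i j, i + j = s → π (z b p q (i + 1)) * π (z b p q j) -
          π (z b p q j) * π (z b p q (i + 1)) =
          (π (x K 2) * π (z b p q i) - π (z b p q i) * π (x K 2)) * π (z b p q j) -
          π (z b p q j) * (π (x K 2) * π (z b p q i) - π (z b p q i) * π (x K 2)) := by
        intro i j hij
        have hc := commute_x_z (q := q) h j
        have c1 := ((hc.mul_left (ih i j hij.le)).smul_left (((i : K) + 1) * b)).eq
        have c2 := (((hc.pow_left (i + 1)).mul_left (ih 0 j (by omega))).smul_left
          ((i.factorial : K) * (q - p) * ((-b - p) / 2) ^ i)).eq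
        rw [map_z_succ, add_mul, sub_mul _ (_ • _), mul_add, mul_sub (π (z b p q j)) _ (_ • _),
          c1, c2]
        abel
      have e := (ih i j hij.le).eq
      have low' := low j i (by omega)
      rw [low i j hij, neg_sub, low']
      have : ∀ t u v : A, u * v = v * u →
          (t * u - u * t) * v - v * (t * u - u * t) =
            (t * v - v * t) * u - u * (t * v - v * t) := by
        intro t u v huv
        have e1 : t * u * v = t * v * u := by rw [mul_assoc, huv, mul_assoc]
        have e2 : v * u * t = u * v * t := by rw [huv]
        have e3 : u * t * v + v * t * u = v * t * u + u * t * v := add_comm _ _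
        simp only [sub_mul, mul_sub, ← mul_assoc, e1, e2]
        abel
      exact this _ _ _ e
    have diag : ∀ e j, j + e + j = s + 1 → Commute (π (z b p q (j + e))) (π (z b p q j)) := by
      intro e
      induction e using Nat.twoStepInduction with
      | zero => intro j _; exact Commute.refl _
      | one =>
        intro j _
        have := hz _ ⟨j, rfl⟩
        rwa [map_sub, map_mul, map_mul, sub_eq_zero] at this
      | more e ih1 _ =>
        intro j hj
        have h1 := shift (j + e + 1) j (by omega)
        have h2 := ih1 (j + 1) (by omega)
        rw [show j + 1 + e = j + e + 1 by omega] at h2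
        rw [h2.eq, sub_self, neg_zero, sub_eq_zero] at h1
        exact h1
    intro i j hij
    rcases Nat.lt_or_ge (i + j) (s + 1) with hlt | hge
    · exact ih i j (by omega)
    · rcases le_total j i with hle | hle
      · obtain ⟨e, rfl⟩ := Nat.exists_eq_add_of_le hle
        exact diag e j (by omega)
      · obtain ⟨e, rfl⟩ := Nat.exists_eq_add_of_le hle
        exact (diag e i (by omega)).symm

end Commutation

/-! ### Normal ordering with respect to `x_3`, with degree control. -/

section Spanning

variable {K : Type*} [Field K] {A : Type*} [Ring A] [Algebra K A] {σ : Type*}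

/-- The exponents of the monomials in the variables from `s`. -/
def exponents (s : Set σ) : AddSubmonoid (σ →₀ ℕ) :=
  AddSubmonoid.closure {m | ∃ i ∈ s, m = Finsupp.single i 1}

/-- The span of the values of the monomials of weight `d` in the variables from `s`. -/
def weightPart (φ : MvPolynomial σ K →ₐ[K] A) (w : σ → ℕ) (s : Set σ) (d : ℕ) : Submodule K A :=
  Submodule.span K {u | ∃ m ∈ exponents s, Finsupp.weight w m = d ∧
    u = φ (MvPolynomial.monomial m 1)}

/-- The span of the elements `u t^j`, with `u` the value of a monomial of weight at most `n - j` in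
the variables from `s`. -/
def filtration (φ : MvPolynomial σ K →ₐ[K] A) (w : σ → ℕ) (s : Set σ) (t : A) (n : ℕ) :
    Submodule K A :=
  Submodule.span K {u | ∃ m ∈ exponents s, ∃ j, Finsupp.weight w m + j ≤ n ∧
    u = φ (MvPolynomial.monomial m 1) * t ^ j}

variable {φ : MvPolynomial σ K →ₐ[K] A} {w : σ → ℕ} {s : Set σ} {t : A}

theorem mul_mem_weightPart {d e : ℕ} {u v : A} (hu : u ∈ weightPart φ w s d)
    (hv : v ∈ weightPart φ w s e) : u * v ∈ weightPart φ w s (d + e) := by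
  have : weightPart φ w s d * weightPart φ w s e ≤ weightPart φ w s (d + e) := by
    rw [weightPart, weightPart, Submodule.span_mul_span, Submodule.span_le]
    rintro _ ⟨_, ⟨m, hm, rfl, rfl⟩, _, ⟨m', hm', rfl, rfl⟩, rfl⟩
    refine Submodule.subset_span ⟨m + m', add_mem hm hm', map_add _ _ _, ?_⟩
    simp only [← map_mul, MvPolynomial.monomial_mul, one_mul]
  exact this (Submodule.mul_mem_mul hu hv)

theorem X_mem_weightPart {i : σ} (hi : i ∈ s) : φ (MvPolynomial.X i) ∈ weightPart φ w s (w i) :=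
  Submodule.subset_span ⟨Finsupp.single i 1, AddSubmonoid.subset_closure ⟨i, hi, rfl⟩,
    by simp [Finsupp.weight_single], rfl⟩

theorem one_mem_weightPart : (1 : A) ∈ weightPart φ w s 0 :=
  Submodule.subset_span ⟨0, zero_mem _, by simp, by simp⟩

theorem pow_mem_weightPart {d : ℕ} {u : A} (hu : u ∈ weightPart φ w s d) (n : ℕ) :
    u ^ n ∈ weightPart φ w s (n * d) := by
  induction n with
  | zero => rw [pow_zero, zero_mul]; exact one_mem_weightPart
  | succ n ih => rw [pow_succ, add_mul, one_mul]; exact mul_mem_weightPart ih hu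

theorem filtration_mono {m n : ℕ} (h : m ≤ n) : filtration φ w s t m ≤ filtration φ w s t n :=
  Submodule.span_mono fun _ ⟨e, he, j, hj, hu⟩ => ⟨e, he, j, hj.trans h, hu⟩

theorem weightPart_mul_mem_filtration {d n : ℕ} {u v : A} (hu : u ∈ weightPart φ w s d)
    (hv : v ∈ filtration φ w s t n) : u * v ∈ filtration φ w s t (d + n) := by
  have : weightPart φ w s d * filtration φ w s t n ≤ filtration φ w s t (d + n) := by
    rw [weightPart, filtration, Submodule.span_mul_span, Submodule.span_le]
    rintro _ ⟨_, ⟨m, hm, rfl, rfl⟩, _, ⟨m', hm', j, hj, rfl⟩, rfl⟩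
    refine Submodule.subset_span ⟨m + m', add_mem hm hm', j, by rw [map_add]; omega, ?_⟩
    simp only [← mul_assoc, ← map_mul, MvPolynomial.monomial_mul, one_mul]
  exact this (Submodule.mul_mem_mul hu hv)

/-- The commutator with `t` is a derivation, so raising the weight by one on the variables implies
the same on monomials. -/
theorem commutator_mem_weightPart
    (h : ∀ i ∈ s, t * φ (MvPolynomial.X i) - φ (MvPolynomial.X i) * t ∈ weightPart φ w s (w i + 1))
    {m : σ →₀ ℕ} (hm : m ∈ exponents s) :
    t * φ (MvPolynomial.monomial m 1) - φ (MvPolynomial.monomial m 1) * t ∈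
      weightPart φ w s (Finsupp.weight w m + 1) := by
  induction hm using AddSubmonoid.closure_induction with
  | mem m hm =>
    obtain ⟨i, hi, rfl⟩ := hm
    rw [Finsupp.weight_single, smul_eq_mul, one_mul]
    exact h i hi
  | zero => simp
  | add m m' hm hm' ih ih' =>
    have e : (MvPolynomial.monomial (m + m') 1 : MvPolynomial σ K) =
        MvPolynomial.monomial m 1 * MvPolynomial.monomial m' 1 := by
      rw [MvPolynomial.monomial_mul, one_mul]
    have h1 : φ (MvPolynomial.monomial m 1) ∈ weightPart φ w s (Finsupp.weight w m) :=
      Submodule.subset_span ⟨m, hm, rfl, rfl⟩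
    have h2 : φ (MvPolynomial.monomial m' 1) ∈ weightPart φ w s (Finsupp.weight w m') :=
      Submodule.subset_span ⟨m', hm', rfl, rfl⟩
    rw [e, map_mul, map_add]
    have h3 := mul_mem_weightPart ih h2
    have h4 := mul_mem_weightPart h1 ih'
    rw [add_right_comm] at h3
    rw [← add_assoc] at h4
    convert add_mem h3 h4 using 1
    noncomm_ring

theorem mul_mem_filtration
    (h : ∀ i ∈ s, t * φ (MvPolynomial.X i) - φ (MvPolynomial.X i) * t ∈ weightPart φ w s (w i + 1))
    {n : ℕ} {u : A} (hu : u ∈ filtration φ w s t n) : t * u ∈ filtration φ w s t (n + 1) := by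
  refine Submodule.span_induction ?_ ?_ ?_ ?_ hu
  · rintro _ ⟨m, hm, j, hj, rfl⟩
    have e : t * (φ (MvPolynomial.monomial m 1) * t ^ j) =
        φ (MvPolynomial.monomial m 1) * t ^ (j + 1) +
          (t * φ (MvPolynomial.monomial m 1) - φ (MvPolynomial.monomial m 1) * t) * t ^ j := by
      rw [pow_succ']; noncomm_ring
    rw [e]
    refine add_mem (Submodule.subset_span ⟨m, hm, j + 1, by omega, rfl⟩) ?_
    have ht : t ^ j ∈ filtration φ w s t j :=
      Submodule.subset_span ⟨0, zero_mem _, j, by simp, by simp⟩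
    exact filtration_mono (by omega)
      (weightPart_mul_mem_filtration (commutator_mem_weightPart h hm) ht)
  · rw [mul_zero]; exact zero_mem _
  · intro u v _ _ hu hv; rw [mul_add]; exact add_mem hu hv
  · intro c u _ hu; rw [mul_smul_comm]; exact Submodule.smul_mem _ _ hu

theorem one_mem_filtration : (1 : A) ∈ filtration φ w s t 0 :=
  Submodule.subset_span ⟨0, zero_mem _, 0, by simp, by simp⟩

end Spanning

/-! ### The family `x_1, z_0, z_1, …` and the PBW monomials. -/

section Family

variable {K : Type*} [Field K] {A : Type*} [Ring A] [Algebra K A] {b p q : K}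
  {π : FreeAlgebra K (Fin 3) →ₐ[K] A}

/-- The family `x_1, z_0, z_1, …`. -/
def zFamily (b p q : K) : ℕ → FreeAlgebra K (Fin 3)
  | 0 => x K 0
  | n + 1 => z b p q n

/-- The degrees of `x_1, z_0, z_1, …`. -/
def zWeight : ℕ → ℕ
  | 0 => 1
  | n + 1 => n + 1

theorem zWeight_pos (i : ℕ) : 1 ≤ zWeight i := by
  cases i <;> simp [zWeight]

theorem commute_zFamily (h : ∀ u ∈ quadraticRels b p, π u = 0) (hz : ∀ u ∈ zRels b p q, π u = 0)
    (i j : ℕ) : Commute (π (zFamily b p q i)) (π (zFamily b p q j)) := by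
  cases i <;> cases j
  · exact Commute.refl _
  · exact commute_x_z h _
  · exact (commute_x_z h _).symm
  · exact commute_z_z h hz _ _

/-- The exponent of the monomial `x_1^{a₁} x_2^{a₂} z_1^{e_1} ⋯ z_n^{e_n}`. -/
def exponent {n : ℕ} (a₁ a₂ : ℕ) (e : Fin n → ℕ) : ℕ →₀ ℕ :=
  Finsupp.single 0 a₁ + Finsupp.single 1 a₂ + ∑ j : Fin n, Finsupp.single ((j : ℕ) + 2) (e j)

theorem exponent_zero {n : ℕ} (a₁ a₂ : ℕ) (e : Fin n → ℕ) : exponent a₁ a₂ e 0 = a₁ := by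
  simp [exponent]

theorem exponent_one {n : ℕ} (a₁ a₂ : ℕ) (e : Fin n → ℕ) : exponent a₁ a₂ e 1 = a₂ := by
  simp [exponent]

theorem exponent_add_two {n : ℕ} (a₁ a₂ : ℕ) (e : Fin n → ℕ) (j : Fin n) :
    exponent a₁ a₂ e ((j : ℕ) + 2) = e j := by
  simp [exponent, Finsupp.single_apply, Fin.val_inj]

theorem exponent_of_le {n : ℕ} (a₁ a₂ : ℕ) (e : Fin n → ℕ) {j : ℕ} (hj : n ≤ j) :
    exponent a₁ a₂ e (j + 2) = 0 := by
  have : ∀ i : Fin n, (i : ℕ) ≠ j := fun i => by have := i.2; omega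
  simp [exponent, this]

theorem map_monomial (φ : MvPolynomial ℕ K →ₐ[K] A)
    (hφ : ∀ i, φ (MvPolynomial.X i) = π (zFamily b p q i)) {n : ℕ} (a₁ a₂ : ℕ) (e : Fin n → ℕ)
    (a₃ : ℕ) :
    π (monomial b p q a₁ a₂ e a₃) =
      φ (MvPolynomial.monomial (exponent a₁ a₂ e) 1) * π (x K 2) ^ a₃ := by
  have e1 : (MvPolynomial.monomial (exponent a₁ a₂ e) 1 : MvPolynomial ℕ K) =
      MvPolynomial.X 0 ^ a₁ * MvPolynomial.X 1 ^ a₂ *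
        (List.ofFn fun j : Fin n =>
          (MvPolynomial.X ((j : ℕ) + 2) : MvPolynomial ℕ K) ^ e j).prod := by
    rw [List.prod_ofFn]
    simp only [MvPolynomial.X_pow_eq_monomial]
    rw [← MvPolynomial.monomial_sum_one, MvPolynomial.monomial_mul, MvPolynomial.monomial_mul,
      one_mul, one_mul]
    rfl
  rw [e1, monomial]
  simp only [map_mul, map_pow, map_list_prod, List.map_ofFn, Function.comp_def, hφ]
  rfl

theorem mem_of_mem_exponents {σ : Type*} {s : Set σ} {m : σ →₀ ℕ} (hm : m ∈ exponents s) {i : σ}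
    (hi : m i ≠ 0) : i ∈ s := by
  induction hm using AddSubmonoid.closure_induction with
  | mem m hm =>
    obtain ⟨j, hj, rfl⟩ := hm
    rcases eq_or_ne j i with rfl | hne
    · exact hj
    · exact absurd (Finsupp.single_eq_of_ne hne.symm) hi
  | zero => exact absurd rfl hi
  | add m m' _ _ ih ih' =>
    by_cases h : m i = 0
    · exact ih' (by simpa [h] using hi)
    · exact ih h

variable (φ : MvPolynomial ℕ K →ₐ[K] A) (s : Set ℕ)

/-- The definition of `z_{n+1}` expresses `[x_3, z_n]` by `z_{n+1}` and polynomials in `x_1, x_2,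
z_n` of the same weight. The hypothesis `hs` covers both cases of the theorem: `z_{n+1}` is either
an allowed variable or rewritten by the truncating relation. -/
theorem commutator_zFamily_mem
    (hφ : ∀ i, φ (MvPolynomial.X i) = π (zFamily b p q i))
    (h : ∀ u ∈ quadraticRels b p, π u = 0) (h0 : 0 ∈ s) (h1 : 1 ∈ s)
    (hs : ∀ n, n + 1 ∈ s → π (z b p q (n + 1)) ∈ weightPart φ zWeight s (n + 2)) (i : ℕ)
    (hi : i ∈ s) :
    π (x K 2) * φ (MvPolynomial.X i) - φ (MvPolynomial.X i) * π (x K 2) ∈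
      weightPart φ zWeight s (zWeight i + 1) := by
  have hmem : ∀ i ∈ s, π (zFamily b p q i) ∈ weightPart φ zWeight s (zWeight i) := by
    intro i hi; rw [← hφ]; exact X_mem_weightPart hi
  rw [hφ]
  cases i with
  | zero =>
    have h2 := h _ (Set.mem_insert_of_mem _ rfl)
    rw [map_add, map_sub, map_mul, map_mul, map_smul, map_pow] at h2
    have e : π (x K 2) * π (x K 0) - π (x K 0) * π (x K 2) = (-((p - b) / 2)) • π (x K 0) ^ 2 := by
      rw [neg_smul, eq_neg_iff_add_eq_zero, h2]
    change π (x K 2) * π (x K 0) - π (x K 0) * π (x K 2) ∈ weightPart φ zWeight s (2 * 1)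
    rw [e]
    exact Submodule.smul_mem _ _ (pow_mem_weightPart (hmem 0 h0) 2)
  | succ n =>
    change π (x K 2) * π (z b p q n) - π (z b p q n) * π (x K 2) ∈ weightPart φ zWeight s (n + 2)
    have e : π (x K 2) * π (z b p q n) - π (z b p q n) * π (x K 2) =
        π (z b p q (n + 1)) + (((n : K) + 1) * b) • (π (x K 0) * π (z b p q n)) -
        ((n.factorial : K) * (q - p) * ((-b - p) / 2) ^ n) •
          (π (x K 0) ^ (n + 1) * π (z b p q 0)) := by
      rw [map_z_succ]; abel
    rw [e]
    refine sub_mem (add_mem (hs n hi) (Submodule.smul_mem _ _ ?_)) (Submodule.smul_mem _ _ ?_)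
    · have := mul_mem_weightPart (hmem 0 h0) (hmem (n + 1) hi)
      rwa [show zWeight 0 + zWeight (n + 1) = n + 2 by simp only [zWeight]; omega] at this
    · have := mul_mem_weightPart (pow_mem_weightPart (hmem 0 h0) (n + 1)) (hmem 1 h1)
      rwa [show (n + 1) * zWeight 0 + zWeight 1 = n + 2 by simp only [zWeight]; omega] at this

theorem gen_mul_mem_filtration
    (hφ : ∀ i, φ (MvPolynomial.X i) = π (zFamily b p q i))
    (h : ∀ u ∈ quadraticRels b p, π u = 0) (h0 : 0 ∈ s) (h1 : 1 ∈ s)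
    (hs : ∀ n, n + 1 ∈ s → π (z b p q (n + 1)) ∈ weightPart φ zWeight s (n + 2)) (i : Fin 3)
    {n : ℕ} {u : A} (hu : u ∈ filtration φ zWeight s (π (x K 2)) n) :
    π (x K i) * u ∈ filtration φ zWeight s (π (x K 2)) (n + 1) := by
  have hmem : ∀ i ∈ s, π (zFamily b p q i) ∈ weightPart φ zWeight s (zWeight i) := by
    intro i hi; rw [← hφ]; exact X_mem_weightPart hi
  fin_cases i
  · rw [add_comm n 1]; exact weightPart_mul_mem_filtration (hmem 0 h0) hu
  · rw [add_comm n 1]; exact weightPart_mul_mem_filtration (hmem 1 h1) hu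
  · exact mul_mem_filtration (commutator_zFamily_mem φ s hφ h h0 h1 hs) hu

theorem exists_mem_filtration
    (hφ : ∀ i, φ (MvPolynomial.X i) = π (zFamily b p q i))
    (h : ∀ u ∈ quadraticRels b p, π u = 0) (h0 : 0 ∈ s) (h1 : 1 ∈ s)
    (hs : ∀ n, n + 1 ∈ s → π (z b p q (n + 1)) ∈ weightPart φ zWeight s (n + 2))
    (y : FreeAlgebra K (Fin 3)) : ∃ n, π y ∈ filtration φ zWeight s (π (x K 2)) n := by
  induction y using freeAlgebra_induction_left with
  | one => exact ⟨0, by rw [map_one]; exact one_mem_filtration⟩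
  | mul i y ih =>
    obtain ⟨n, hn⟩ := ih
    exact ⟨n + 1, by rw [map_mul]; exact gen_mul_mem_filtration φ s hφ h h0 h1 hs i hn⟩
  | add y z hy hz =>
    obtain ⟨m, hm⟩ := hy
    obtain ⟨n, hn⟩ := hz
    exact ⟨max m n, by
      rw [map_add]
      exact add_mem (filtration_mono (le_max_left _ _) hm) (filtration_mono (le_max_right _ _) hn)⟩
  | smul c y hy =>
    obtain ⟨n, hn⟩ := hy
    exact ⟨n, by rw [map_smul]; exact Submodule.smul_mem _ _ hn⟩

theorem pow_le_filtration
    (hφ : ∀ i, φ (MvPolynomial.X i) = π (zFamily b p q i))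
    (h : ∀ u ∈ quadraticRels b p, π u = 0) (h0 : 0 ∈ s) (h1 : 1 ∈ s)
    (hs : ∀ n, n + 1 ∈ s → π (z b p q (n + 1)) ∈ weightPart φ zWeight s (n + 2)) (n : ℕ) :
    (1 ⊔ Submodule.span K (Set.range fun i => π (x K i))) ^ n ≤
      filtration φ zWeight s (π (x K 2)) n := by
  induction n with
  | zero =>
    rw [pow_zero, Submodule.one_le]
    exact one_mem_filtration
  | succ n ih =>
    rw [pow_succ', Submodule.sup_mul, one_mul]
    refine sup_le (ih.trans (filtration_mono (Nat.le_succ n))) ?_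
    rw [Submodule.mul_le]
    intro u hu v hv
    replace hv := ih hv
    refine Submodule.span_induction ?_ ?_ ?_ ?_ hu
    · rintro _ ⟨i, rfl⟩
      exact gen_mul_mem_filtration φ s hφ h h0 h1 hs i hv
    · rw [zero_mul]; exact zero_mem _
    · intro u u' _ _ hu hu'; rw [add_mul]; exact add_mem hu hu'
    · intro c u _ hu; rw [smul_mul_assoc]; exact Submodule.smul_mem _ _ hu

end Family

/-! ### Independence and the comparison with the presented algebra. -/

section Independence

variable {K : Type*} [Field K] [CharZero K] {a b p q k : K} {B : Type*} [Ring B] [Algebra K B]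

-- The combination is grouped by the exponent of `x_3`; each group is a polynomial in `x_1, z_0, …,
-- z_N` that must vanish, and injectivity of the exponents isolates its coefficients.
open MvPolynomial in
theorem R12Derivations.sum_monomial_eq_zero (S : R12Derivations a b p q k B) {N : ℕ}
    (hρ : ∀ n ≤ N, R12Derivations.rho b p q n ≠ 0) {τ : Type*} (f : τ → (ℕ →₀ ℕ) × ℕ)
    (hf : Function.Injective f) (F : Finset τ)
    (hF : ∀ s ∈ F, ∀ i, (f s).1 i ≠ 0 → i ≤ N + 1) (g : τ → K)
    (h : ∑ s ∈ F, g s • (S.φ (zSubst b p q (MvPolynomial.monomial (f s).1 1)) *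
      S.x₃ ^ (f s).2) = 0) :
    ∀ s ∈ F, g s = 0 := by
  classical
  let P : ℕ → MvPolynomial ℕ K := fun j =>
    ∑ s ∈ F with (f s).2 = j, g s • MvPolynomial.monomial (f s).1 1
  let d := F.sup fun s => (f s).2 + 1
  have hd : ∀ s ∈ F, (f s).2 < d := fun s hs =>
    Nat.lt_of_succ_le (Finset.le_sup (f := fun s => (f s).2 + 1) hs)
  have hP : ∀ j, P j ∈ supported K {i | i ≤ N + 1} := by
    intro j
    refine Subalgebra.sum_mem _ fun s hs => Subalgebra.smul_mem _ ?_ _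
    rw [mem_supported]
    intro i hi
    rw [vars_monomial one_ne_zero, Finset.mem_coe, Finsupp.mem_support_iff] at hi
    exact hF s (Finset.mem_filter.1 hs).1 i hi
  have hsum : ∑ j ∈ Finset.range d, S.φ (zSubst b p q (P j)) * S.x₃ ^ j = 0 := by
    rw [← h, ← Finset.sum_fiberwise_of_maps_to (s := F) (t := Finset.range d)
      (g := fun s => (f s).2) fun s hs => Finset.mem_range.2 (hd s hs)]
    refine Finset.sum_congr rfl fun j _ => ?_
    simp only [P, map_sum, Finset.sum_mul]
    refine Finset.sum_congr rfl fun s hs => ?_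
    rw [map_smul, map_smul, smul_mul_assoc, (Finset.mem_filter.1 hs).2]
  intro s hs
  have h0 := S.eq_zero_of_sum_zSubst hρ P hP d hsum (f s).2 (hd s hs)
  have h1 := congrArg (coeff (f s).1) h0
  simp only [P, coeff_sum, coeff_smul, coeff_monomial, coeff_zero] at h1
  rw [Finset.sum_eq_single_of_mem s (by simp [hs])] at h1
  · simpa using h1
  · intro s' hs' hne
    rw [if_neg, smul_zero]
    intro heq
    exact hne (hf (Prod.ext heq (Finset.mem_filter.1 hs').2))

end Independence

section Core

variable {K : Type*} [Field K] {ι : Type*} [Fintype ι] [DecidableEq ι]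
  {r : ι → ι → Matrix ι ι K}

/-- If a set `R` of relations holds in the Nichols algebra, and a family spans the algebra defined
by `R` and is independent in the Nichols algebra, then `R` generates the Nichols ideal and the
family is a basis. -/
theorem nicholsIdeal_eq_span_and_isBasis {R : Set (FreeAlgebra K ι)}
    (hR : ∀ u ∈ R, proj r u = 0) {τ : Type*} (f : τ → FreeAlgebra K ι)
    (hf : LinearIndependent K fun s => proj r (f s))
    (hspan : ∀ y, (TwoSidedIdeal.span R).ringCon.mkₐ (α := K) y ∈
      Submodule.span K (Set.range fun s => (TwoSidedIdeal.span R).ringCon.mkₐ (α := K) (f s))) :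
    nicholsIdeal r = TwoSidedIdeal.span R ∧ IsBasis K fun s => proj r (f s) := by
  have hle : TwoSidedIdeal.span R ≤ nicholsIdeal r :=
    TwoSidedIdeal.span_le.2 fun u hu => proj_eq_zero_iff.1 (hR u hu)
  have key : ∀ y, ∃ c : τ →₀ K, y - Finsupp.linearCombination K f c ∈ TwoSidedIdeal.span R := by
    intro y
    obtain ⟨c, hc⟩ := (Finsupp.mem_span_range_iff_exists_finsupp).1 (hspan y)
    refine ⟨c, ?_⟩
    rw [TwoSidedIdeal.mem_iff, ← RingCon.eq]
    change (TwoSidedIdeal.span R).ringCon.mkₐ (α := K) _ = 0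
    rw [map_sub, ← hc, Finsupp.linearCombination_apply, map_finsuppSum]
    simp only [map_smul, sub_self]
  have hproj : ∀ c : τ →₀ K, proj r (Finsupp.linearCombination K f c) =
      Finsupp.linearCombination K (fun s => proj r (f s)) c := by
    intro c
    rw [Finsupp.linearCombination_apply, map_finsuppSum, Finsupp.linearCombination_apply]
    simp only [map_smul]
  refine ⟨le_antisymm (fun y hy => ?_) hle, hf, ?_⟩
  · obtain ⟨c, hc⟩ := key y
    have h1 := proj_eq_zero_iff.2 (hle hc)
    rw [map_sub, proj_eq_zero_iff.2 hy, zero_sub, neg_eq_zero, hproj] at h1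
    rw [linearIndependent_iff.1 hf c h1, map_zero, sub_zero] at hc
    exact hc
  · rw [eq_top_iff]
    rintro u -
    obtain ⟨y, rfl⟩ := proj_surjective u
    obtain ⟨c, hc⟩ := key y
    have h1 := proj_eq_zero_iff.2 (hle hc)
    rw [map_sub, sub_eq_zero, hproj] at h1
    rw [h1]
    exact Finsupp.mem_span_range_iff_exists_finsupp.2 ⟨c, rfl⟩

end Core

/-! ### Bounds for the Gelfand-Kirillov dimension. -/

section GKdim

open Filter Topology

variable {K A : Type*} [Field K] [Ring A] [Algebra K A]

theorem tendsto_coe_add_div_log (m : ℕ) (c : ℝ) :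
    Tendsto (fun n : ℕ => (((m : ℝ) + c / Real.log n : ℝ) : EReal)) atTop (𝓝 (m : EReal)) := by
  have h : Tendsto (fun n : ℕ => (m : ℝ) + c / Real.log n) atTop (𝓝 ((m : ℝ) + 0)) :=
    tendsto_const_nhds.add
      ((Real.tendsto_log_atTop.comp tendsto_natCast_atTop_atTop).const_div_atTop c)
  rw [add_zero] at h
  exact (continuous_coe_real_ereal.tendsto _).comp h

theorem fg_one : (1 : Submodule K A).FG := by
  rw [Submodule.one_eq_span]
  exact Submodule.fg_span_singleton 1

theorem prod_ofFn_pow_mem {V : Submodule K A} {m : ℕ} (u : Fin m → A) (hu : ∀ i, u i ∈ V)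
    (e : Fin m → ℕ) : (List.ofFn fun i => u i ^ e i).prod ∈ V ^ ∑ i, e i := by
  induction m with
  | zero => simpa using (⟨1, map_one _⟩ : ∃ y, algebraMap K A y = 1)
  | succ m ih =>
    rw [List.ofFn_succ, List.prod_cons, Fin.sum_univ_succ, pow_add]
    exact Submodule.mul_mem_mul (Submodule.pow_mem_pow _ (hu 0) _)
      (ih (fun i => u i.succ) (fun i => hu i.succ) fun i => e i.succ)

/-- Ordered monomials with all `m` exponents at most `n / m` have length at most `n`, so at least
`(n / m + 1) ^ m` independent elements lie in the `n`-th power. -/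
theorem natCast_le_GKdim {m : ℕ} (hm : 0 < m) (u : Fin m → A)
    (hu : LinearIndependent K fun e : Fin m → ℕ => (List.ofFn fun i => u i ^ e i).prod) :
    (m : EReal) ≤ GKdim K A := by
  let W : Submodule K A := Submodule.span K (Set.range u)
  have hW : W.FG := Submodule.fg_span (Set.finite_range u)
  have h1W : (1 ⊔ W).FG := fg_one.sup hW
  have hcard : ∀ n : ℕ, (n / m + 1) ^ m ≤ Module.finrank K ↥((1 ⊔ W) ^ n) := by
    intro n
    have : Module.Finite K ↥((1 ⊔ W) ^ n) := Module.Finite.iff_fg.2 (h1W.pow n)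
    have hmem : ∀ e : Fin m → Fin (n / m + 1),
        (List.ofFn fun i => u i ^ (e i : ℕ)).prod ∈ (1 ⊔ W) ^ n := by
      intro e
      have hle : ∑ i, (e i : ℕ) ≤ n := by
        calc ∑ i, (e i : ℕ) ≤ ∑ _i : Fin m, n / m :=
              Finset.sum_le_sum fun i _ => Nat.lt_succ_iff.1 (e i).2
          _ = m * (n / m) := by simp
          _ ≤ n := Nat.mul_div_le n m
      exact pow_le_pow_right' (le_sup_left : (1 : Submodule K A) ≤ 1 ⊔ W) hle
        (prod_ofFn_pow_mem u
          (fun i => (le_sup_right : W ≤ 1 ⊔ W) (Submodule.subset_span ⟨i, rfl⟩)) _)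
    have hinj : Function.Injective
        fun (e : Fin m → Fin (n / m + 1)) (i : Fin m) => (e i : ℕ) := by
      intro e e' h
      ext i
      exact congrFun h i
    have hli : LinearIndependent K
        fun e : Fin m → Fin (n / m + 1) => (⟨_, hmem e⟩ : ↥((1 ⊔ W) ^ n)) :=
      LinearIndependent.of_comp (Submodule.subtype _) (hu.comp _ hinj)
    have := hli.fintype_card_le_finrank
    simpa using this
  refine le_trans ?_ (le_iSup _ (⟨W, hW⟩ : {W : Submodule K A // W.FG}))
  -- The constant is the logarithm of `m^{-m}` from the bound `(n/m)^m`; it disappears after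
  -- division by `log n`.
  rw [← (tendsto_coe_add_div_log m (-(m * Real.log m))).limsup_eq]
  refine limsup_le_limsup ?_
  filter_upwards [eventually_ge_atTop 2] with n hn
  rw [EReal.coe_le_coe_iff]
  have hn0 : (0 : ℝ) < n := by positivity
  have hm0 : (0 : ℝ) < m := by exact_mod_cast hm
  have hlog : 0 < Real.log n := Real.log_pos (by exact_mod_cast hn)
  have h1 : (n : ℝ) / m ≤ ((n / m + 1 : ℕ) : ℝ) := by
    rw [div_le_iff₀ hm0]
    have : n < (n / m + 1) * m := by
      have h2 := Nat.div_add_mod n m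
      have h3 := Nat.mod_lt n hm
      rw [add_mul, one_mul, mul_comm]
      omega
    exact_mod_cast this.le
  have h2 : (m : ℝ) * (Real.log n - Real.log m) ≤
      Real.log (Module.finrank K ↥((1 ⊔ W) ^ n)) := by
    rw [← Real.log_div hn0.ne' hm0.ne', ← Real.log_pow]
    apply Real.log_le_log (by positivity)
    calc ((n : ℝ) / m) ^ m ≤ ((n / m + 1 : ℕ) : ℝ) ^ m := by gcongr
      _ ≤ _ := by exact_mod_cast hcard n
  rw [le_div_iff₀ hlog, add_mul, div_mul_cancel₀ _ hlog.ne']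
  linarith

/-- Any finite-dimensional `W` lies in a power `k` of `1 + V`, which replaces `n` by `k n` in the
dimension bound; such a rescaling does not change the exponent of growth. -/
theorem GKdim_le_natCast {m : ℕ} (V : Submodule K A) (hV : V.FG)
    (hgen : ∀ y, ∃ n, y ∈ (1 ⊔ V) ^ n)
    (hdim : ∀ n, Module.finrank K ↥((1 ⊔ V) ^ n) ≤ (n + 1) ^ m) : GKdim K A ≤ m := by
  refine iSup_le fun ⟨W, hW⟩ => ?_
  have h1V : (1 ⊔ V).FG := fg_one.sup hV
  have hone : (1 : Submodule K A) ≤ 1 ⊔ V := le_sup_left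
  obtain ⟨k, hk⟩ : ∃ k, W ≤ (1 ⊔ V) ^ k := by
    obtain ⟨s, rfl⟩ := hW
    choose f hf using hgen
    refine ⟨s.sup f, Submodule.span_le.2 fun y hy => ?_⟩
    exact pow_le_pow_right' hone (Finset.le_sup hy) (hf y)
  have hfin : ∀ n, Module.finrank K ↥((1 ⊔ W) ^ n) ≤ (k * n + 1) ^ m := by
    intro n
    have : Module.Finite K ↥((1 ⊔ V) ^ (k * n)) := Module.Finite.iff_fg.2 (h1V.pow _)
    refine le_trans (Submodule.finrank_mono ?_) (hdim (k * n))
    rw [pow_mul]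
    exact pow_le_pow_left' (sup_le (one_le_pow_of_one_le' hone k) hk) n
  rw [← (tendsto_coe_add_div_log m (m * Real.log (k + 1))).limsup_eq]
  refine limsup_le_limsup ?_
  filter_upwards [eventually_ge_atTop 2] with n hn
  rw [EReal.coe_le_coe_iff]
  have hn1 : (1 : ℝ) ≤ n := by exact_mod_cast (by omega : 1 ≤ n)
  have hlog : 0 < Real.log n := Real.log_pos (by exact_mod_cast hn)
  have h1 : ((k * n + 1 : ℕ) : ℝ) ≤ (k + 1) * n := by
    push_cast; linarith
  have h2 : Real.log (Module.finrank K ↥((1 ⊔ W) ^ n)) ≤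
      m * (Real.log (k + 1) + Real.log n) := by
    rw [← Real.log_mul (by positivity) (by positivity), ← Real.log_pow]
    have h3 : (Module.finrank K ↥((1 ⊔ W) ^ n) : ℝ) ≤ ((k + 1) * n) ^ m := by
      calc (Module.finrank K ↥((1 ⊔ W) ^ n) : ℝ) ≤ ((k * n + 1 : ℕ) : ℝ) ^ m := by
            exact_mod_cast hfin n
        _ ≤ _ := by gcongr
    -- For dimension zero the convention `log 0 = 0` applies, and the right-hand side must be seen
    -- to be nonnegative.
    rcases Nat.eq_zero_or_pos (Module.finrank K ↥((1 ⊔ W) ^ n)) with h0 | hpos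
    · rw [h0, Nat.cast_zero, Real.log_zero]
      apply Real.log_nonneg
      apply one_le_pow₀
      nlinarith [(Nat.cast_nonneg k : (0 : ℝ) ≤ k)]
    · exact Real.log_le_log (by exact_mod_cast hpos) h3
  rw [div_le_iff₀ hlog, add_mul, div_mul_cancel₀ _ hlog.ne']
  linarith

end GKdim

/-! ### The numbers `β_n` and the non-vanishing of `ρ_n`. -/

section Beta

variable {K : Type*} [Field K] [CharZero K] {b p q : K}

theorem beta_eq (n : ℕ) :
    beta b p q n = n * ((p - b) / 2 - q - (n : K) * ((b + p) / 2)) := by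
  unfold beta
  ring

theorem beta_eq_zero_iff {n : ℕ} (hn : 1 ≤ n) :
    beta b p q n = 0 ↔ (p - b) / 2 - q - (n : K) * ((b + p) / 2) = 0 := by
  rw [beta_eq, mul_eq_zero, or_iff_right (Nat.cast_ne_zero.2 (by omega))]

theorem half_sub_ne_zero (hb : b ≠ p - 2 * q) : (p - b) / 2 - q ≠ 0 := by
  intro h
  apply hb
  linear_combination -2 * h

/-- `β_n / n` is an affine function of `n` whose value at `0` is `(p-b)/2 - q`, nonzero by `hb`. A
zero forces its slope to be nonzero, and then it is unique. -/
theorem beta_eq_zero_unique (hb : b ≠ p - 2 * q) {m n : ℕ} (hm : 1 ≤ m) (hn : 1 ≤ n)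
    (h : beta b p q m = 0) (h' : beta b p q n = 0) : m = n := by
  rw [beta_eq_zero_iff hm] at h
  rw [beta_eq_zero_iff hn] at h'
  have hs : (b + p) / 2 ≠ 0 := by
    intro h0
    rw [h0, mul_zero, sub_zero] at h
    exact half_sub_ne_zero hb h
  have : ((m : K) - n) * ((b + p) / 2) = 0 := by linear_combination h' - h
  rcases mul_eq_zero.1 this with h1 | h1
  · exact_mod_cast sub_eq_zero.1 h1
  · exact absurd h1 hs

theorem rho_ne_zero (hb : b ≠ p - 2 * q) {n : ℕ}
    (h : ∀ j, 1 ≤ j → j < n → beta b p q j ≠ 0) : R12Derivations.rho b p q n ≠ 0 := by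
  unfold R12Derivations.rho
  refine mul_ne_zero (by exact_mod_cast n.succ_ne_zero) (Finset.prod_ne_zero_iff.2 fun j hj => ?_)
  rcases Nat.eq_zero_or_pos j with rfl | hpos
  · simpa using half_sub_ne_zero hb
  · exact fun h0 => h j hpos (Finset.mem_range.1 hj) ((beta_eq_zero_iff hpos).2 h0)

end Beta

/-! ### The relations in the Nichols algebra and independence of PBW families. -/

section Relations

variable {K : Type*} [Field K] [CharZero K] (a b p q k : K)

theorem proj_quadraticRels {u : FreeAlgebra K (Fin 3)} (hu : u ∈ quadraticRels b p) :
    proj (R12 1 a b p q k) u = 0 := by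
  rcases hu with rfl | rfl
  · rw [map_sub, map_mul, map_mul, sub_eq_zero]
    exact (r12Derivations a b p q k).commute_x₂_x₁
  · have h : proj (R12 1 a b p q k) (x K 2) * proj _ (x K 0) =
        proj _ (x K 0) * proj _ (x K 2) + ((b - p) / 2) • proj _ (x K 0) ^ 2 :=
      (r12Derivations a b p q k).x₃_mul_x₁
    rw [map_add, map_sub, map_mul, map_mul, map_smul, map_pow, h, add_sub_cancel_left, ← add_smul,
      show (b - p) / 2 + (p - b) / 2 = 0 by ring, zero_smul]

theorem proj_zRels {u : FreeAlgebra K (Fin 3)} (hu : u ∈ zRels b p q) :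
    proj (R12 1 a b p q k) u = 0 := by
  obtain ⟨n, rfl⟩ := hu
  simp only [map_sub, map_mul, ← r12Derivations_z]
  exact sub_eq_zero.2 ((r12Derivations a b p q k).commute_z_z _ _)

theorem proj_z_succ_add {N : ℕ} (hN : 1 ≤ N) (h : beta b p q N = 0) :
    proj (R12 1 a b p q k)
      (z b p q (N + 1) + (((N : K) + 1) * ((b + p) / 2)) • (x K 0 * z b p q N)) = 0 := by
  rw [map_add, map_smul, map_mul, ← r12Derivations_z, ← r12Derivations_z]
  exact (r12Derivations a b p q k).z_succ_add ((beta_eq_zero_iff hN).1 h)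

/-- The evaluation of polynomials at the images of `x_1, z_0, z_1, …` in the Nichols algebra. -/
def nicholsEval : MvPolynomial ℕ K →ₐ[K] NicholsAlgebra (R12 1 a b p q k) :=
  (r12Derivations a b p q k).φ.comp (R12Derivations.zSubst b p q)

theorem nicholsEval_X (i : ℕ) :
    nicholsEval a b p q k (MvPolynomial.X i) = proj (R12 1 a b p q k) (zFamily b p q i) := by
  refine ((r12Derivations a b p q k).φ_zSubst_X i).trans ?_
  cases i with
  | zero => rfl
  | succ n => exact r12Derivations_z ..

variable {a b p q k}

/-- The bound `N` may depend on the finite set of indices, so that infinitely many variables `z_n`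
are allowed as well. -/
theorem linearIndependent_proj {τ : Type*} (F : τ → FreeAlgebra K (Fin 3))
    (f : τ → (ℕ →₀ ℕ) × ℕ) (hf : Function.Injective f)
    (hF : ∀ s, proj (R12 1 a b p q k) (F s) =
      nicholsEval a b p q k (MvPolynomial.monomial (f s).1 1) * proj _ (x K 2) ^ (f s).2)
    (hN : ∀ E : Finset τ, ∃ N, (∀ n ≤ N, R12Derivations.rho b p q n ≠ 0) ∧
      ∀ s ∈ E, ∀ i, (f s).1 i ≠ 0 → i ≤ N + 1) :
    LinearIndependent K fun s => proj (R12 1 a b p q k) (F s) := by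
  rw [linearIndependent_iff']
  intro E g hg
  obtain ⟨N, hρ, hE⟩ := hN E
  refine (r12Derivations a b p q k).sum_monomial_eq_zero hρ f hf E hE g ?_
  simp only [hF] at hg
  exact hg

end Relations

/-! ### Indexing of the PBW monomials by exponents. -/

section Exponents

theorem exponent_apply_ne_zero {n : ℕ} {a₁ a₂ : ℕ} {e : Fin n → ℕ} {i : ℕ}
    (h : exponent a₁ a₂ e i ≠ 0) : i ≤ n + 1 := by
  by_contra hi
  obtain ⟨j, rfl⟩ : ∃ j, i = j + 2 := ⟨i - 2, by omega⟩
  exact h (exponent_of_le a₁ a₂ e (by omega))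

theorem exponent_injective (n : ℕ) : Function.Injective
    fun s : ℕ × ℕ × (Fin n → ℕ) × ℕ => (exponent s.1 s.2.1 s.2.2.1, s.2.2.2) := by
  rintro ⟨a₁, a₂, e, a₃⟩ ⟨a₁', a₂', e', a₃'⟩ h
  obtain ⟨h1, rfl⟩ := Prod.ext_iff.1 h
  have h0 := DFunLike.congr_fun h1 0
  have h2 := DFunLike.congr_fun h1 1
  simp only [exponent_zero, exponent_one] at h0 h2
  have h3 : e = e' := funext fun j => by
    have := DFunLike.congr_fun h1 ((j : ℕ) + 2)
    simpa only [exponent_add_two] using this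
  rw [h0, h2, h3]

theorem eq_exponent {n : ℕ} {m : ℕ →₀ ℕ} (h : ∀ i, m i ≠ 0 → i ≤ n + 1) :
    m = exponent (m 0) (m 1) fun j : Fin n => m (j + 2) := by
  ext i
  rcases i with _ | _ | j
  · rw [exponent_zero]
  · rw [exponent_one]
  · by_cases hj : j < n
    · exact (exponent_add_two (m 0) (m 1) (fun j : Fin n => m (j + 2)) ⟨j, hj⟩).symm
    · rw [exponent_of_le _ _ _ (by omega)]
      by_contra h0
      have := h _ h0
      omega

theorem apply_eq_zero_of_sup_succ_le {e : ℕ →₀ ℕ} {j : ℕ} (h : e.support.sup Nat.succ ≤ j) :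
    e j = 0 := by
  by_contra h0
  have := Finset.le_sup (f := Nat.succ) (Finsupp.mem_support_iff.2 h0)
  omega

/-- The exponent of the monomial `BInfty b p q s`. -/
def exponentInfty (s : ℕ × ℕ × (ℕ →₀ ℕ) × ℕ) : ℕ →₀ ℕ :=
  exponent s.1 s.2.1 fun j : Fin (s.2.2.1.support.sup Nat.succ) => s.2.2.1 j

theorem exponentInfty_add_two (s : ℕ × ℕ × (ℕ →₀ ℕ) × ℕ) (j : ℕ) :
    exponentInfty s (j + 2) = s.2.2.1 j := by
  by_cases hj : j < s.2.2.1.support.sup Nat.succ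
  · exact exponent_add_two s.1 s.2.1
      (fun j : Fin (s.2.2.1.support.sup Nat.succ) => s.2.2.1 j) ⟨j, hj⟩
  · rw [exponentInfty, exponent_of_le _ _ _ (not_lt.1 hj),
      apply_eq_zero_of_sup_succ_le (not_lt.1 hj)]

theorem exponentInfty_injective : Function.Injective
    fun s : ℕ × ℕ × (ℕ →₀ ℕ) × ℕ => (exponentInfty s, s.2.2.2) := by
  rintro ⟨a₁, a₂, e, a₃⟩ ⟨a₁', a₂', e', a₃'⟩ h
  obtain ⟨h1, rfl⟩ := Prod.ext_iff.1 h
  have h0 : a₁ = a₁' := by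
    simpa only [exponentInfty, exponent_zero] using DFunLike.congr_fun h1 0
  have h2 : a₂ = a₂' := by
    simpa only [exponentInfty, exponent_one] using DFunLike.congr_fun h1 1
  have h3 : e = e' := Finsupp.ext fun j => by
    simpa only [exponentInfty_add_two] using DFunLike.congr_fun h1 (j + 2)
  rw [h0, h2, h3]

theorem exponentInfty_surjective (m : ℕ →₀ ℕ) (a₃ : ℕ) :
    ∃ s : ℕ × ℕ × (ℕ →₀ ℕ) × ℕ, exponentInfty s = m ∧ s.2.2.2 = a₃ := by
  refine ⟨(m 0, m 1, m.comapDomain (· + 2) (add_left_injective 2).injOn, a₃), ?_, rfl⟩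
  ext i
  rcases i with _ | _ | j
  · rw [exponentInfty, exponent_zero]
  · rw [exponentInfty, exponent_one]
  · rw [exponentInfty_add_two, Finsupp.comapDomain_apply]

end Exponents

/-! ### Presentations and PBW bases. -/

section Presentation

variable {K : Type*} [Field K] {a b p q k : K}

theorem mk_eq_zero {R : Set (FreeAlgebra K (Fin 3))} {u : FreeAlgebra K (Fin 3)} (hu : u ∈ R) :
    (TwoSidedIdeal.span R).ringCon.mkₐ (α := K) u = 0 :=
  (RingCon.eq _).2 ((TwoSidedIdeal.mem_iff _ _).1 (TwoSidedIdeal.subset_span hu))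

/-- The extra relation replaces `z_{N+1}`, the first element outside the allowed variables, by a
multiple of `x_1 z_N`, which has the same weight. -/
theorem mem_weightPart_of_rel {A : Type*} [Ring A] [Algebra K A]
    {π : FreeAlgebra K (Fin 3) →ₐ[K] A} (φ : MvPolynomial ℕ K →ₐ[K] A)
    (hφ : ∀ i, φ (MvPolynomial.X i) = π (zFamily b p q i)) {N : ℕ}
    (h : π (z b p q (N + 1) + (((N : K) + 1) * ((b + p) / 2)) • (x K 0 * z b p q N)) = 0) (n : ℕ)
    (hn : n + 1 ∈ {i | i ≤ N + 1}) :
    π (z b p q (n + 1)) ∈ weightPart φ zWeight {i | i ≤ N + 1} (n + 2) := by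
  have hmem : ∀ i ≤ N + 1, π (zFamily b p q i) ∈ weightPart φ zWeight {i | i ≤ N + 1} (zWeight i) :=
    fun i hi => by rw [← hφ]; exact X_mem_weightPart hi
  rcases (Nat.succ_le_succ_iff.1 hn : n ≤ N).lt_or_eq with hlt | rfl
  · exact hmem (n + 2) (by omega)
  · rw [map_add, map_smul, map_mul] at h
    rw [eq_neg_of_add_eq_zero_left h]
    refine neg_mem (Submodule.smul_mem _ _ ?_)
    have := mul_mem_weightPart (hmem 0 (by omega)) (hmem (n + 1) le_rfl)
    rwa [show zWeight 0 + zWeight (n + 1) = n + 2 by simp only [zWeight]; omega] at this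

/-- The hypotheses quantify over `φ` because the evaluation map on the presented algebra exists only
once its generators are known to commute, which is established inside the proof. -/
theorem mk_mem_span {R : Set (FreeAlgebra K (Fin 3))} (hq : quadraticRels b p ⊆ R)
    (hz : zRels b p q ⊆ R) (s : Set ℕ) (h0 : 0 ∈ s) (h1 : 1 ∈ s)
    (hs : ∀ φ : MvPolynomial ℕ K →ₐ[K] (TwoSidedIdeal.span R).ringCon.Quotient,
      (∀ i, φ (MvPolynomial.X i) =
        (TwoSidedIdeal.span R).ringCon.mkₐ (α := K) (zFamily b p q i)) →
      ∀ n, n + 1 ∈ s → (TwoSidedIdeal.span R).ringCon.mkₐ (α := K) (z b p q (n + 1)) ∈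
        weightPart φ zWeight s (n + 2))
    {τ : Type*} (F : τ → FreeAlgebra K (Fin 3))
    (hF : ∀ (m : ℕ →₀ ℕ) (j : ℕ), (∀ i, m i ≠ 0 → i ∈ s) → ∃ t : τ,
      ∀ φ : MvPolynomial ℕ K →ₐ[K] (TwoSidedIdeal.span R).ringCon.Quotient,
      (∀ i, φ (MvPolynomial.X i) =
        (TwoSidedIdeal.span R).ringCon.mkₐ (α := K) (zFamily b p q i)) →
      (TwoSidedIdeal.span R).ringCon.mkₐ (α := K) (F t) = φ (MvPolynomial.monomial m 1) *
        (TwoSidedIdeal.span R).ringCon.mkₐ (α := K) (x K 2) ^ j)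
    (y : FreeAlgebra K (Fin 3)) :
    (TwoSidedIdeal.span R).ringCon.mkₐ (α := K) y ∈
      Submodule.span K (Set.range fun t => (TwoSidedIdeal.span R).ringCon.mkₐ (α := K) (F t)) := by
  set π := (TwoSidedIdeal.span R).ringCon.mkₐ (α := K)
  have hπq : ∀ u ∈ quadraticRels b p, π u = 0 := fun u hu => mk_eq_zero (hq hu)
  have hπz : ∀ u ∈ zRels b p q, π u = 0 := fun u hu => mk_eq_zero (hz hu)
  let φ : MvPolynomial ℕ K →ₐ[K] _ :=
    commAeval (fun i => π (zFamily b p q i)) (commute_zFamily hπq hπz)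
  have hφ : ∀ i, φ (MvPolynomial.X i) = π (zFamily b p q i) := fun i => commAeval_X _ _ i
  obtain ⟨n, hn⟩ := exists_mem_filtration φ s hφ hπq h0 h1 (hs φ hφ) y
  refine Submodule.span_le.2 ?_ hn
  rintro _ ⟨m, hm, j, -, rfl⟩
  obtain ⟨t, ht⟩ := hF m j fun i hi => mem_of_mem_exponents hm hi
  rw [← ht φ hφ]
  exact Submodule.subset_span ⟨t, rfl⟩

theorem linearIndependent_BFin [CharZero K] {N : ℕ} (hρ : ∀ n ≤ N, R12Derivations.rho b p q n ≠ 0) :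
    LinearIndependent K fun s => proj (R12 1 a b p q k) (BFin b p q N s) :=
  linearIndependent_proj _ (fun s => (exponent s.1 s.2.1 s.2.2.1, s.2.2.2)) (exponent_injective N)
    (fun _ => map_monomial _ (nicholsEval_X a b p q k) _ _ _ _)
    fun _ => ⟨N, hρ, fun _ _ _ => exponent_apply_ne_zero⟩

theorem linearIndependent_BInfty [CharZero K] (hρ : ∀ n, R12Derivations.rho b p q n ≠ 0) :
    LinearIndependent K fun s => proj (R12 1 a b p q k) (BInfty b p q s) :=
  linearIndependent_proj _ (fun s => (exponentInfty s, s.2.2.2)) exponentInfty_injective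
    (fun _ => map_monomial _ (nicholsEval_X a b p q k) _ _ _ _)
    fun E => ⟨E.sup fun s => s.2.2.1.support.sup Nat.succ, fun n _ => hρ n, fun _ hs _ hi =>
      (exponent_apply_ne_zero hi).trans (Nat.succ_le_succ
        (Finset.le_sup (f := fun s : ℕ × ℕ × (ℕ →₀ ℕ) × ℕ => s.2.2.1.support.sup Nat.succ) hs))⟩

theorem presentation_infty [CharZero K] (hρ : ∀ n, R12Derivations.rho b p q n ≠ 0) :
    nicholsIdeal (R12 1 a b p q k) = TwoSidedIdeal.span (quadraticRels b p ∪ zRels b p q) ∧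
      IsBasis K fun s => proj (R12 1 a b p q k) (BInfty b p q s) := by
  refine nicholsIdeal_eq_span_and_isBasis ?_ _ (linearIndependent_BInfty hρ)
    (mk_mem_span (b := b) (p := p) (q := q) Set.subset_union_left Set.subset_union_right
      Set.univ trivial trivial ?_ _ ?_)
  · rintro u (hu | hu)
    exacts [proj_quadraticRels a b p q k hu, proj_zRels a b p q k hu]
  · intro φ hφ n _
    have := X_mem_weightPart (φ := φ) (w := zWeight) (Set.mem_univ (n + 2))
    rwa [hφ] at this
  · intro m j _
    obtain ⟨s, rfl, rfl⟩ := exponentInfty_surjective m j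
    exact ⟨s, fun φ hφ => map_monomial φ hφ _ _ _ _⟩

theorem presentation_fin [CharZero K] {N : ℕ} (hN : 1 ≤ N) (hβ : beta b p q N = 0)
    (hρ : ∀ n ≤ N, R12Derivations.rho b p q n ≠ 0) :
    nicholsIdeal (R12 1 a b p q k) = TwoSidedIdeal.span (quadraticRels b p ∪ zRels b p q ∪
        {z b p q (N + 1) + (((N : K) + 1) * ((b + p) / 2)) • (x K 0 * z b p q N)}) ∧
      IsBasis K fun s => proj (R12 1 a b p q k) (BFin b p q N s) := by
  refine nicholsIdeal_eq_span_and_isBasis ?_ _ (linearIndependent_BFin hρ)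
    (mk_mem_span (b := b) (p := p) (q := q)
      (Set.subset_union_left.trans Set.subset_union_left)
      (Set.subset_union_right.trans Set.subset_union_left) {i | i ≤ N + 1}
      (Nat.zero_le _) (Nat.le_add_left _ _) ?_ _ ?_)
  · rintro u ((hu | hu) | rfl)
    exacts [proj_quadraticRels a b p q k hu, proj_zRels a b p q k hu,
      proj_z_succ_add a b p q k hN hβ]
  · exact fun φ hφ => mem_weightPart_of_rel φ hφ (mk_eq_zero (Set.mem_union_right _ rfl))
  · intro m j hm
    refine ⟨(m 0, m 1, fun i => m (i + 2), j), fun φ hφ => ?_⟩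
    conv_rhs => rw [eq_exponent hm]
    exact map_monomial φ hφ _ _ _ _

end Presentation

/-! ### Growth of the Nichols algebra. -/

section Growth

variable {K : Type*} [Field K] {a b p q k : K}

/-- The elements `x_1, x_2, z_1, …, z_N, x_3`. -/
def pbwGenerators (b p q : K) (N : ℕ) : Fin (N + 1 + 1 + 1) → FreeAlgebra K (Fin 3) :=
  Fin.cons (x K 0) (Fin.cons (x K 1)
    (Fin.snoc (α := fun _ => FreeAlgebra K (Fin 3)) (fun j : Fin N => z b p q (j + 1)) (x K 2)))

theorem prod_pbwGenerators {N : ℕ} (e : Fin (N + 1 + 1 + 1) → ℕ) :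
    (List.ofFn fun i => pbwGenerators b p q N i ^ e i).prod =
      BFin b p q N (e 0, e 1, fun j => e j.castSucc.succ.succ, e (Fin.last _)) := by
  rw [List.ofFn_succ, List.ofFn_succ, List.ofFn_succ', List.concat_eq_append, List.prod_cons,
    List.prod_cons, List.prod_append, List.prod_singleton]
  simp only [pbwGenerators, Fin.cons_zero, Fin.cons_succ, Fin.snoc_castSucc, Fin.snoc_last, BFin,
    monomial, mul_assoc]
  rfl

theorem natCast_le_GKdim_nichols [CharZero K] {N : ℕ}
    (hρ : ∀ n ≤ N, R12Derivations.rho b p q n ≠ 0) :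
    ((N + 3 : ℕ) : EReal) ≤ GKdim K (NicholsAlgebra (R12 1 a b p q k)) := by
  refine natCast_le_GKdim (Nat.succ_pos _)
    (fun i => proj (R12 1 a b p q k) (pbwGenerators b p q N i)) ?_
  have hinj : Function.Injective fun e : Fin (N + 1 + 1 + 1) → ℕ =>
      (e 0, e 1, (fun j : Fin N => e j.castSucc.succ.succ), e (Fin.last _)) := by
    intro e e' h
    simp only [Prod.mk.injEq] at h
    obtain ⟨h0, h1, h2, h3⟩ := h
    funext i
    refine Fin.cases h0 (fun i => Fin.cases h1 (fun i => ?_) i) i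
    exact Fin.lastCases h3 (fun i => congrFun h2 i) i
  have hprod : (fun e : Fin (N + 1 + 1 + 1) → ℕ =>
      (List.ofFn fun i => proj (R12 1 a b p q k) (pbwGenerators b p q N i) ^ e i).prod) =
      (fun s => proj (R12 1 a b p q k) (BFin b p q N s)) ∘ fun e : Fin (N + 1 + 1 + 1) → ℕ =>
        (e 0, e 1, (fun j : Fin N => e j.castSucc.succ.succ), e (Fin.last _)) := by
    funext e
    rw [Function.comp_apply, ← prod_pbwGenerators, map_list_prod, List.map_ofFn]
    simp only [Function.comp_def, map_pow]
  rw [hprod]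
  exact (linearIndependent_BFin hρ).comp _ hinj

theorem exists_mem_pow {ι A : Type*} [Ring A] [Algebra K A] (π : FreeAlgebra K ι →ₐ[K] A)
    (y : FreeAlgebra K ι) :
    ∃ n, π y ∈ (1 ⊔ Submodule.span K (Set.range fun i => π (FreeAlgebra.ι K i))) ^ n := by
  have hone : (1 : Submodule K A) ≤
      1 ⊔ Submodule.span K (Set.range fun i => π (FreeAlgebra.ι K i)) := le_sup_left
  induction y using freeAlgebra_induction_left with
  | one => exact ⟨0, by rw [map_one, pow_zero]; exact Submodule.one_le.1 le_rfl⟩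
  | mul i y ih =>
    obtain ⟨n, hn⟩ := ih
    refine ⟨n + 1, ?_⟩
    rw [map_mul, pow_succ']
    exact Submodule.mul_mem_mul (Submodule.mem_sup_right (Submodule.subset_span ⟨i, rfl⟩)) hn
  | add y z hy hz =>
    obtain ⟨m, hm⟩ := hy
    obtain ⟨n, hn⟩ := hz
    refine ⟨max m n, ?_⟩
    rw [map_add]
    exact add_mem (pow_le_pow_right' hone (le_max_left _ _) hm)
      (pow_le_pow_right' hone (le_max_right _ _) hn)
  | smul c y hy =>
    obtain ⟨n, hn⟩ := hy
    exact ⟨n, by rw [map_smul]; exact Submodule.smul_mem _ _ hn⟩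

/-- All weights are at least 1, so each of the `N + 3` exponents of a monomial in the `n`-th step is
at most `n`. -/
theorem finrank_filtration_le {A : Type*} [Ring A] [Algebra K A] (φ : MvPolynomial ℕ K →ₐ[K] A)
    (t : A) (N n : ℕ) : Module.Finite K ↥(filtration φ zWeight {i | i ≤ N + 1} t n) ∧
      Module.finrank K ↥(filtration φ zWeight {i | i ≤ N + 1} t n) ≤ (n + 1) ^ (N + 3) := by
  classical
  let F : (Fin (n + 1) × Fin (n + 1) × (Fin N → Fin (n + 1)) × Fin (n + 1)) → A := fun s =>
    φ (MvPolynomial.monomial (exponent (s.1 : ℕ) s.2.1 fun j => (s.2.2.1 j : ℕ)) 1) *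
      t ^ (s.2.2.2 : ℕ)
  have hle : filtration φ zWeight {i | i ≤ N + 1} t n ≤ Submodule.span K (Set.range F) := by
    refine Submodule.span_mono ?_
    rintro _ ⟨m, hm, j, hj, rfl⟩
    have hb : ∀ i, m i < n + 1 := fun i => by
      have := Finsupp.le_weight zWeight (s := i) (Nat.one_le_iff_ne_zero.1 (zWeight_pos i)) m
      omega
    refine ⟨(⟨m 0, hb 0⟩, ⟨m 1, hb 1⟩, fun i => ⟨m (i + 2), hb _⟩, ⟨j, by omega⟩), ?_⟩
    conv_rhs => rw [eq_exponent fun i hi => mem_of_mem_exponents hm hi]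
  have : Module.Finite K ↥(Submodule.span K (Set.range F)) :=
    Module.Finite.span_of_finite K (Set.finite_range F)
  refine ⟨Submodule.finiteDimensional_of_le hle, (Submodule.finrank_mono hle).trans ?_⟩
  refine (finrank_range_le_card F).trans (le_of_eq ?_)
  simp only [Fintype.card_prod, Fintype.card_fin, Fintype.card_pi, Finset.prod_const,
    Finset.card_univ]
  ring

theorem GKdim_nichols_le [CharZero K] {N : ℕ} (hN : 1 ≤ N) (hβ : beta b p q N = 0) :
    GKdim K (NicholsAlgebra (R12 1 a b p q k)) ≤ ((N + 3 : ℕ) : EReal) := by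
  let π := proj (R12 1 a b p q k)
  refine GKdim_le_natCast (Submodule.span K (Set.range fun i => π (x K i)))
    (Submodule.fg_span (Set.finite_range _)) (fun u => ?_) fun n => ?_
  · obtain ⟨y, rfl⟩ := proj_surjective u
    exact exists_mem_pow π y
  · have hle := pow_le_filtration (nicholsEval a b p q k) {i | i ≤ N + 1}
      (nicholsEval_X a b p q k) (fun u hu => proj_quadraticRels a b p q k hu) (Nat.zero_le _)
      (Nat.le_add_left _ _)
      (mem_weightPart_of_rel _ (nicholsEval_X a b p q k) (proj_z_succ_add a b p q k hN hβ)) n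
    obtain ⟨hfin, hcard⟩ := finrank_filtration_le (nicholsEval a b p q k) (π (x K 2)) N n
    exact (Submodule.finrank_mono hle).trans hcard

end Growth

end Nichols

end

theorem proposition3p3 {K : Type*} [Field K] [CharZero K] (t a b p q k : K)
    (ht : t = 1) (hb : b ≠ p - 2 * q) :
    ((∀ n : ℕ, 1 ≤ n → Nichols.beta b p q n ≠ 0) →
      Nichols.nicholsIdeal (Nichols.R12 t a b p q k) =
          TwoSidedIdeal.span (Nichols.quadraticRels b p ∪ Nichols.zRels b p q) ∧
        Nichols.IsBasis K
          (fun s => Nichols.proj (Nichols.R12 t a b p q k) (Nichols.BInfty b p q s)) ∧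
        Nichols.GKdim K (Nichols.NicholsAlgebra (Nichols.R12 t a b p q k)) = ⊤) ∧
    ((¬ ∀ n : ℕ, 1 ≤ n → Nichols.beta b p q n ≠ 0) →
      (∃! N : ℕ, 1 ≤ N ∧ Nichols.beta b p q N = 0) ∧
        ∀ N : ℕ, 1 ≤ N → Nichols.beta b p q N = 0 →
          Nichols.nicholsIdeal (Nichols.R12 t a b p q k) =
              TwoSidedIdeal.span (Nichols.quadraticRels b p ∪ Nichols.zRels b p q ∪
                {Nichols.z b p q (N + 1) +
                  (((N : K) + 1) * ((b + p) / 2)) • (Nichols.x K 0 * Nichols.z b p q N)}) ∧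
            Nichols.IsBasis K
              (fun s => Nichols.proj (Nichols.R12 t a b p q k) (Nichols.BFin b p q N s)) ∧
            Nichols.GKdim K (Nichols.NicholsAlgebra (Nichols.R12 t a b p q k)) =
              ((N + 3 : ℕ) : EReal)) := by
  subst ht
  refine ⟨fun hβ => ?_, fun hβ => ?_⟩
  · have hρ : ∀ n, Nichols.R12Derivations.rho b p q n ≠ 0 := fun n =>
      Nichols.rho_ne_zero hb fun j hj _ => hβ j hj
    obtain ⟨hJ, hB⟩ := Nichols.presentation_infty (a := a) (k := k) hρ
    refine ⟨hJ, hB, EReal.eq_top_iff_forall_lt _ |>.2 fun c => ?_⟩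
    obtain ⟨N, hN⟩ := exists_nat_gt c
    -- All `ρ_n` are nonzero, so the lower bound `N + 3` is available for every `N` and exceeds any
    -- real number.
    refine lt_of_lt_of_le ?_ (Nichols.natCast_le_GKdim_nichols (N := N) fun n _ => hρ n)
    have : c < ((N + 3 : ℕ) : ℝ) := by push_cast; linarith
    rw [← EReal.coe_coe_eq_natCast]
    exact EReal.coe_lt_coe_iff.2 this
  · push Not at hβ
    obtain ⟨M, hM, hM0⟩ := hβ
    refine ⟨⟨M, ⟨hM, hM0⟩, fun m hm => Nichols.beta_eq_zero_unique hb hm.1 hM hm.2 hM0⟩, ?_⟩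
    intro N hN hN0
    -- The product for `ρ_n` involves only indices `j < n ≤ N`, which avoid the unique zero `N`.
    have hρ : ∀ n ≤ N, Nichols.R12Derivations.rho b p q n ≠ 0 := fun n hn =>
      Nichols.rho_ne_zero hb fun j hj hjn h0 =>
        (hjn.trans_le hn).ne (Nichols.beta_eq_zero_unique hb hj hN h0 hN0)
    obtain ⟨hJ, hB⟩ := Nichols.presentation_fin (a := a) (k := k) hN hN0 hρ
    exact ⟨hJ, hB, le_antisymm (Nichols.GKdim_nichols_le hN hN0)
      (Nichols.natCast_le_GKdim_nichols hρ)⟩
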